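/- Let $H:\mathbb R\to\mathbb R$ be a smooth, nonnegative, even double-well potential with $xH'(x)<0$ for $0<|x|<1$, $xH'(x)>0$ for $|x|>1$, $H(\pm1)=H'(\pm1)=H'(0)=0$, $H(0)=H(\pm2)=1$, $H''(0)<0<H''(\pm1)$. For $\varepsilon>0$ put $$\tau_\varepsilon=\varepsilon^{-2}e^{-1/\varepsilon^2},\qquad k=\pi^{-1}\sqrt{|H''(0)|\,H''(1)},\qquad \gamma_\varepsilon=Z_\varepsilon^{-1}e^{-H/\varepsilon^2},\quad Z_\varepsilon=\int_{\mathbb R}e^{-H(y)/\varepsilon^2}\,dy ,$$ where $Z_\varepsilon<\infty$ for all $\varepsilon\in(0,\varepsilon_0)$, for some $\varepsilon_0>0$. For each $\varepsilon\in(0,\varepsilon_0)$ let $\rho_\varepsilon:[0,\infty)\times\mathbb R\to[0,\infty)$ be a weak solution of $$\tau_\varepsilon\,\partial_t\rho_\varepsilon=\partial_x\big(\partial_x\rho_\varepsilon+\varepsilon^{-2}\rho_\varepsilon H'\big)$$ with initial datum $\rho_\varepsilon^0$, in the energy class: $u_\varepsilon=\rho_\varepsilon/\gamma_\varepsilon$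 belongs to $C([0,\infty);L^2(\gamma_\varepsilon\,dx))$, and $\int_0^T\!\int_{\mathbb R}\gamma_\varepsilon|\partial_xu_\varepsilon|^2\,dx\,dt<\infty$ for all $T>0$. Assume that the $\rho^0_\varepsilon$ are probability densities that converge weakly-$*$, as $\varepsilon\to0$, to a probability measure $\rho^0$, and that, with constants $C$ and $c>0$ independent of $\varepsilon$, $u^0_\varepsilon=\rho^0_\varepsilon/\gamma_\varepsilon$ satisfies $$\int_{\mathbb R}\gamma_\varepsilon|u^0_\varepsilon|^2\,dx+\int_{\mathbb R}\frac{\gamma_\varepsilon|\partial_xu^0_\varepsilon|^2}{\tau_\varepsilon}\,dx\le C,\qquad u^0_\varepsilon(x)\ge c\quad\text{for all }x\in\mathbb R .$$ Let $0<T<\infty$. For a sequence $\varepsilon_n\to0$ in $(0,\varepsilon_0)$, say that $u\in H^1(0,T)$, with weak derivative $\dot u\in L^2(0,T)$, is the limit of $(\rho_{\varepsilon_n})$ if, for every $t\in[0,T]$, the $\rho_{\varepsilon_n}(t,\cdot)$ are probability densities that converge weakly-$*$ to $\tfrac12\big(u(t)\delta_{+1}+(2-u(t))\delta_{-1}\big)$,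 and if the weak derivatives $\partial_t\rho_{\varepsilon_n}$ exist on $(0,T)\times\mathbb R$, satisfy $\int_0^T\!\int_{\mathbb R}|\partial_t\rho_{\varepsilon_n}|^2/\gamma_{\varepsilon_n}\,dx\,dt<\infty$, and converge weakly-$*$, as measures tested against bounded continuous functions, to $\tfrac12\big(\dot u\,\delta_{+1}-\dot u\,\delta_{-1}\big)$. For $u\in(0,2)$ and $v,w\in\mathbb R$ put $$g_u(v,w)=\frac{v\,w\,\ln\big(u/(2-u)\big)}{2k(u-1)}\quad(u\neq1),\qquad g_1(v,w)=\frac{v\,w}{k},\qquad E(u)=\tfrac12\big(u\ln u+(2-u)\ln(2-u)\big),$$ and $DE(u)v=E'(u)\,v$. Then: (1) Every sequence $\varepsilon_n\to0$ in $(0,\varepsilon_0)$ has a subsequence along which the solutions have a limit $u\in H^1(0,T)$ in this sense. (2) If $u$ is the limit of the solutions along some sequence $\varepsilon_n\to0$ in $(0,\varepsilon_0)$, then there is $\delta>0$ with $\delta\le u(t)\le2-\delta$ for all $t\in[0,T]$, and $\dot u$ minimizes the time-integrated limit Rayleigh functional over $L^2(0,T)$: all the integrals are finite, and $$\int_0^T\Big(\tfrac12g_u(\dot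 u,\dot u)+DE(u)\dot u\Big)dt\;\le\;\int_0^T\Big(\tfrac12g_u(v,v)+DE(u)v\Big)dt\qquad\text{for all }v\in L^2(0,T).$$ Moreover $u$ is differentiable on $[0,T]$ (one-sidedly at the end points) and is the $g$-gradient flow of $E$, i.e. $g_{u(t)}(\dot u(t),v)+DE(u(t))v=0$ for all $v\in\mathbb R$ and $t\in[0,T]$; hence $\dot u=-k(u-1)$ on $[0,T]$, and $u(0)=2\rho^0\big((0,\infty)\big)$. -/

import Mathlib

open MeasureTheory Set Filter Topology
open scoped ContDiff BoundedContinuousFunction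

noncomputable section

namespace KramersLimit

/-- The double-well enthalpy functions `H`. -/
structure IsDoubleWell (H : ℝ → ℝ) : Prop where
  smooth : ContDiff ℝ ∞ H
  nonneg : ∀ x, 0 ≤ H x
  even : ∀ x, H (-x) = H x
  decreasing_inside : ∀ x, 0 < |x| → |x| < 1 → x * deriv H x < 0
  increasing_outside : ∀ x, 1 < |x| → 0 < x * deriv H x
  at_wells : H 1 = 0 ∧ H (-1) = 0
  deriv_at_wells : deriv H 1 = 0 ∧ deriv H (-1) = 0
  deriv_at_zero : deriv H 0 = 0
  at_barrier : H 0 = 1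
  at_two : H 2 = 1 ∧ H (-2) = 1
  barrier_nondegenerate : deriv (deriv H) 0 < 0
  wells_nondegenerate : 0 < deriv (deriv H) 1 ∧ 0 < deriv (deriv H) (-1)

/-- The time scale `τ_ε = ε⁻² exp (-1/ε²)`. -/
def tau (ε : ℝ) : ℝ := (ε ^ 2)⁻¹ * Real.exp (-1 / ε ^ 2)

/-- The rate constant `k = π⁻¹ √(|H''(0)| H''(1))`. -/
def rate (H : ℝ → ℝ) : ℝ :=
  Real.pi⁻¹ * Real.sqrt (|deriv (deriv H) 0| * deriv (deriv H) 1)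

/-- The normalisation `Z_ε = ∫ exp (-H/ε²)`. -/
def partitionFn (H : ℝ → ℝ) (ε : ℝ) : ℝ := ∫ y, Real.exp (-H y / ε ^ 2)

/-- The density `γ_ε = Z_ε⁻¹ exp (-H/ε²)` of the invariant measure. -/
def gam (H : ℝ → ℝ) (ε : ℝ) (x : ℝ) : ℝ :=
  (partitionFn H ε)⁻¹ * Real.exp (-H x / ε ^ 2)

/-- `g` is the weak derivative of `f` on the open set `Ω ⊆ ℝ`. -/
def HasWeakDerivOn (f g : ℝ → ℝ) (Ω : Set ℝ) : Prop :=
  LocallyIntegrableOn f Ω ∧ LocallyIntegrableOn g Ω ∧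
    ∀ ψ : ℝ → ℝ, ContDiff ℝ ∞ ψ → HasCompactSupport ψ → tsupport ψ ⊆ Ω →
      ∫ x in Ω, f x * deriv ψ x = -∫ x in Ω, g x * ψ x

/-- Lebesgue measure on the space-time strip `(0, T) × ℝ`. -/
def stripMeasure (T : ℝ) : Measure (ℝ × ℝ) := (volume.restrict (Ioo 0 T)).prod volume

/-- The weighted space of `f : (0, T) × ℝ → ℝ` with `∫_0^T ∫ f² / γ_ε dx dt < ∞`. -/
def MemL2Strip (H : ℝ → ℝ) (ε T : ℝ) (f : ℝ → ℝ → ℝ) : Prop :=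
  AEStronglyMeasurable (Function.uncurry f) (stripMeasure T) ∧
    Integrable (fun p : ℝ × ℝ => f p.1 p.2 ^ 2 / gam H ε p.2) (stripMeasure T)

/-- The flux `∂_x ρ + ε⁻² ρ H'`, where `r` stands for `∂_x ρ`. -/
def flux (H : ℝ → ℝ) (ε : ℝ) (ρ r : ℝ → ℝ → ℝ) (t x : ℝ) : ℝ :=
  r t x + (ε ^ 2)⁻¹ * ρ t x * deriv H x

/-- `ρ : [0, ∞) × ℝ → [0, ∞)` is a weak solution, in the usual energy class, of
`τ_ε ∂_t ρ = ∂_x (∂_x ρ + ε⁻² ρ H')` with initial datum `ρ0`: with `u = ρ / γ_ε`,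
`u` belongs to `C([0, ∞); L²(γ_ε))` and, because `γ_ε ∂_x u = ∂_x ρ + ε⁻² ρ H'`, the
condition on the flux says that `∂_x u` belongs to `L²((0, T) × ℝ; γ_ε)` for all `T`.
Values of `ρ` at negative times are irrelevant. -/
structure IsSolution (H : ℝ → ℝ) (ε : ℝ) (ρ0 : ℝ → ℝ) (ρ : ℝ → ℝ → ℝ) : Prop where
  nonneg : ∀ t, 0 ≤ t → ∀ x, 0 ≤ ρ t x
  meas : AEStronglyMeasurable (Function.uncurry ρ) ((volume.restrict (Ioi 0)).prod volume)
  meas_slice : ∀ t, 0 ≤ t → AEStronglyMeasurable (ρ t) volume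
  sq_integrable : ∀ t, 0 ≤ t → Integrable (fun x => ρ t x ^ 2 / gam H ε x)
  continuous : ∀ s, 0 ≤ s →
    Tendsto (fun t => ∫ x, (ρ t x - ρ s x) ^ 2 / gam H ε x) (𝓝[Ici 0] s) (𝓝 0)
  initial : ρ 0 =ᵐ[volume] ρ0
  weak_form : ∃ r : ℝ → ℝ → ℝ,
    (∀ᵐ t ∂(volume.restrict (Ioi (0 : ℝ))), HasWeakDerivOn (ρ t) (r t) univ) ∧
    (∀ T, 0 < T → MemL2Strip H ε T (flux H ε ρ r)) ∧
    ∀ ψ : ℝ → ℝ, ContDiff ℝ ∞ ψ → HasCompactSupport ψ → ∀ t, 0 ≤ t →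
      tau ε * ((∫ x, ρ t x * ψ x) - (∫ x, ρ0 x * ψ x))
        = -∫ p, flux H ε ρ r p.1 p.2 * deriv ψ p.2 ∂(stripMeasure t)

/-- The well-preparedness of a probability density `ρ0` with constants `C`, `c`:
for `u0 = ρ0 / γ_ε`,
`∫ γ_ε |u0|² + ∫ γ_ε |∂_x u0|² / τ_ε ≤ C` and `u0 ≥ c`. -/
def WellPrepared (H : ℝ → ℝ) (ε C c : ℝ) (ρ0 : ℝ → ℝ) : Prop :=
  Integrable ρ0 ∧ ∫ x, ρ0 x = 1 ∧
    (∀ x, c ≤ ρ0 x / gam H ε x) ∧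
    ∃ d : ℝ → ℝ, HasWeakDerivOn (fun x => ρ0 x / gam H ε x) d univ ∧
      Integrable (fun x => gam H ε x * (ρ0 x / gam H ε x) ^ 2) ∧
      Integrable (fun x => gam H ε x * d x ^ 2 / tau ε) ∧
      (∫ x, gam H ε x * (ρ0 x / gam H ε x) ^ 2) + (∫ x, gam H ε x * d x ^ 2 / tau ε) ≤ C

/-- `w` is the weak time derivative `∂_t ρ` on `(0, T) × ℝ`. -/
def HasWeakTimeDeriv (T : ℝ) (ρ w : ℝ → ℝ → ℝ) : Prop :=
  ∀ ψ : ℝ × ℝ → ℝ, ContDiff ℝ ∞ ψ → HasCompactSupport ψ →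
    tsupport ψ ⊆ Ioo 0 T ×ˢ univ →
      ∫ p, ρ p.1 p.2 * deriv (fun t => ψ (t, p.2)) p.1 ∂(stripMeasure T)
        = -∫ p, w p.1 p.2 * ψ p ∂(stripMeasure T)

/-- Along the sequence `e n → 0`, the solutions `ρ_ε` have the limit `u ∈ H¹(0, T)` with weak
derivative `du`: for all `t ∈ [0, T]` the probability densities `ρ_ε(t, ·)` converge weakly-* to
`½ (u(t) δ₁ + (2 - u(t)) δ₋₁)`, and `∂_t ρ_ε` (which belongs to the weighted space `L²_ε`)
converges weakly-* as a measure on `[0, T] × ℝ` to `½ (du δ₁ - du δ₋₁)`. -/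
structure IsLimit (H : ℝ → ℝ) (T : ℝ) (ρ : ℝ → ℝ → ℝ → ℝ) (e : ℕ → ℝ) (u du : ℝ → ℝ) :
    Prop where
  memLp : MemLp u 2 (volume.restrict (Ioo 0 T))
  memLp_deriv : MemLp du 2 (volume.restrict (Ioo 0 T))
  weak_deriv : HasWeakDerivOn u du (Ioo 0 T)
  mass : ∀ n, ∀ t ∈ Icc 0 T, ∫ x, ρ (e n) t x = 1
  tendsto_density : ∀ t ∈ Icc 0 T, ∀ ψ : ℝ →ᵇ ℝ,
    Tendsto (fun n => ∫ x, ρ (e n) t x * ψ x) atTop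
      (𝓝 ((1 / 2) * (u t * ψ 1 + (2 - u t) * ψ (-1))))
  tendsto_time_deriv : ∃ w : ℕ → ℝ → ℝ → ℝ,
    (∀ n, MemL2Strip H (e n) T (w n) ∧ HasWeakTimeDeriv T (ρ (e n)) (w n)) ∧
    ∀ ψ : (ℝ × ℝ) →ᵇ ℝ,
      Tendsto (fun n => ∫ p, w n p.1 p.2 * ψ p ∂(stripMeasure T)) atTop
        (𝓝 (∫ t in Ioo 0 T, (1 / 2) * (du t * ψ (t, 1) - du t * ψ (t, -1))))

/-- The limit metric tensor `g_u(v, w) = v w ln (u / (2 - u)) / (2 k (u - 1))`, with its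
continuous extension `g_1(v, w) = v w / k`. -/
def limitMetric (k u v w : ℝ) : ℝ :=
  if u = 1 then v * w / k else v * w * Real.log (u / (2 - u)) / (2 * k * (u - 1))

/-- The limit energy `E(u) = ½ (u ln u + (2 - u) ln (2 - u))`. -/
def limitEnergy (u : ℝ) : ℝ := (1 / 2) * (u * Real.log u + (2 - u) * Real.log (2 - u))

/-- The integrand `½ g_u(v, v) + DE(u) v` of the limit Rayleigh functional. -/
def rayleighDensity (k u v : ℝ) : ℝ :=
  (1 / 2) * limitMetric k u v v + deriv limitEnergy u * v

/-- `d` minimizes `∫_0^T (½ g_u(v, v) + DE(u) v) dt` over all `v ∈ L²(0, T)`, the integrals being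
finite. -/
def IsRayleighMinimizer (k T : ℝ) (u d : ℝ → ℝ) : Prop :=
  MemLp d 2 (volume.restrict (Ioo 0 T)) ∧
  IntegrableOn (fun t => rayleighDensity k (u t) (d t)) (Ioo 0 T) ∧
  ∀ v : ℝ → ℝ, MemLp v 2 (volume.restrict (Ioo 0 T)) →
    IntegrableOn (fun t => rayleighDensity k (u t) (v t)) (Ioo 0 T) ∧
    ∫ t in Ioo 0 T, rayleighDensity k (u t) (d t)
      ≤ ∫ t in Ioo 0 T, rayleighDensity k (u t) (v t)

/-- `u : [0, T] → (0, 2)` is the `g`-gradient flow of the limit energy: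
`g_u(u̇, v) + DE(u) v = 0` for all `v ∈ ℝ` and all times (one-sided derivatives at the end
points). -/
def IsLimitGradientFlow (k T : ℝ) (u : ℝ → ℝ) : Prop :=
  ∀ t ∈ Icc 0 T, u t ∈ Ioo (0 : ℝ) 2 ∧
    ∃ d, HasDerivWithinAt u d (Icc 0 T) t ∧
      ∀ v, limitMetric k (u t) d v + deriv limitEnergy (u t) * v = 0

end KramersLimit

end

/-!
Dividing `ρ_ε` by `√γ_ε` turns the equation into `τ_ε V' = -D* D V` in `L²`. Its energy estimates
keep `‖V‖² ≤ C` and `‖D V‖² ≤ C τ_ε`, so the mass of `ρ_ε(t)` stays where `γ_ε` concentrates, at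
the wells, and only the difference `D_ε(t)` of the masses of the two wells has to be followed.
Testing the equation with the committor function, which is harmonic between the wells, leaves on
the right-hand side the flux between the wells, and testing the small gradient `D V` with the
plateau function expresses this flux by `D_ε` itself. The result is
`D_ε(t) - D_ε(0) = -K_ε ∫_0^t D_ε + o(1)` with `K_ε → k` by Kramers' formula, so that
`u(t) = 1 + lim D_ε(t)` solves `u̇ = -k (u - 1)`: the limit exists along the whole family.
The time derivative `V'` satisfies `∫ ‖V'‖² ≤ C`, because `V` starts with energy of order `τ_ε`;
this uniform bound reduces the convergence of `∂_t ρ_ε` to smooth test functions, dense in the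
limit norm. Finally `DE(u) = g_u(k (u - 1), ·)`, so completing the square in the Rayleigh functional
gives the minimality of `u̇`.
-/

noncomputable section

namespace KramersLimit

open scoped RealInnerProductSpace

/-- `f` is an absolutely continuous primitive of the locally integrable function `f'`, normalised
through the value `f 0`. -/
structure IsPrimitive (f f' : ℝ → ℝ) : Prop where
  locallyIntegrable : LocallyIntegrable f'
  eq_add_integral : ∀ x, f x = f 0 + ∫ y in (0 : ℝ)..x, f' y

namespace IsPrimitive

variable {f f' g g' : ℝ → ℝ}

lemma const_add_integral (hf : LocallyIntegrable f') (a : ℝ) :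
    IsPrimitive (fun x => a + ∫ y in (0 : ℝ)..x, f' y) f' :=
  ⟨hf, fun x => by simp⟩

lemma of_contDiff (hf : ContDiff ℝ 1 f) : IsPrimitive f (deriv f) := by
  have hc : Continuous (deriv f) := hf.continuous_deriv le_rfl
  refine ⟨hc.locallyIntegrable, fun x => ?_⟩
  rw [intervalIntegral.integral_deriv_eq_sub (fun y _ => (hf.differentiable one_ne_zero) y)
    (hc.intervalIntegrable _ _)]
  ring

lemma intervalIntegrable (hf : IsPrimitive f f') (a b : ℝ) : IntervalIntegrable f' volume a b :=
  (hf.locallyIntegrable.integrableOn_isCompact isCompact_uIcc).intervalIntegrable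

lemma eq_const_add_integral (hf : IsPrimitive f f') :
    f = fun x => f 0 + ∫ y in (0 : ℝ)..x, f' y :=
  funext hf.eq_add_integral

lemma integral_eq_sub (hf : IsPrimitive f f') (a b : ℝ) : ∫ y in a..b, f' y = f b - f a := by
  rw [hf.eq_add_integral a, hf.eq_add_integral b, add_sub_add_left_eq_sub,
    intervalIntegral.integral_interval_sub_left] <;> exact hf.intervalIntegrable _ _

lemma continuous (hf : IsPrimitive f f') : Continuous f := by
  rw [hf.eq_const_add_integral]
  exact continuous_const.add (intervalIntegral.continuous_primitive hf.intervalIntegrable 0)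

lemma absolutelyContinuous (hf : IsPrimitive f f') (a b : ℝ) :
    AbsolutelyContinuousOnInterval f a b := by
  have hconst : AbsolutelyContinuousOnInterval (fun _ => f a) a b :=
    (LipschitzWith.const (f a)).lipschitzOnWith.absolutelyContinuousOnInterval
  have hint := (hf.intervalIntegrable a b).absolutelyContinuousOnInterval_intervalIntegral
    (c := a) left_mem_uIcc
  have h_eq : f = (fun _ => f a) + fun x => ∫ y in a..x, f' y := by
    ext x
    rw [Pi.add_apply, hf.integral_eq_sub, add_sub_cancel]
  rw [h_eq]
  exact hconst.add hint

lemma ae_hasDerivAt (hf : IsPrimitive f f') : ∀ᵐ x, HasDerivAt f (f' x) x := by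
  filter_upwards [LocallyIntegrable.ae_hasDerivAt_integral hf.locallyIntegrable] with x hx
  rw [hf.eq_const_add_integral]
  exact (hx 0).const_add _

lemma zero : IsPrimitive 0 0 := ⟨locallyIntegrable_zero, by simp⟩

lemma add (hf : IsPrimitive f f') (hg : IsPrimitive g g') : IsPrimitive (f + g) (f' + g') := by
  refine ⟨hf.locallyIntegrable.add hg.locallyIntegrable, fun x => ?_⟩
  simp only [Pi.add_apply]
  rw [intervalIntegral.integral_add (hf.intervalIntegrable _ _) (hg.intervalIntegrable _ _),
    hf.eq_add_integral x, hg.eq_add_integral x]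
  ring

lemma const_mul (a : ℝ) (hf : IsPrimitive f f') :
    IsPrimitive (fun x => a * f x) fun x => a * f' x := by
  refine ⟨hf.locallyIntegrable.smul a, fun x => ?_⟩
  rw [intervalIntegral.integral_const_mul, hf.eq_add_integral x]
  ring

lemma mul (hf : IsPrimitive f f') (hg : IsPrimitive g g') :
    IsPrimitive (fun x => f x * g x) fun x => f' x * g x + f x * g' x := by
  have hloc : LocallyIntegrable fun x => f' x * g x + f x * g' x := by
    simp only [← locallyIntegrableOn_univ]
    exact ((hf.locallyIntegrable.locallyIntegrableOn univ).mul_continuousOn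
      hg.continuous.continuousOn isClosed_univ.isLocallyClosed).add
      ((hg.locallyIntegrable.locallyIntegrableOn univ).continuousOn_mul
        hf.continuous.continuousOn isClosed_univ.isLocallyClosed)
  refine ⟨hloc, fun x => ?_⟩
  have hsub := AbsolutelyContinuousOnInterval.integral_deriv_mul_eq_sub
    (hf.absolutelyContinuous 0 x) (hg.absolutelyContinuous 0 x)
  have hcongr : ∫ y in (0 : ℝ)..x, (deriv f y * g y + f y * deriv g y) =
      ∫ y in (0 : ℝ)..x, (f' y * g y + f y * g' y) := by
    refine intervalIntegral.integral_congr_ae ?_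
    filter_upwards [hf.ae_hasDerivAt, hg.ae_hasDerivAt] with y hfy hgy _
    rw [hfy.deriv, hgy.deriv]
  rw [← hcongr, hsub]
  ring

lemma tendsto_zero_atTop (hf : IsPrimitive f f') (hi : Integrable f) (hi' : Integrable f') :
    Tendsto f atTop (𝓝 0) := by
  have hlim : Tendsto f atTop (𝓝 (f 0 + ∫ y in Ioi (0 : ℝ), f' y)) :=
    ((intervalIntegral_tendsto_integral_Ioi 0 hi'.integrableOn tendsto_id).const_add
      (f 0)).congr fun x => (hf.eq_add_integral x).symm
  have h_zero := IntegrableAtFilter.eq_zero_of_tendsto (hi.integrableAtFilter atTop)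
    (fun s hs => by
      obtain ⟨a, ha⟩ := mem_atTop_sets.1 hs
      exact measure_mono_top (s₁ := Ici a) ha Real.volume_Ici) hlim
  rwa [h_zero] at hlim

lemma tendsto_zero_atBot (hf : IsPrimitive f f') (hi : Integrable f) (hi' : Integrable f') :
    Tendsto f atBot (𝓝 0) := by
  have hlim : Tendsto f atBot (𝓝 (f 0 - ∫ y in Iic (0 : ℝ), f' y)) :=
    ((intervalIntegral_tendsto_integral_Iic 0 hi'.integrableOn tendsto_id).const_sub
      (f 0)).congr fun x => by rw [hf.integral_eq_sub, id, sub_sub_cancel]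
  have h_zero := IntegrableAtFilter.eq_zero_of_tendsto (hi.integrableAtFilter atBot)
    (fun s hs => by
      obtain ⟨a, ha⟩ := mem_atBot_sets.1 hs
      exact measure_mono_top (s₁ := Iic a) ha Real.volume_Iic) hlim
  rwa [h_zero] at hlim

lemma integral_eq_zero (hf : IsPrimitive f f') (hi : Integrable f) (hi' : Integrable f') :
    ∫ x, f' x = 0 := by
  have h_lim := (hf.tendsto_zero_atTop hi hi').sub (hf.tendsto_zero_atBot hi hi' |>.comp
    tendsto_neg_atTop_atBot)
  rw [sub_zero] at h_lim
  refine tendsto_nhds_unique (intervalIntegral_tendsto_integral hi' tendsto_neg_atTop_atBot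
    tendsto_id) (h_lim.congr fun x => ?_)
  rw [hf.integral_eq_sub, id, Function.comp_apply]

lemma integral_mul_add_integral_mul_eq_zero (hf : IsPrimitive f f') (hg : IsPrimitive g g')
    (hf'g : Integrable fun x => f' x * g x) (hfg' : Integrable fun x => f x * g' x)
    (hfg : Integrable fun x => f x * g x) :
    (∫ x, f' x * g x) + ∫ x, f x * g' x = 0 := by
  rw [← integral_add hf'g hfg']
  exact (hf.mul hg).integral_eq_zero hfg (hf'g.add hfg')

end IsPrimitive

section WeakDerivatives

lemma integrable_mul_of_hasCompactSupport {f g : ℝ → ℝ} (hf : LocallyIntegrable f)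
    (hg : Continuous g) (hgs : HasCompactSupport g) : Integrable fun x => f x * g x := by
  simpa only [smul_eq_mul, mul_comm] using hf.integrable_smul_left_of_hasCompactSupport hg hgs

lemma setIntegral_mul_eq_integral_of_tsupport_subset {f ψ : ℝ → ℝ} {Ω : Set ℝ}
    (hΩ : tsupport ψ ⊆ Ω) : ∫ x in Ω, f x * ψ x = ∫ x, f x * ψ x :=
  setIntegral_eq_integral_of_forall_compl_eq_zero fun x hx => by
    rw [image_eq_zero_of_notMem_tsupport fun h => hx (hΩ h), mul_zero]

lemma hasWeakDerivOn_univ {f g : ℝ → ℝ} :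
    HasWeakDerivOn f g univ ↔ LocallyIntegrable f ∧ LocallyIntegrable g ∧
      ∀ ψ : ℝ → ℝ, ContDiff ℝ ∞ ψ → HasCompactSupport ψ →
        ∫ x, f x * deriv ψ x = -∫ x, g x * ψ x := by
  simp only [HasWeakDerivOn, locallyIntegrableOn_univ, Measure.restrict_univ, subset_univ,
    true_imp_iff]

lemma IsPrimitive.hasWeakDerivOn {f f' : ℝ → ℝ} (hf : IsPrimitive f f') (Ω : Set ℝ) :
    HasWeakDerivOn f f' Ω := by
  refine ⟨hf.continuous.locallyIntegrable.locallyIntegrableOn Ω,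
    hf.locallyIntegrable.locallyIntegrableOn Ω, fun ψ hψ hψs hψΩ => ?_⟩
  have hψ' : Continuous (deriv ψ) := hψ.continuous_deriv (by simp)
  have h_parts := hf.integral_mul_add_integral_mul_eq_zero
    (IsPrimitive.of_contDiff (hψ.of_le (by simp)))
    (integrable_mul_of_hasCompactSupport hf.locallyIntegrable hψ.continuous hψs)
    (integrable_mul_of_hasCompactSupport hf.continuous.locallyIntegrable hψ' hψs.deriv)
    (integrable_mul_of_hasCompactSupport hf.continuous.locallyIntegrable hψ.continuous hψs)
  rw [setIntegral_mul_eq_integral_of_tsupport_subset hψΩ,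
    setIntegral_mul_eq_integral_of_tsupport_subset ((tsupport_deriv_subset).trans hψΩ)]
  linarith

lemma HasWeakDerivOn.ae_eq {f g g' : ℝ → ℝ} {Ω : Set ℝ} (hΩ : IsOpen Ω)
    (h : HasWeakDerivOn f g Ω) (h' : HasWeakDerivOn f g' Ω) : g =ᵐ[volume.restrict Ω] g' := by
  have h_zero := hΩ.ae_eq_zero_of_integral_contDiff_smul_eq_zero (h.2.1.sub h'.2.1)
    fun ψ hψ hψs hψΩ => by
      have hi : ∀ d : ℝ → ℝ, LocallyIntegrableOn d Ω → Integrable fun x => d x * ψ x := by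
        intro d hd
        have hK : IntegrableOn (fun x => d x * ψ x) (tsupport ψ) :=
          (hd.integrableOn_compact_subset hψΩ hψs).mul_continuousOn hψ.continuous.continuousOn hψs
        exact (integrableOn_iff_integrable_of_support_subset fun x hx =>
          subset_tsupport ψ (right_ne_zero_of_mul hx)).1 hK
      have h_eq := (h.2.2 ψ hψ hψs hψΩ).symm.trans (h'.2.2 ψ hψ hψs hψΩ)
      simp only [setIntegral_mul_eq_integral_of_tsupport_subset hψΩ, neg_inj] at h_eq
      simp only [Pi.sub_apply, smul_eq_mul, mul_comm (ψ _), sub_mul]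
      rw [integral_sub (hi g h.2.1) (hi g' h'.2.1), h_eq, sub_self]
  rw [EventuallyEq, ae_restrict_iff' hΩ.measurableSet]
  filter_upwards [h_zero] with x hx hxΩ
  exact sub_eq_zero.1 (hx hxΩ)

lemma HasWeakDerivOn.congr {f₁ f₂ g : ℝ → ℝ} {Ω : Set ℝ} (hΩ : MeasurableSet Ω)
    (h : HasWeakDerivOn f₁ g Ω) (hf : EqOn f₁ f₂ Ω) : HasWeakDerivOn f₂ g Ω := by
  refine ⟨fun x hx => ?_, h.2.1, fun ψ hψ hψs hψΩ => ?_⟩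
  · obtain ⟨s, hs, hi⟩ := h.1 x hx
    exact ⟨s ∩ Ω, inter_mem hs self_mem_nhdsWithin, (hi.mono_set inter_subset_left).congr
      (ae_restrict_of_ae_restrict_of_subset inter_subset_right
        ((ae_restrict_iff' hΩ).2 (ae_of_all _ hf)))⟩
  · rw [← h.2.2 ψ hψ hψs hψΩ]
    exact setIntegral_congr_fun hΩ fun x hx => by rw [hf hx]

lemma exists_hasCompactSupport_deriv_eq {G : ℝ → ℝ} (hG : ContDiff ℝ ∞ G)
    (hGs : HasCompactSupport G) (hG0 : ∫ x, G x = 0) :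
    ∃ ψ : ℝ → ℝ, ContDiff ℝ ∞ ψ ∧ HasCompactSupport ψ ∧ deriv ψ = G := by
  have hGi : Integrable G := hG.continuous.integrable_of_hasCompactSupport hGs
  set ψ : ℝ → ℝ := fun x => ∫ y in Iic x, G y
  have hψd : ∀ x, HasDerivAt ψ (G x) x := by
    intro x
    have h_split : ψ = fun x => (∫ y in Iic (0 : ℝ), G y) + ∫ y in (0 : ℝ)..x, G y := by
      ext x
      rw [← intervalIntegral.integral_Iic_sub_Iic hGi.integrableOn hGi.integrableOn]
      ring
    rw [h_split]
    exact (hG.continuous.integral_hasStrictDerivAt 0 x).hasDerivAt.const_add _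
  have hψ' : deriv ψ = G := funext fun x => (hψd x).deriv
  refine ⟨ψ, contDiff_infty_iff_deriv.2 ⟨fun x => (hψd x).differentiableAt, hψ' ▸ hG⟩, ?_, hψ'⟩
  obtain ⟨R, hR⟩ := hGs.isCompact.isBounded.subset_closedBall 0
  have hG_out : ∀ y, R < |y| → G y = 0 := fun y hy =>
    image_eq_zero_of_notMem_tsupport fun hy' => by
      have := hR hy'
      rw [mem_closedBall_zero_iff, Real.norm_eq_abs] at this
      linarith
  refine HasCompactSupport.intro (isCompact_closedBall 0 R) fun x hx => ?_
  rw [mem_closedBall_zero_iff, Real.norm_eq_abs, not_le] at hx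
  rcases lt_abs.1 hx with hx | hx
  · refine (setIntegral_eq_integral_of_forall_compl_eq_zero fun y hy => ?_).trans hG0
    exact hG_out y (lt_abs.2 (Or.inl (hx.trans (not_le.1 hy))))
  · refine setIntegral_eq_zero_of_forall_eq_zero fun y hy => ?_
    exact hG_out y (lt_abs.2 (Or.inr (hx.trans_le (neg_le_neg hy))))

/-- The du Bois-Reymond lemma. -/
lemma ae_eq_const_of_hasWeakDerivOn_zero {f : ℝ → ℝ} (hf : HasWeakDerivOn f 0 univ) :
    ∃ a : ℝ, f =ᵐ[volume] fun _ => a := by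
  obtain ⟨hf, -, hf0⟩ := hasWeakDerivOn_univ.1 hf
  obtain ⟨b⟩ : Nonempty (ContDiffBump (0 : ℝ)) := inferInstance
  set η : ℝ → ℝ := b.normed volume
  have hη : ContDiff ℝ ∞ η := b.contDiff_normed
  have hηs : HasCompactSupport η := b.hasCompactSupport_normed
  have hηi : Integrable η := hη.continuous.integrable_of_hasCompactSupport hηs
  have hfη := integrable_mul_of_hasCompactSupport hf hη.continuous hηs
  refine ⟨∫ x, f x * η x, ae_eq_of_integral_contDiff_smul_eq hf (locallyIntegrable_const _) ?_⟩
  intro g hg hgs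
  have hgi : Integrable g := hg.continuous.integrable_of_hasCompactSupport hgs
  have hfg := integrable_mul_of_hasCompactSupport hf hg.continuous hgs
  -- Subtracting a multiple of `η` gives `g` vanishing mean, hence makes it a derivative.
  obtain ⟨ψ, hψ, hψs, hψ'⟩ := exists_hasCompactSupport_deriv_eq
    (G := fun x => g x - (∫ y, g y) * η x) (hg.sub (contDiff_const.mul hη))
    (hgs.sub hηs.mul_left) (by
      rw [integral_sub hgi (hηi.const_mul _), integral_const_mul, b.integral_normed, mul_one,
        sub_self])
  have h_test := hf0 ψ hψ hψs
  simp only [hψ', mul_sub, mul_left_comm (f _), Pi.zero_apply, zero_mul, integral_zero, neg_zero]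
    at h_test
  rw [integral_sub hfg (hfη.const_mul _), integral_const_mul, sub_eq_zero] at h_test
  simp only [smul_eq_mul, integral_mul_const]
  simpa only [mul_comm (g _)] using h_test

lemma HasWeakDerivOn.exists_isPrimitive {f g : ℝ → ℝ} (h : HasWeakDerivOn f g univ) :
    ∃ F, IsPrimitive F g ∧ f =ᵐ[volume] F := by
  obtain ⟨hf, hg, hfg⟩ := hasWeakDerivOn_univ.1 h
  set F₀ : ℝ → ℝ := fun x => 0 + ∫ y in (0 : ℝ)..x, g y
  have hF₀ : IsPrimitive F₀ g := IsPrimitive.const_add_integral hg 0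
  have hF₀l : LocallyIntegrable F₀ := hF₀.continuous.locallyIntegrable
  obtain ⟨-, -, hF₀g⟩ := hasWeakDerivOn_univ.1 (hF₀.hasWeakDerivOn univ)
  have h_sub : HasWeakDerivOn (f - F₀) 0 univ := by
    refine hasWeakDerivOn_univ.2 ⟨hf.sub hF₀l, locallyIntegrable_zero, fun ψ hψ hψs => ?_⟩
    have hψ' : Continuous (deriv ψ) := hψ.continuous_deriv (by simp)
    simp only [Pi.sub_apply, sub_mul, Pi.zero_apply, zero_mul, integral_zero, neg_zero]
    rw [integral_sub (integrable_mul_of_hasCompactSupport hf hψ' hψs.deriv)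
      (integrable_mul_of_hasCompactSupport hF₀l hψ' hψs.deriv), hfg ψ hψ hψs, hF₀g ψ hψ hψs,
      sub_self]
  obtain ⟨a, ha⟩ := ae_eq_const_of_hasWeakDerivOn_zero h_sub
  refine ⟨_, IsPrimitive.const_add_integral hg a, ?_⟩
  filter_upwards [ha] with x hx
  rw [← hx, Pi.sub_apply]
  simp only [F₀, zero_add, sub_add_cancel]

end WeakDerivatives

section Laplace

variable {f g : ℝ → ℝ} {x₀ : ℝ}

lemma tendsto_div_sq_of_contDiff (hf : ContDiff ℝ 2 f) (h0 : f x₀ = 0) (h1 : deriv f x₀ = 0) :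
    Tendsto (fun x => f x / (x - x₀) ^ 2) (𝓝[≠] x₀) (𝓝 (deriv (deriv f) x₀ / 2)) := by
  have h := Real.taylor_tendsto (n := 2) (s := univ) convex_univ (mem_univ x₀) hf.contDiffOn
  rw [nhdsWithin_univ] at h
  have h' := (h.mono_left (nhdsWithin_le_nhds (s := {x₀}ᶜ))).add_const (deriv (deriv f) x₀ / 2)
  rw [zero_add] at h'
  refine h'.congr' ?_
  filter_upwards [self_mem_nhdsWithin] with x hx
  have hx' : x - x₀ ≠ 0 := sub_ne_zero.2 hx
  rw [taylorWithinEval_succ, taylorWithinEval_succ, taylor_within_zero_eval]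
  simp only [iteratedDerivWithin_univ, iteratedDeriv_succ, iteratedDeriv_zero, h0, h1]
  field_simp
  norm_num
  ring

lemma eventually_forall_ball_mul_sq_le {b c : ℝ} (h0 : f x₀ = 0)
    (hfx : Tendsto (fun x => f x / (x - x₀) ^ 2) (𝓝[≠] x₀) (𝓝 b)) (hc : c < b) :
    ∀ᶠ r in 𝓝[>] 0, ∀ x ∈ Metric.ball x₀ r, c * (x - x₀) ^ 2 ≤ f x := by
  obtain ⟨R, hR, h⟩ := Metric.eventually_nhds_iff_ball.1
    (eventually_nhdsWithin_iff.1 (hfx.eventually (lt_mem_nhds hc)))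
  filter_upwards [Ioc_mem_nhdsGT hR] with r hr x hx
  rcases eq_or_ne x x₀ with rfl | hxx
  · simp [h0]
  · have hpos : 0 < (x - x₀) ^ 2 := sq_pos_of_ne_zero (sub_ne_zero.2 hxx)
    exact ((lt_div_iff₀ hpos).1 (h x (Metric.ball_subset_ball hr.2 hx) hxx)).le

lemma tendsto_comp_rescale_div_sq {b : ℝ} (h0 : f x₀ = 0)
    (hfx : Tendsto (fun x => f x / (x - x₀) ^ 2) (𝓝[≠] x₀) (𝓝 b)) (y : ℝ) :
    Tendsto (fun ε => f (x₀ + ε * y) / ε ^ 2) (𝓝[>] 0) (𝓝 (b * y ^ 2)) := by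
  rcases eq_or_ne y 0 with rfl | hy
  · simp [h0]
  have hlin : Tendsto (fun ε : ℝ => x₀ + ε * y) (𝓝[>] 0) (𝓝[≠] x₀) := by
    refine tendsto_nhdsWithin_iff.2 ⟨?_, ?_⟩
    · have h := (Continuous.tendsto (f := fun ε : ℝ => x₀ + ε * y) (by fun_prop) 0).mono_left
        (nhdsWithin_le_nhds (s := Ioi 0))
      rwa [zero_mul, add_zero] at h
    · filter_upwards [self_mem_nhdsWithin] with ε (hε : 0 < ε)
      simp [hε.ne', hy]
  refine ((hfx.comp hlin).mul_const (y ^ 2)).congr' ?_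
  filter_upwards [self_mem_nhdsWithin] with ε (hε : 0 < ε)
  rw [Function.comp_apply]
  field_simp
  ring

lemma inv_mul_exp_neg_div_sq_le {m ε : ℝ} (hm : 0 < m) (hε : 0 < ε) :
    ε⁻¹ * Real.exp (-m / ε ^ 2) ≤ ε / m := by
  have h_exp : Real.exp (-m / ε ^ 2) ≤ ε ^ 2 / m := by
    rw [neg_div, Real.exp_neg, ← inv_div m]
    exact inv_anti₀ (by positivity) (by linarith [Real.add_one_le_exp (m / ε ^ 2)])
  calc ε⁻¹ * Real.exp (-m / ε ^ 2) ≤ ε⁻¹ * (ε ^ 2 / m) := by gcongr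
    _ = ε / m := by field_simp

section Tail

variable {α : Type*} [MeasurableSpace α] {μ : Measure α} {φ ψ : α → ℝ} {m M ε ε₁ : ℝ}

lemma exp_neg_div_sq_le {y : ℝ} (hε : 0 < ε) (hεε : ε ≤ ε₁) (hy : m ≤ y) :
    Real.exp (-y / ε ^ 2) ≤
      Real.exp (m / ε₁ ^ 2) * Real.exp (-m / ε ^ 2) * Real.exp (-y / ε₁ ^ 2) := by
  rw [← Real.exp_add, ← Real.exp_add, Real.exp_le_exp]
  have h_inv : (ε₁ ^ 2)⁻¹ ≤ (ε ^ 2)⁻¹ := by gcongr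
  simp only [div_eq_mul_inv]
  nlinarith

lemma norm_mul_exp_neg_div_sq_le (hε : 0 < ε) (hεε : ε ≤ ε₁) (hφ : ∀ᵐ x ∂μ, m ≤ φ x)
    (hψ : ∀ᵐ x ∂μ, |ψ x| ≤ M) :
    ∀ᵐ x ∂μ, ‖ψ x * Real.exp (-φ x / ε ^ 2)‖ ≤
      M * (Real.exp (m / ε₁ ^ 2) * Real.exp (-m / ε ^ 2)) * Real.exp (-φ x / ε₁ ^ 2) := by
  filter_upwards [hφ, hψ] with x hφx hψx
  rw [norm_mul, Real.norm_eq_abs, Real.norm_eq_abs, Real.abs_exp, mul_assoc]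
  exact mul_le_mul hψx (exp_neg_div_sq_le hε hεε hφx) (Real.exp_pos _).le
    ((abs_nonneg _).trans hψx)

lemma integrable_mul_exp_neg_div_sq (hε : 0 < ε) (hεε : ε ≤ ε₁) (hφm : AEMeasurable φ μ)
    (hφ : ∀ᵐ x ∂μ, m ≤ φ x) (hψm : AEMeasurable ψ μ) (hψ : ∀ᵐ x ∂μ, |ψ x| ≤ M)
    (hint : Integrable (fun x => Real.exp (-φ x / ε₁ ^ 2)) μ) :
    Integrable (fun x => ψ x * Real.exp (-φ x / ε ^ 2)) μ :=
  (hint.const_mul _).mono' (hψm.mul (hφm.neg.div_const _).exp).aestronglyMeasurable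
    (norm_mul_exp_neg_div_sq_le hε hεε hφ hψ)

lemma tendsto_inv_mul_integral_exp_zero (hm : 0 < m) (hφ : ∀ᵐ x ∂μ, m ≤ φ x)
    (hψ : ∀ᵐ x ∂μ, |ψ x| ≤ M) (hε₁ : 0 < ε₁)
    (hint : Integrable (fun x => Real.exp (-φ x / ε₁ ^ 2)) μ) :
    Tendsto (fun ε => ε⁻¹ * ∫ x, ψ x * Real.exp (-φ x / ε ^ 2) ∂μ) (𝓝[>] 0) (𝓝 0) := by
  set K := |M| * Real.exp (m / ε₁ ^ 2) * ∫ x, Real.exp (-φ x / ε₁ ^ 2) ∂μ with hK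
  have hlim : Tendsto (fun ε : ℝ => K * (ε / m)) (𝓝[>] 0) (𝓝 0) := by
    have h := (Continuous.tendsto (f := fun ε : ℝ => K * (ε / m)) (by fun_prop) 0).mono_left
      (nhdsWithin_le_nhds (s := Ioi 0))
    rwa [zero_div, mul_zero] at h
  refine squeeze_zero_norm' ?_ hlim
  filter_upwards [Ioc_mem_nhdsGT hε₁] with ε hε
  have h_int : ‖∫ x, ψ x * Real.exp (-φ x / ε ^ 2) ∂μ‖ ≤ K * Real.exp (-m / ε ^ 2) := by
    refine (norm_integral_le_of_norm_le (hint.const_mul _) (norm_mul_exp_neg_div_sq_le hε.1 hε.2 hφ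
      (hψ.mono fun x hx => hx.trans (le_abs_self M)))).trans_eq ?_
    rw [integral_const_mul, hK]
    ring
  rw [norm_mul, norm_inv, Real.norm_of_nonneg hε.1.le]
  calc ε⁻¹ * ‖∫ x, ψ x * Real.exp (-φ x / ε ^ 2) ∂μ‖
      ≤ ε⁻¹ * (K * Real.exp (-m / ε ^ 2)) :=
        mul_le_mul_of_nonneg_left h_int (inv_nonneg.2 hε.1.le)
    _ = K * (ε⁻¹ * Real.exp (-m / ε ^ 2)) := by ring
    _ ≤ K * (ε / m) := mul_le_mul_of_nonneg_left (inv_mul_exp_neg_div_sq_le hm hε.1) (by positivity)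

end Tail

lemma inv_mul_setIntegral_eq_integral_rescale {h : ℝ → ℝ} {B : Set ℝ} (hB : MeasurableSet B)
    (x₀ : ℝ) {ε : ℝ} (hε : 0 < ε) :
    ε⁻¹ * ∫ x in B, h x = ∫ y, B.indicator h (x₀ + ε * y) := by
  rw [Measure.integral_comp_mul_left (fun z => B.indicator h (x₀ + z)), integral_add_left_eq_self,
    integral_indicator hB, abs_of_pos (inv_pos.2 hε), smul_eq_mul]

lemma tendsto_laplace_ball {b c r M : ℝ} (hf : Measurable f) (hg : Measurable g)
    (hgM : ∀ x, |g x| ≤ M) (hgc : ContinuousAt g x₀) (h0 : f x₀ = 0)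
    (hfx : Tendsto (fun x => f x / (x - x₀) ^ 2) (𝓝[≠] x₀) (𝓝 b)) (hr : 0 < r) (hc : 0 < c)
    (hfc : ∀ x ∈ Metric.ball x₀ r, c * (x - x₀) ^ 2 ≤ f x) :
    Tendsto (fun ε => ε⁻¹ * ∫ x in Metric.ball x₀ r, g x * Real.exp (-f x / ε ^ 2)) (𝓝[>] 0)
      (𝓝 (g x₀ * Real.sqrt (Real.pi / b))) := by
  have hM : 0 ≤ M := (abs_nonneg _).trans (hgM 0)
  have hB : MeasurableSet (Metric.ball x₀ r) := measurableSet_ball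
  have hpos : ∀ᶠ ε : ℝ in 𝓝[>] 0, 0 < ε := self_mem_nhdsWithin
  rw [← integral_gaussian, ← integral_const_mul]
  refine Tendsto.congr' (hpos.mono fun ε hε =>
    (inv_mul_setIntegral_eq_integral_rescale hB x₀ hε).symm) ?_
  refine tendsto_integral_filter_of_dominated_convergence (fun y => M * Real.exp (-c * y ^ 2))
    (.of_forall fun ε => ?_) (hpos.mono fun ε hε => ae_of_all _ fun y => ?_)
    ((integrable_exp_neg_mul_sq hc).const_mul M) (ae_of_all _ fun y => ?_)
  · exact (((hg.mul (hf.neg.div_const _).exp).indicator hB).comp (by fun_prop)).aestronglyMeasurable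
  · by_cases hy : x₀ + ε * y ∈ Metric.ball x₀ r
    · rw [indicator_of_mem hy, norm_mul, Real.norm_eq_abs, Real.norm_eq_abs, Real.abs_exp]
      refine mul_le_mul (hgM _) ?_ (Real.exp_pos _).le hM
      rw [Real.exp_le_exp, neg_div, neg_mul, neg_le_neg_iff, le_div_iff₀ (by positivity)]
      have h := hfc _ hy
      rwa [add_sub_cancel_left, mul_pow, mul_left_comm, mul_comm (ε ^ 2)] at h
    · rw [indicator_of_notMem hy, norm_zero]
      positivity
  · have hlin : Tendsto (fun ε : ℝ => x₀ + ε * y) (𝓝[>] 0) (𝓝 x₀) := by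
      have h := (Continuous.tendsto (f := fun ε : ℝ => x₀ + ε * y) (by fun_prop) 0).mono_left
        (nhdsWithin_le_nhds (s := Ioi 0))
      rwa [zero_mul, add_zero] at h
    have h_exp := (Real.continuous_exp.tendsto _).comp (tendsto_comp_rescale_div_sq h0 hfx y).neg
    rw [← neg_mul] at h_exp
    refine ((hgc.tendsto.comp hlin).mul h_exp).congr' ?_
    filter_upwards [hlin.eventually (Metric.ball_mem_nhds x₀ hr)]
      with ε (hε : x₀ + ε * y ∈ Metric.ball x₀ r)
    rw [indicator_of_mem hε]
    simp only [Function.comp_apply, neg_div]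

/-- Laplace's method at an interior nondegenerate minimum. -/
lemma tendsto_laplace {I : Set ℝ} {a ε₁ M : ℝ} (hf : Measurable f) (hI : MeasurableSet I)
    (hIx : I ∈ 𝓝 x₀) (ha : 0 < a) (hf0 : f x₀ = 0)
    (hfx : Tendsto (fun x => f x / (x - x₀) ^ 2) (𝓝[≠] x₀) (𝓝 (a / 2)))
    (hfm : ∀ r > 0, ∃ m > 0, ∀ x ∈ I, r ≤ |x - x₀| → m ≤ f x)
    (hε₁ : 0 < ε₁) (hint : IntegrableOn (fun x => Real.exp (-f x / ε₁ ^ 2)) I)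
    (hg : Measurable g) (hgM : ∀ x, |g x| ≤ M) (hgc : ContinuousAt g x₀) :
    Tendsto (fun ε => ε⁻¹ * ∫ x in I, g x * Real.exp (-f x / ε ^ 2)) (𝓝[>] 0)
      (𝓝 (g x₀ * Real.sqrt (2 * Real.pi / a))) := by
  obtain ⟨R, hR, hRI⟩ := Metric.mem_nhds_iff.1 hIx
  obtain ⟨r, hrc, hr, hrR⟩ := ((eventually_forall_ball_mul_sq_le hf0 hfx
    (by linarith : a / 4 < a / 2)).and (Ioc_mem_nhdsGT hR)).exists
  obtain ⟨m, hm, hmf⟩ := hfm r hr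
  set B := Metric.ball x₀ r
  have hB : MeasurableSet B := measurableSet_ball
  have hBI : B ⊆ I := (Metric.ball_subset_ball hrR).trans hRI
  have hm_out : ∀ x ∈ I \ B, m ≤ f x := fun x hx =>
    hmf x hx.1 (by simpa only [B, Metric.mem_ball, Real.dist_eq, not_lt] using hx.2)
  have hf_nonneg : ∀ x ∈ I, 0 ≤ f x := fun x hx => by
    by_cases hxB : x ∈ B
    · exact (by positivity : 0 ≤ a / 4 * (x - x₀) ^ 2).trans (hrc x hxB)
    · exact hm.le.trans (hm_out x ⟨hx, hxB⟩)
  have h_out := tendsto_inv_mul_integral_exp_zero hm (ae_restrict_of_forall_mem (hI.diff hB) hm_out)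
    (ae_of_all _ hgM) hε₁ (hint.mono_set sdiff_subset)
  have h_sum := (tendsto_laplace_ball hf hg hgM hgc hf0 hfx hr (by positivity) hrc).add h_out
  rw [add_zero, ← div_mul, div_mul_eq_mul_div, mul_comm Real.pi] at h_sum
  refine h_sum.congr' ?_
  filter_upwards [Ioc_mem_nhdsGT hε₁] with ε hε
  have h_int := integrable_mul_exp_neg_div_sq hε.1 hε.2 hf.aemeasurable
    (ae_restrict_of_forall_mem hI hf_nonneg) hg.aemeasurable (ae_of_all _ hgM) hint
  rw [← mul_add, ← setIntegral_union disjoint_sdiff_right (hI.diff hB)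
    (IntegrableOn.mono_set h_int hBI) (IntegrableOn.mono_set h_int sdiff_subset),
    union_sdiff_cancel hBI]

end Laplace

/-- Finiteness of the partition function `Z_ε`. -/
abbrev GibbsIntegrable (H : ℝ → ℝ) (ε : ℝ) : Prop :=
  Integrable fun x => Real.exp (-H x / ε ^ 2)

namespace IsDoubleWell

variable {H : ℝ → ℝ}

lemma continuous (hH : IsDoubleWell H) : Continuous H := hH.smooth.continuous

lemma abs_eq (hH : IsDoubleWell H) (x : ℝ) : H |x| = H x := by
  rcases abs_choice x with h | h <;> rw [h]
  exact hH.even x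

lemma strictAntiOn (hH : IsDoubleWell H) : StrictAntiOn H (Icc 0 1) := by
  refine strictAntiOn_of_deriv_neg (convex_Icc 0 1) hH.continuous.continuousOn fun x hx => ?_
  rw [interior_Icc] at hx
  exact neg_of_mul_neg_left (mul_comm x _ ▸ hH.decreasing_inside x (abs_pos.2 hx.1.ne')
    ((abs_of_pos hx.1).trans_lt hx.2)) hx.1.le

lemma strictMonoOn (hH : IsDoubleWell H) : StrictMonoOn H (Ici 1) := by
  refine strictMonoOn_of_deriv_pos (convex_Ici 1) hH.continuous.continuousOn fun x hx => ?_
  rw [interior_Ici] at hx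
  exact pos_of_mul_pos_right (hH.increasing_outside x (lt_abs.2 (Or.inl hx)))
    (zero_le_one.trans_lt hx).le

lemma exists_pos_le_of_le_abs_sub_one (hH : IsDoubleWell H) {r : ℝ} (hr : 0 < r) :
    ∃ m > 0, ∀ x ∈ Ioi (0 : ℝ), r ≤ |x - 1| → m ≤ H x := by
  set r' := min r 1
  have hr' : 0 < r' := lt_min hr one_pos
  have hr1 : r' ≤ 1 := min_le_right _ _
  have h_left : 0 < H (1 - r') := by
    rw [← hH.at_wells.1]
    exact hH.strictAntiOn ⟨by linarith, by linarith⟩ ⟨zero_le_one, le_rfl⟩ (by linarith)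
  have h_right : 0 < H (1 + r') := by
    rw [← hH.at_wells.1]
    exact hH.strictMonoOn self_mem_Ici (mem_Ici.2 (by linarith)) (by linarith)
  refine ⟨min (H (1 - r')) (H (1 + r')), lt_min h_left h_right, fun x hx hxr => ?_⟩
  rcases le_abs.1 ((min_le_left r 1).trans hxr) with h | h
  · exact (min_le_right _ _).trans (hH.strictMonoOn.monotoneOn (mem_Ici.2 (by linarith))
      (mem_Ici.2 (by linarith)) (by linarith))
  · exact (min_le_left _ _).trans (hH.strictAntiOn.antitoneOn ⟨(mem_Ioi.1 hx).le, by linarith⟩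
      ⟨by linarith, by linarith⟩ (by linarith))

lemma exists_pos_le_one_sub (hH : IsDoubleWell H) {r : ℝ} (hr : 0 < r) :
    ∃ m > 0, ∀ x ∈ Ioc (-1 : ℝ) 1, r ≤ |x - 0| → m ≤ 1 - H x := by
  set r' := min r 1
  have hr' : 0 < r' := lt_min hr one_pos
  have hr1 : r' ≤ 1 := min_le_right _ _
  have h_lt : H r' < 1 := by
    rw [← hH.at_barrier]
    exact hH.strictAntiOn ⟨le_rfl, zero_le_one⟩ ⟨hr'.le, hr1⟩ hr'
  refine ⟨1 - H r', by linarith, fun x hx hxr => ?_⟩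
  rw [sub_zero] at hxr
  have h_anti := hH.strictAntiOn.antitoneOn ⟨hr'.le, hr1⟩
    ⟨abs_nonneg x, abs_le.2 ⟨hx.1.le, hx.2⟩⟩ ((min_le_left _ _).trans hxr)
  rw [hH.abs_eq] at h_anti
  linarith

lemma sqrt_well_pos (hH : IsDoubleWell H) :
    0 < Real.sqrt (2 * Real.pi / deriv (deriv H) 1) :=
  Real.sqrt_pos.2 (div_pos Real.two_pi_pos hH.wells_nondegenerate.1)

lemma sqrt_barrier_pos (hH : IsDoubleWell H) :
    0 < Real.sqrt (2 * Real.pi / -deriv (deriv H) 0) :=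
  Real.sqrt_pos.2 (div_pos Real.two_pi_pos (neg_pos.2 hH.barrier_nondegenerate))

lemma rate_pos (hH : IsDoubleWell H) : 0 < rate H :=
  mul_pos (inv_pos.2 Real.pi_pos) (Real.sqrt_pos.2 (mul_pos
    (abs_pos.2 hH.barrier_nondegenerate.ne) hH.wells_nondegenerate.1))

lemma rate_div_two (hH : IsDoubleWell H) :
    rate H / 2 = 2 / (2 * Real.sqrt (2 * Real.pi / deriv (deriv H) 1) *
      Real.sqrt (2 * Real.pi / -deriv (deriv H) 0)) := by
  have ha := hH.barrier_nondegenerate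
  have hb := hH.wells_nondegenerate.1
  have hs₁ := hH.sqrt_well_pos
  have hs₀ := hH.sqrt_barrier_pos
  have h_prod : Real.sqrt (2 * Real.pi / deriv (deriv H) 1) *
      Real.sqrt (2 * Real.pi / -deriv (deriv H) 0) *
      Real.sqrt (|deriv (deriv H) 0| * deriv (deriv H) 1) = 2 * Real.pi := by
    have ha' : 0 ≤ 2 * Real.pi / deriv (deriv H) 1 := by positivity
    have hb' : 0 ≤ 2 * Real.pi / -deriv (deriv H) 0 := (Real.sqrt_pos.1 hs₀).le
    rw [← Real.sqrt_mul ha', ← Real.sqrt_mul (mul_nonneg ha' hb'), abs_of_neg ha,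
      Real.sqrt_eq_iff_mul_self_eq_of_pos (by positivity)]
    field_simp [ha.ne, hb.ne']
  rw [rate]
  generalize Real.sqrt (2 * Real.pi / deriv (deriv H) 1) = s₁ at *
  generalize Real.sqrt (2 * Real.pi / -deriv (deriv H) 0) = s₀ at *
  generalize Real.sqrt (|deriv (deriv H) 0| * deriv (deriv H) 1) = s at *
  field_simp
  linarith

lemma tendsto_right_well (hH : IsDoubleWell H) {ε₁ : ℝ} (hε₁ : 0 < ε₁)
    (hint : GibbsIntegrable H ε₁) {g : ℝ → ℝ} {M : ℝ}
    (hg : Measurable g) (hgM : ∀ x, |g x| ≤ M) (hgc : ContinuousAt g 1) :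
    Tendsto (fun ε => ε⁻¹ * ∫ x in Ioi 0, g x * Real.exp (-H x / ε ^ 2)) (𝓝[>] 0)
      (𝓝 (g 1 * Real.sqrt (2 * Real.pi / deriv (deriv H) 1))) :=
  tendsto_laplace hH.continuous.measurable measurableSet_Ioi (Ioi_mem_nhds one_pos)
    hH.wells_nondegenerate.1 hH.at_wells.1
    (tendsto_div_sq_of_contDiff (hH.smooth.of_le (by norm_cast)) hH.at_wells.1
      hH.deriv_at_wells.1) (fun _ hr => hH.exists_pos_le_of_le_abs_sub_one hr) hε₁
    hint.integrableOn hg hgM hgc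

lemma tendsto_both_wells (hH : IsDoubleWell H) {ε₁ : ℝ} (hε₁ : 0 < ε₁)
    (hint : GibbsIntegrable H ε₁) {g : ℝ → ℝ} {M : ℝ}
    (hg : Measurable g) (hgM : ∀ x, |g x| ≤ M) (hgc : ContinuousAt g 1)
    (hgc' : ContinuousAt g (-1)) :
    Tendsto (fun ε => ε⁻¹ * ∫ x, g x * Real.exp (-H x / ε ^ 2)) (𝓝[>] 0)
      (𝓝 ((g 1 + g (-1)) * Real.sqrt (2 * Real.pi / deriv (deriv H) 1))) := by
  have h_sum := (hH.tendsto_right_well hε₁ hint hg hgM hgc).add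
    (hH.tendsto_right_well hε₁ hint (g := fun x => g (-x)) (hg.comp measurable_neg)
      (fun x => hgM (-x)) (ContinuousAt.comp (f := fun x : ℝ => -x) hgc' continuousAt_neg))
  rw [← add_mul] at h_sum
  refine h_sum.congr' ?_
  filter_upwards [Ioc_mem_nhdsGT hε₁] with ε hε
  have hi : Integrable fun x => g x * Real.exp (-H x / ε ^ 2) :=
    integrable_mul_exp_neg_div_sq hε.1 hε.2 hH.continuous.aemeasurable (ae_of_all _ hH.nonneg)
      hg.aemeasurable (ae_of_all _ hgM) hint
  have h_left : ∫ x in Iic 0, g x * Real.exp (-H x / ε ^ 2) =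
      ∫ x in Ioi 0, g (-x) * Real.exp (-H x / ε ^ 2) := by
    simpa only [neg_zero, neg_neg, hH.even] using
      integral_comp_neg_Iic (0 : ℝ) fun x => g (-x) * Real.exp (-H x / ε ^ 2)
  rw [← mul_add, ← intervalIntegral.integral_Iic_add_Ioi hi.integrableOn hi.integrableOn (b := 0),
    h_left, add_comm]

lemma tendsto_barrier (hH : IsDoubleWell H) :
    Tendsto (fun ε => ε⁻¹ * ∫ x in Ioc (-1) 1, Real.exp (-(1 - H x) / ε ^ 2)) (𝓝[>] 0)
      (𝓝 (Real.sqrt (2 * Real.pi / -deriv (deriv H) 0))) := by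
  have hd1 : deriv (fun x => 1 - H x) = fun x => -deriv H x := by
    ext x
    rw [deriv_const_sub]
  have hd2 : deriv (deriv fun x => 1 - H x) 0 = -deriv (deriv H) 0 := by
    rw [hd1]
    exact deriv.fun_neg
  have h0 : 1 - H 0 = 0 := by rw [hH.at_barrier, sub_self]
  have h_quad := tendsto_div_sq_of_contDiff (f := fun x => 1 - H x) (x₀ := 0)
    (contDiff_const.sub (hH.smooth.of_le (by norm_cast))) h0
    (by simp only [hd1, hH.deriv_at_zero, neg_zero])
  have h_int : IntegrableOn (fun x => Real.exp (-(1 - H x) / 1 ^ 2)) (Ioc (-1) 1) :=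
    ((continuous_const.sub hH.continuous).neg.div_const _).rexp.integrableOn_Ioc
  simpa only [one_mul] using tendsto_laplace (f := fun x => 1 - H x) (g := fun _ => 1) (M := 1)
    (measurable_const.sub hH.continuous.measurable) measurableSet_Ioc
    (Ioc_mem_nhds (by norm_num) one_pos) (neg_pos.2 hH.barrier_nondegenerate) h0
    (hd2 ▸ h_quad) (fun r hr => hH.exists_pos_le_one_sub hr) one_pos h_int measurable_const
    (fun _ => abs_one.le) continuousAt_const

end IsDoubleWell

section Gibbs

variable {H : ℝ → ℝ} {ε : ℝ}

lemma tau_pos (hε : 0 < ε) : 0 < tau ε := mul_pos (by positivity) (Real.exp_pos _)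

lemma tendsto_tau : Tendsto tau (𝓝[>] 0) (𝓝 0) := by
  have h_inv : Tendsto (fun ε : ℝ => ε⁻¹ ^ 2) (𝓝[>] 0) atTop :=
    (tendsto_pow_atTop two_ne_zero).comp tendsto_inv_nhdsGT_zero
  refine ((Real.tendsto_pow_mul_exp_neg_atTop_nhds_zero 1).comp h_inv).congr fun ε => ?_
  rw [Function.comp_apply, pow_one, inv_pow, tau, neg_div, one_div]

lemma partitionFn_pos (hint : GibbsIntegrable H ε) :
    0 < partitionFn H ε := integral_exp_pos hint

lemma gam_pos (hint : GibbsIntegrable H ε) (x : ℝ) : 0 < gam H ε x :=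
  mul_pos (inv_pos.2 (partitionFn_pos hint)) (Real.exp_pos _)

lemma integrable_gam (hint : GibbsIntegrable H ε) :
    Integrable (gam H ε) := hint.const_mul _

lemma integral_gam (hint : GibbsIntegrable H ε) :
    ∫ x, gam H ε x = 1 := by
  unfold gam
  rw [integral_const_mul]
  exact inv_mul_cancel₀ (partitionFn_pos hint).ne'

lemma gam_le_gam {x y : ℝ} (h : H y ≤ H x) : gam H ε x ≤ gam H ε y := by
  have hZ : 0 ≤ partitionFn H ε := integral_nonneg fun x => (Real.exp_pos _).le
  unfold gam
  gcongr

lemma contDiff_gam {n : WithTop ℕ∞} (hH : ContDiff ℝ n H) (ε : ℝ) : ContDiff ℝ n (gam H ε) :=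
  contDiff_const.mul (hH.neg.div_const _).exp

lemma continuous_gam (hH : Continuous H) (ε : ℝ) : Continuous (gam H ε) :=
  continuous_const.mul (hH.neg.div_const _).rexp

lemma gam_neg (hH : ∀ x, H (-x) = H x) (ε x : ℝ) : gam H ε (-x) = gam H ε x := by
  rw [gam, gam, hH]

lemma integral_inv_gam (H : ℝ → ℝ) (ε : ℝ) (s : Set ℝ) :
    ∫ x in s, (gam H ε x)⁻¹ = partitionFn H ε * Real.exp (1 / ε ^ 2) *
      ∫ x in s, Real.exp (-(1 - H x) / ε ^ 2) := by
  rw [← integral_const_mul]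
  congr 1
  ext x
  rw [gam, mul_inv, inv_inv, mul_assoc, ← Real.exp_add, ← Real.exp_neg]
  congr 2
  ring

/-- The effective conductance `2 / ∫_{-1}^1 γ⁻¹` of the barrier between the wells, i.e. half the
minimal Dirichlet energy of a function that equals `±1` at `±1`. -/
def conductance (H : ℝ → ℝ) (ε : ℝ) : ℝ :=
  2 / ∫ x in (-1 : ℝ)..1, (gam H ε x)⁻¹

end Gibbs

namespace IsDoubleWell

variable {H : ℝ → ℝ}

lemma gam_monotoneOn (hH : IsDoubleWell H) (ε : ℝ) : MonotoneOn (gam H ε) (Icc 0 1) :=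
  fun _ hx _ hy hxy => gam_le_gam (hH.strictAntiOn.antitoneOn hx hy hxy)

lemma gam_antitoneOn (hH : IsDoubleWell H) (ε : ℝ) : AntitoneOn (gam H ε) (Ici 1) :=
  fun _ hx _ hy hxy => gam_le_gam (hH.strictMonoOn.monotoneOn hx hy hxy)

lemma tendsto_partitionFn (hH : IsDoubleWell H) {ε₁ : ℝ} (hε₁ : 0 < ε₁)
    (hint : GibbsIntegrable H ε₁) :
    Tendsto (fun ε => ε⁻¹ * partitionFn H ε) (𝓝[>] 0)
      (𝓝 (2 * Real.sqrt (2 * Real.pi / deriv (deriv H) 1))) := by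
  simpa only [partitionFn, one_mul, one_add_one_eq_two] using
    hH.tendsto_both_wells hε₁ hint (g := fun _ => 1) (M := 1) measurable_const
      (fun _ => abs_one.le) continuousAt_const continuousAt_const

lemma tendsto_integral_mul_gam (hH : IsDoubleWell H) {ε₁ : ℝ} (hε₁ : 0 < ε₁)
    (hint : GibbsIntegrable H ε₁) {g : ℝ → ℝ} {M : ℝ}
    (hg : Measurable g) (hgM : ∀ x, |g x| ≤ M) (hgc : ContinuousAt g 1)
    (hgc' : ContinuousAt g (-1)) :
    Tendsto (fun ε => ∫ x, g x * gam H ε x) (𝓝[>] 0) (𝓝 ((g 1 + g (-1)) / 2)) := by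
  have hs := hH.sqrt_well_pos
  rw [← mul_div_mul_right _ _ hs.ne']
  refine ((hH.tendsto_both_wells hε₁ hint hg hgM hgc hgc').div
    (hH.tendsto_partitionFn hε₁ hint) (by positivity)).congr' ?_
  filter_upwards [self_mem_nhdsWithin] with ε (hε : 0 < ε)
  rw [Pi.div_apply, mul_div_mul_left _ _ (inv_pos.2 hε).ne', div_eq_inv_mul, ← integral_const_mul]
  exact integral_congr_ae (ae_of_all _ fun x => mul_left_comm _ _ _)

/-- Kramers' formula: the conductance of the barrier is asymptotic to `k τ_ε / 2`. -/
lemma tendsto_conductance_div_tau (hH : IsDoubleWell H) {ε₁ : ℝ} (hε₁ : 0 < ε₁)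
    (hint : GibbsIntegrable H ε₁) :
    Tendsto (fun ε => conductance H ε / tau ε) (𝓝[>] 0) (𝓝 (rate H / 2)) := by
  have hs₁ := hH.sqrt_well_pos
  have hs₀ := hH.sqrt_barrier_pos
  rw [hH.rate_div_two]
  refine (tendsto_const_nhds.div ((hH.tendsto_partitionFn hε₁ hint).mul hH.tendsto_barrier)
    (by positivity)).congr' ?_
  filter_upwards [self_mem_nhdsWithin] with ε (hε : 0 < ε)
  have hexp := (Real.exp_pos (1 / ε ^ 2)).ne'
  rw [Pi.div_apply, conductance, intervalIntegral.integral_of_le (by norm_num), integral_inv_gam,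
    tau, neg_div, Real.exp_neg, div_div]
  congr 1
  field_simp

end IsDoubleWell

lemma le_mul_of_deriv_sq_le {f g : ℝ → ℝ} {β : ℝ} (hf0 : f 0 = 0)
    (hfc : ContinuousOn (fun t => f t ^ 2) (Ici 0))
    (hfg : ∀ t, 0 < t → HasDerivAt (fun t => f t ^ 2) (g t) t) (hβ : 0 ≤ β)
    (hg : ∀ t, 0 < t → g t ≤ 2 * (f t * β)) {t : ℝ} (ht : 0 ≤ t) : f t ≤ t * β := by
  refine le_of_forall_pos_le_add fun δ hδ => ?_
  -- The shift by `δ ^ 2` keeps the square root differentiable where `f` vanishes.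
  have hpos : ∀ s, 0 < f s ^ 2 + δ ^ 2 := fun s => by positivity
  have hf_le : ∀ s, f s ≤ Real.sqrt (f s ^ 2 + δ ^ 2) := fun s =>
    Real.le_sqrt_of_sq_le (le_add_of_nonneg_right (sq_nonneg δ))
  have h_anti : AntitoneOn (fun s => Real.sqrt (f s ^ 2 + δ ^ 2) - s * β) (Ici 0) := by
    refine antitoneOn_of_hasDerivWithinAt_nonpos
      (f' := fun s => g s / (2 * Real.sqrt (f s ^ 2 + δ ^ 2)) - 1 * β) (convex_Ici 0)
      ((hfc.add continuousOn_const).sqrt.sub (by fun_prop)) ?_ ?_ <;>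
      simp only [interior_Ici, mem_Ioi] <;> intro s hs
    · exact ((((hfg s hs).add_const _).sqrt (hpos s).ne').sub
        ((hasDerivAt_id s).mul_const _)).hasDerivWithinAt
    · rw [sub_nonpos, div_le_iff₀ (by positivity)]
      linarith [hg s hs, mul_le_mul_of_nonneg_right (hf_le s) hβ]
  have h_le := h_anti self_mem_Ici (mem_Ici.2 ht) ht
  simp only [hf0, zero_mul, sub_zero, zero_pow two_ne_zero, zero_add, Real.sqrt_sq hδ.le] at h_le
  linarith [hf_le t]

section FormFlow

variable {X : Type*} [NormedAddCommGroup X] [InnerProductSpace ℝ X]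

/-- A `C¹` path `V` with derivative `V'` that solves `τ V' = τ a - D* D V`, where `G` is the graph
of the operator `D` and `Q = D V`. -/
structure IsFormFlow (G : Submodule ℝ (X × X)) (τ : ℝ) (a : X) (V V' Q : ℝ → X) : Prop where
  hasDerivAt : ∀ t, HasDerivAt V (V' t) t
  continuous : Continuous V'
  mem_graph : ∀ t, 0 ≤ t → (V t, Q t) ∈ G
  weak : ∀ t, 0 ≤ t → ∀ p ∈ G, τ * ⟪V' t - a, p.1⟫ = -⟪Q t, p.2⟫

namespace IsFormFlow

variable {G : Submodule ℝ (X × X)} {τ : ℝ} {a : X} {V V' Q : ℝ → X}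

lemma continuous_path (h : IsFormFlow G τ a V V' Q) : Continuous V :=
  continuous_iff_continuousAt.2 fun t => (h.hasDerivAt t).continuousAt

lemma norm_sq_sub (h : IsFormFlow G τ a V V' Q) {s t : ℝ} (hs : 0 ≤ s) (ht : 0 ≤ t) :
    ‖Q s‖ ^ 2 = ‖Q t‖ ^ 2 - τ * ⟪(V' s - a) + (V' t - a), V s - V t⟫ := by
  have hm : (V s - V t, Q s - Q t) ∈ G := G.sub_mem (h.mem_graph s hs) (h.mem_graph t ht)
  rw [inner_add_left, mul_add, h.weak s hs _ hm, h.weak t ht _ hm, inner_sub_right (Q s),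
    inner_sub_right (Q t), real_inner_self_eq_norm_sq, real_inner_self_eq_norm_sq,
    real_inner_comm (Q s) (Q t)]
  ring

lemma continuousOn_norm_sq (h : IsFormFlow G τ a V V' Q) :
    ContinuousOn (fun t => ‖Q t‖ ^ 2) (Ici 0) := by
  have hV := h.continuous_path
  have hV' := h.continuous
  have hc : Continuous fun s => ‖Q 0‖ ^ 2 - τ * ⟪(V' s - a) + (V' 0 - a), V s - V 0⟫ := by
    fun_prop
  exact hc.continuousOn.congr fun s hs => h.norm_sq_sub hs le_rfl

lemma hasDerivAt_norm_sq (h : IsFormFlow G τ a V V' Q) {t : ℝ} (ht : 0 < t) :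
    HasDerivAt (fun t => ‖Q t‖ ^ 2) (-2 * τ * ⟪V' t - a, V' t⟫) t := by
  have hV' := h.continuous
  have h_inner : HasDerivAt (fun s => ⟪(V' s - a) + (V' t - a), V s - V t⟫)
      (2 * ⟪V' t - a, V' t⟫) t := by
    rw [hasDerivAt_iff_tendsto_slope, two_mul, ← inner_add_left]
    have h_left : Tendsto (fun s => (V' s - a) + (V' t - a)) (𝓝[≠] t)
        (𝓝 ((V' t - a) + (V' t - a))) :=
      Continuous.tendsto' (by fun_prop) _ _ rfl |>.mono_left nhdsWithin_le_nhds
    refine (h_left.inner (hasDerivAt_iff_tendsto_slope.1 (h.hasDerivAt t)) (𝕜 := ℝ)).congr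
      fun s => ?_
    simp only [slope, vsub_eq_sub, inner_smul_right, sub_self, inner_zero_right, sub_zero,
      smul_eq_mul]
  refine (((h_inner.const_mul τ).const_sub (‖Q t‖ ^ 2)).congr_deriv (by ring)).congr_of_eventuallyEq
    ?_
  filter_upwards [lt_mem_nhds ht] with s hs using h.norm_sq_sub hs.le ht.le

lemma inner_deriv_sub_le (h : IsFormFlow G τ a V V' Q) (hτ : 0 ≤ τ) {b : X} (hab : (a, b) ∈ G)
    {t : ℝ} (ht : 0 ≤ t) : -τ * ⟪V' t - a, V' t⟫ ≤ ‖Q t‖ * ‖b‖ := by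
  have hw : τ * ⟪V' t - a, a⟫ = -⟪Q t, b⟫ := h.weak t ht _ hab
  calc -τ * ⟪V' t - a, V' t⟫
      = ⟪Q t, b⟫ - τ * ‖V' t - a‖ ^ 2 := by
        rw [← neg_eq_iff_eq_neg.2 hw, ← real_inner_self_eq_norm_sq, inner_sub_right (V' t - a)]
        ring
    _ ≤ ⟪Q t, b⟫ := sub_le_self _ (by positivity)
    _ ≤ ‖Q t‖ * ‖b‖ := real_inner_le_norm _ _

lemma norm_le_mul (h : IsFormFlow G τ a V V' Q) (hτ : 0 ≤ τ) (hQ : Q 0 = 0) {b : X}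
    (hab : (a, b) ∈ G) {t : ℝ} (ht : 0 ≤ t) : ‖Q t‖ ≤ t * ‖b‖ := by
  refine le_mul_of_deriv_sq_le (f := fun t => ‖Q t‖) (by simp only [hQ, norm_zero])
    h.continuousOn_norm_sq (fun s hs => h.hasDerivAt_norm_sq hs) (norm_nonneg b)
    (fun s hs => ?_) ht
  linarith [h.inner_deriv_sub_le hτ hab hs.le]

lemma norm_path_le (h : IsFormFlow G τ 0 V V' Q) (hτ : 0 < τ) {t : ℝ} (ht : 0 ≤ t) :
    ‖V t‖ ≤ ‖V 0‖ := by
  have h_anti : AntitoneOn (fun s => ‖V s‖ ^ 2) (Ici 0) := by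
    refine antitoneOn_of_hasDerivWithinAt_nonpos (f' := fun s => 2 * ⟪V s, V' s⟫) (convex_Ici 0)
      (h.continuous_path.norm.pow 2).continuousOn
      (fun s _ => (h.hasDerivAt s).norm_sq.hasDerivWithinAt) fun s hs => ?_
    rw [interior_Ici] at hs
    have hw : τ * ⟪V' s - 0, V s⟫ = -⟪Q s, Q s⟫ :=
      h.weak s (le_of_lt hs) _ (h.mem_graph s (le_of_lt hs))
    rw [sub_zero, real_inner_self_eq_norm_sq, real_inner_comm] at hw
    refine mul_nonpos_of_nonneg_of_nonpos zero_le_two (nonpos_of_mul_nonpos_right ?_ hτ)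
    rw [hw]
    exact neg_nonpos.2 (sq_nonneg _)
  exact (pow_le_pow_iff_left₀ (norm_nonneg _) (norm_nonneg _) two_ne_zero).1
    (h_anti self_mem_Ici (mem_Ici.2 ht) ht)

lemma integral_norm_sq_deriv_le (h : IsFormFlow G τ 0 V V' Q) {T : ℝ} (hT : 0 ≤ T) :
    2 * τ * ∫ t in (0 : ℝ)..T, ‖V' t‖ ^ 2 ≤ ‖Q 0‖ ^ 2 := by
  have hV' := h.continuous
  have h_ftc := intervalIntegral.integral_eq_sub_of_hasDerivAt_of_le
    (f := fun t => ‖Q t‖ ^ 2) (f' := fun t => -2 * τ * ⟪V' t - 0, V' t⟫) hT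
    (h.continuousOn_norm_sq.mono Icc_subset_Ici_self) (fun t ht => h.hasDerivAt_norm_sq ht.1)
    (Continuous.intervalIntegrable (by fun_prop) _ _)
  simp only [sub_zero, real_inner_self_eq_norm_sq, intervalIntegral.integral_const_mul] at h_ftc
  linarith [sq_nonneg ‖Q T‖]

lemma increment (h : IsFormFlow G τ a V V' Q) {r : ℝ} (hr : 0 ≤ r) :
    IsFormFlow G τ 0 (fun t => V (t + r) - V t) (fun t => V' (t + r) - V' t)
      (fun t => Q (t + r) - Q t) where
  hasDerivAt t := ((h.hasDerivAt (t + r)).comp_add_const t r).sub (h.hasDerivAt t)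
  continuous := (h.continuous.comp (continuous_add_const r)).sub h.continuous
  mem_graph t ht := G.sub_mem (h.mem_graph (t + r) (add_nonneg ht hr)) (h.mem_graph t ht)
  weak t ht p hp := by
    rw [sub_zero, ← sub_sub_sub_cancel_right _ _ a, inner_sub_left (V' (t + r) - a),
      inner_sub_left (Q (t + r)), mul_sub, h.weak _ (add_nonneg ht hr) p hp, h.weak t ht p hp]
    ring

lemma norm_deriv_le (h : IsFormFlow G τ a V V' Q) (hτ : 0 < τ) {t : ℝ}
    (ht : 0 ≤ t) : ‖V' t‖ ≤ ‖V' 0‖ := by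
  have h_slope : ∀ s, Tendsto (fun r : ℝ => ‖r⁻¹ • (V (s + r) - V s)‖) (𝓝[>] 0) (𝓝 ‖V' s‖) :=
    fun s => (h.hasDerivAt s).tendsto_slope_zero_right.norm
  refine le_of_tendsto_of_tendsto (h_slope t) (h_slope 0) ?_
  filter_upwards [self_mem_nhdsWithin] with r (hr : 0 < r)
  rw [norm_smul, norm_smul]
  exact mul_le_mul_of_nonneg_left ((h.increment hr.le).norm_path_le hτ ht) (norm_nonneg _)

lemma integral_norm_sq_increment_le (h : IsFormFlow G τ a V V' Q) (hτ : 0 < τ)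
    (hQ : Q 0 = 0) {b : X} (hab : (a, b) ∈ G) {r T : ℝ} (hr : 0 ≤ r) (hT : 0 ≤ T) :
    ∫ t in (0 : ℝ)..T, ‖V' (t + r) - V' t‖ ^ 2 ≤ r ^ 2 * ‖b‖ ^ 2 / (2 * τ) := by
  have h_deriv := (h.increment hr).integral_norm_sq_deriv_le hT
  rw [zero_add, hQ, sub_zero] at h_deriv
  rw [le_div_iff₀ (by positivity), ← mul_pow, mul_comm]
  exact h_deriv.trans (pow_le_pow_left₀ (norm_nonneg _) (h.norm_le_mul hτ.le hQ hab hr) 2)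

end IsFormFlow

lemma exists_weak_limit [CompleteSpace X] {x : ℕ → X} {R : ℝ} (hx : ∀ n, ‖x n‖ ≤ R) :
    ∃ y, ‖y‖ ≤ R ∧ ∀ z l, Tendsto (fun n => ⟪x n, z⟫) atTop (𝓝 l) → ⟪y, z⟫ = l := by
  let F : ℕ → WeakDual ℝ X := fun n => StrongDual.toWeakDual (InnerProductSpace.toDual ℝ X (x n))
  have hF : ∀ n, F n ∈ WeakDual.toStrongDual ⁻¹' Metric.closedBall (0 : StrongDual ℝ X) R :=
    fun n => by
      rw [mem_preimage, mem_closedBall_zero_iff]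
      exact ((InnerProductSpace.toDual ℝ X).norm_map (x n)).trans_le (hx n)
  obtain ⟨f, hf, hfl⟩ := (WeakDual.isCompact_closedBall (𝕜 := ℝ) (E := X) 0 R).ultrafilter_le_nhds
    ((hyperfilter ℕ : Ultrafilter ℕ).map F) (tendsto_principal.2 (Eventually.of_forall hF))
  refine ⟨(InnerProductSpace.toDual ℝ X).symm (WeakDual.toStrongDual f), ?_, fun z l hz => ?_⟩
  · rw [LinearIsometryEquiv.norm_map]
    exact mem_closedBall_zero_iff.1 hf
  · rw [InnerProductSpace.toDual_symm_apply]
    have hF_lim : Tendsto F (hyperfilter ℕ : Filter ℕ) (𝓝 f) := hfl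
    exact tendsto_nhds_unique (((WeakDual.eval_continuous z).tendsto f).comp hF_lim)
      (hz.mono_left Nat.hyperfilter_le_atTop)

end FormFlow

section L2

variable {α : Type*} [MeasurableSpace α] {μ : Measure α} {f g : α → ℝ}

open Classical in
/-- The class in `L²` of a square-integrable function (and `0` for other functions). -/
def toL2 (μ : Measure α) (f : α → ℝ) : Lp ℝ 2 μ := if h : MemLp f 2 μ then h.toLp f else 0

lemma coeFn_toL2 (hf : MemLp f 2 μ) : toL2 μ f =ᵐ[μ] f := by
  rw [toL2, dif_pos hf]
  exact hf.coeFn_toLp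

lemma inner_eq_integral {F G : Lp ℝ 2 μ} (hf : F =ᵐ[μ] f) (hg : G =ᵐ[μ] g) :
    ⟪F, G⟫ = ∫ x, f x * g x ∂μ := by
  rw [L2.inner_def]
  refine integral_congr_ae ?_
  filter_upwards [hf, hg] with x hfx hgx
  rw [hfx, hgx, RCLike.inner_apply, conj_trivial, mul_comm]

lemma inner_toL2 (hf : MemLp f 2 μ) (hg : MemLp g 2 μ) :
    ⟪toL2 μ f, toL2 μ g⟫ = ∫ x, f x * g x ∂μ :=
  inner_eq_integral (coeFn_toL2 hf) (coeFn_toL2 hg)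

lemma norm_toL2_sq (hf : MemLp f 2 μ) : ‖toL2 μ f‖ ^ 2 = ∫ x, f x ^ 2 ∂μ := by
  rw [← real_inner_self_eq_norm_sq, inner_toL2 hf hf]
  simp only [sq]

lemma toL2_sub (hf : MemLp f 2 μ) (hg : MemLp g 2 μ) :
    toL2 μ f - toL2 μ g = toL2 μ (fun x => f x - g x) := by
  refine Lp.ext ?_
  filter_upwards [Lp.coeFn_sub (toL2 μ f) (toL2 μ g), coeFn_toL2 hf, coeFn_toL2 hg,
    coeFn_toL2 (hf.sub hg)] with x h_sub hfx hgx h_toL2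
  rw [h_sub, Pi.sub_apply, hfx, hgx]
  exact h_toL2.symm

lemma toL2_const_mul (a : ℝ) (hf : MemLp f 2 μ) : toL2 μ (fun x => a * f x) = a • toL2 μ f := by
  refine Lp.ext ?_
  filter_upwards [Lp.coeFn_smul a (toL2 μ f), coeFn_toL2 hf, coeFn_toL2 (hf.const_mul a)]
    with x h_smul hfx h_toL2
  rw [h_smul, Pi.smul_apply, hfx, h_toL2, smul_eq_mul]

lemma abs_integral_mul_le (hf : MemLp f 2 μ) (hg : MemLp g 2 μ) :
    |∫ x, f x * g x ∂μ| ≤ Real.sqrt (∫ x, f x ^ 2 ∂μ) * Real.sqrt (∫ x, g x ^ 2 ∂μ) := by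
  rw [← inner_toL2 hf hg, ← norm_toL2_sq hf, ← norm_toL2_sq hg, Real.sqrt_sq (norm_nonneg _),
    Real.sqrt_sq (norm_nonneg _)]
  exact abs_real_inner_le_norm _ _

lemma sq_integral_le [IsFiniteMeasure μ] (hf : MemLp f 2 μ) :
    (∫ x, f x ∂μ) ^ 2 ≤ μ.real univ * ∫ x, f x ^ 2 ∂μ := by
  have h_cs := abs_integral_mul_le hf (memLp_const (1 : ℝ))
  simp only [mul_one, one_pow, integral_const, smul_eq_mul] at h_cs
  rw [← Real.sqrt_mul (integral_nonneg fun x => sq_nonneg _),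
    Real.le_sqrt (abs_nonneg _) (by positivity), sq_abs] at h_cs
  rwa [mul_comm]

variable {β : Type*} [MeasurableSpace β] {ν : Measure β} [IsFiniteMeasure μ] [SFinite ν]

lemma memLp_integral_fst {F : α × β → ℝ} (hF : MemLp F 2 (μ.prod ν)) :
    MemLp (fun y => ∫ x, F (x, y) ∂μ) 2 ν := by
  have hm : AEStronglyMeasurable (fun y => ∫ x, F (x, y) ∂μ) ν :=
    hF.aestronglyMeasurable.prod_swap.integral_prod_right'
  have hF_slice : ∀ᵐ y ∂ν, AEStronglyMeasurable (fun x => F (x, y)) μ :=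
    hF.aestronglyMeasurable.prod_swap.prodMk_left
  refine (memLp_two_iff_integrable_sq hm).2 (Integrable.mono'
    (hF.integrable_sq.integral_prod_right.const_mul (μ.real univ)) (hm.pow 2) ?_)
  filter_upwards [hF.integrable_sq.prod_left_ae, hF_slice] with y hy hym
  rw [Real.norm_of_nonneg (sq_nonneg _)]
  exact sq_integral_le ((memLp_two_iff_integrable_sq hym).2 hy)

lemma integral_integral_fst_mul {F : α × β → ℝ} (hF : MemLp F 2 (μ.prod ν)) {q : β → ℝ}
    (hq : MemLp q 2 ν) :
    ∫ y, (∫ x, F (x, y) ∂μ) * q y ∂ν = ∫ p, F p * q p.2 ∂(μ.prod ν) := by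
  have hFq : Integrable (fun p => F p * q p.2) (μ.prod ν) := hF.integrable_mul (hq.comp_snd μ)
  rw [integral_prod_symm _ hFq]
  simp only [integral_mul_const]

end L2

section Weight

/-- The state space of the flow: a density `ρ` is represented by `ρ / √γ_ε`. -/
abbrev L2Line := Lp ℝ 2 (volume : Measure ℝ)

variable {w : ℝ → ℝ}

lemma hasCompactSupport_div {f : ℝ → ℝ} (hf : HasCompactSupport f) (w : ℝ → ℝ) :
    HasCompactSupport fun x => f x / w x := by
  simp only [div_eq_mul_inv]
  exact hf.mul_right

lemma memLp_div_of_hasCompactSupport (hw : Continuous w) (hw0 : ∀ x, w x ≠ 0) {f : ℝ → ℝ}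
    (hf : Continuous f) (hfs : HasCompactSupport f) : MemLp (fun x => f x / w x) 2 :=
  (hf.div hw hw0).memLp_of_hasCompactSupport (hasCompactSupport_div hfs w)

lemma locallyIntegrable_of_memLp_div (hw : Continuous w) (hw0 : ∀ x, w x ≠ 0) {f : ℝ → ℝ}
    (hf : MemLp (fun x => f x / w x) 2) : LocallyIntegrable f := by
  have hloc := (hf.locallyIntegrable one_le_two).locallyIntegrableOn univ
  rw [← locallyIntegrableOn_univ]
  exact (hloc.continuousOn_mul hw.continuousOn isOpen_univ.isLocallyClosed).congr
    (ae_of_all _ fun x => mul_div_cancel₀ _ (hw0 x))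

lemma div_mul_mul_cancel_weight (hw0 : ∀ x, w x ≠ 0) (a b x : ℝ) :
    a / w x * (w x * b) = a * b := by
  rw [← mul_assoc, div_mul_cancel₀ _ (hw0 x)]

/-- The graph of the weak derivative in the weighted space `L²(w²)`, the function `F` being
represented by `w F` in the unweighted space. -/
def derivGraph (w : ℝ → ℝ) : Submodule ℝ (L2Line × L2Line) where
  carrier := {p | ∃ F f : ℝ → ℝ, IsPrimitive F f ∧ p.1 =ᵐ[volume] (fun x => w x * F x) ∧
    p.2 =ᵐ[volume] fun x => w x * f x}
  zero_mem' := by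
    refine ⟨0, 0, IsPrimitive.zero, ?_, ?_⟩ <;>
    · filter_upwards [Lp.coeFn_zero ℝ 2 (volume : Measure ℝ)] with x hx
      simpa only [Prod.fst_zero, Prod.snd_zero, Pi.zero_apply, mul_zero] using hx
  add_mem' := by
    rintro p q ⟨F, f, hF, hp₁, hp₂⟩ ⟨G, g, hG, hq₁, hq₂⟩
    refine ⟨F + G, f + g, hF.add hG, ?_, ?_⟩
    · filter_upwards [Lp.coeFn_add p.1 q.1, hp₁, hq₁] with x hx hpx hqx
      simp only [Prod.fst_add, hx, Pi.add_apply, hpx, hqx, mul_add]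
    · filter_upwards [Lp.coeFn_add p.2 q.2, hp₂, hq₂] with x hx hpx hqx
      simp only [Prod.snd_add, hx, Pi.add_apply, hpx, hqx, mul_add]
  smul_mem' := by
    rintro a p ⟨F, f, hF, hp₁, hp₂⟩
    refine ⟨fun x => a * F x, fun x => a * f x, hF.const_mul a, ?_, ?_⟩
    · filter_upwards [Lp.coeFn_smul a p.1, hp₁] with x hx hpx
      simp only [Prod.smul_fst, hx, Pi.smul_apply, hpx, smul_eq_mul, mul_left_comm]
    · filter_upwards [Lp.coeFn_smul a p.2, hp₂] with x hx hpx
      simp only [Prod.smul_snd, hx, Pi.smul_apply, hpx, smul_eq_mul, mul_left_comm]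

lemma IsPrimitive.mem_derivGraph {F f : ℝ → ℝ} (hF : IsPrimitive F f)
    (hwF : MemLp (fun x => w x * F x) 2) (hwf : MemLp (fun x => w x * f x) 2) :
    (toL2 volume (fun x => w x * F x), toL2 volume (fun x => w x * f x)) ∈ derivGraph w :=
  ⟨F, f, hF, coeFn_toL2 hwF, coeFn_toL2 hwf⟩

lemma mem_derivGraph_of_hasWeakDerivOn (hw0 : ∀ x, w x ≠ 0) {p : L2Line × L2Line}
    (hp : HasWeakDerivOn (fun x => p.1 x / w x) (fun x => p.2 x / w x) univ) :
    p ∈ derivGraph w := by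
  obtain ⟨F, hF, hpF⟩ := hp.exists_isPrimitive
  refine ⟨F, _, hF, ?_, ae_of_all _ fun x => (mul_div_cancel₀ _ (hw0 x)).symm⟩
  filter_upwards [hpF] with x hx
  rw [← hx, mul_div_cancel₀ _ (hw0 x)]

lemma mem_derivGraph_of_forall_inner (hw : Continuous w) (hw0 : ∀ x, w x ≠ 0)
    {p : L2Line × L2Line}
    (hp : ∀ ψ : ℝ → ℝ, ContDiff ℝ ∞ ψ → HasCompactSupport ψ →
      ⟪p.1, toL2 volume fun x => deriv ψ x / w x⟫ = -⟪p.2, toL2 volume fun x => ψ x / w x⟫) :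
    p ∈ derivGraph w := by
  have hloc : ∀ P : L2Line, LocallyIntegrable fun x => P x / w x := fun P => by
    have hP := ((Lp.memLp P).locallyIntegrable one_le_two).locallyIntegrableOn univ
    rw [← locallyIntegrableOn_univ]
    exact hP.mul_continuousOn (hw.inv₀ hw0).continuousOn isOpen_univ.isLocallyClosed
  refine mem_derivGraph_of_hasWeakDerivOn hw0
    (hasWeakDerivOn_univ.2 ⟨hloc p.1, hloc p.2, fun ψ hψ hψs => ?_⟩)
  have hψ' : Continuous (deriv ψ) := hψ.continuous_deriv (by simp)
  have h_inner := hp ψ hψ hψs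
  rw [inner_eq_integral (ae_eq_refl _)
      (coeFn_toL2 (memLp_div_of_hasCompactSupport hw hw0 hψ' hψs.deriv)),
    inner_eq_integral (ae_eq_refl _)
      (coeFn_toL2 (memLp_div_of_hasCompactSupport hw hw0 hψ.continuous hψs))] at h_inner
  simpa only [div_mul_eq_mul_div, mul_div_assoc] using h_inner

lemma inner_eq_neg_inner_of_hasWeakDerivOn (hw0 : ∀ x, w x ≠ 0) {Φ D : ℝ → ℝ}
    (hΦD : HasWeakDerivOn Φ D univ) (hΦ : MemLp (fun x => Φ x / w x) 2)
    (hD : MemLp (fun x => D x / w x) 2) {p : L2Line × L2Line} (hp : p ∈ derivGraph w) :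
    ⟪toL2 volume fun x => D x / w x, p.1⟫ = -⟪toL2 volume fun x => Φ x / w x, p.2⟫ := by
  obtain ⟨F, f, hF, hp₁, hp₂⟩ := hp
  obtain ⟨Φ', hΦ', hΦe⟩ := hΦD.exists_isPrimitive
  have hwF : MemLp (fun x => w x * F x) 2 := (memLp_congr_ae hp₁).1 (Lp.memLp p.1)
  have hwf : MemLp (fun x => w x * f x) 2 := (memLp_congr_ae hp₂).1 (Lp.memLp p.2)
  have h_mul : ∀ {A B : ℝ → ℝ}, MemLp (fun x => A x / w x) 2 → MemLp (fun x => w x * B x) 2 →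
      Integrable fun x => A x * B x := fun hA hB => by
    simpa only [Pi.mul_def, div_mul_mul_cancel_weight hw0] using hA.integrable_mul hB
  have h_congr : ∀ B : ℝ → ℝ, (fun x => Φ x * B x) =ᵐ[volume] fun x => Φ' x * B x := fun B => by
    filter_upwards [hΦe] with x hx
    rw [hx]
  have h_parts := hΦ'.integral_mul_add_integral_mul_eq_zero hF (h_mul hD hwF)
    ((h_mul hΦ hwf).congr (h_congr f)) ((h_mul hΦ hwF).congr (h_congr F))
  rw [← integral_congr_ae (h_congr f)] at h_parts
  rw [inner_eq_integral (coeFn_toL2 hD) hp₁, inner_eq_integral (coeFn_toL2 hΦ) hp₂]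
  simp only [div_mul_mul_cancel_weight hw0]
  exact eq_neg_of_add_eq_zero_left h_parts

end Weight

section GibbsWeight

/-- The weight `√γ_ε`. -/
def wt (H : ℝ → ℝ) (ε x : ℝ) : ℝ := Real.sqrt (gam H ε x)

variable {H : ℝ → ℝ} {ε : ℝ}

lemma wt_ne_zero (hint : GibbsIntegrable H ε) (x : ℝ) : wt H ε x ≠ 0 :=
  (Real.sqrt_pos.2 (gam_pos hint x)).ne'

lemma wt_sq (hint : GibbsIntegrable H ε) (x : ℝ) : wt H ε x ^ 2 = gam H ε x :=
  Real.sq_sqrt (gam_pos hint x).le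

lemma continuous_wt (hH : Continuous H) (ε : ℝ) : Continuous (wt H ε) :=
  (continuous_gam hH ε).sqrt

lemma div_wt_sq (hint : GibbsIntegrable H ε) (a x : ℝ) :
    (a / wt H ε x) ^ 2 = a ^ 2 / gam H ε x := by
  rw [div_pow, wt_sq hint]

lemma mul_wt_sq (hint : GibbsIntegrable H ε) (a x : ℝ) :
    (wt H ε x * a) ^ 2 = gam H ε x * a ^ 2 := by
  rw [mul_pow, wt_sq hint]

lemma div_wt_mul_div_wt (hint : GibbsIntegrable H ε) (a b x : ℝ) :
    a / wt H ε x * (b / wt H ε x) = a / gam H ε x * b := by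
  rw [div_mul_div_comm, ← sq, wt_sq hint, div_mul_eq_mul_div]

lemma memLp_div_wt (hH : Continuous H) (hint : GibbsIntegrable H ε) {f : ℝ → ℝ}
    (hf : AEStronglyMeasurable f) (hfi : Integrable fun x => f x ^ 2 / gam H ε x) :
    MemLp (fun x => f x / wt H ε x) 2 := by
  refine (memLp_two_iff_integrable_sq
    (hf.aemeasurable.div (continuous_wt hH ε).aemeasurable).aestronglyMeasurable).2 ?_
  simpa only [Pi.div_apply, div_wt_sq hint] using hfi

lemma memLp_wt_mul (hH : Continuous H) (hint : GibbsIntegrable H ε) {f : ℝ → ℝ}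
    (hf : AEStronglyMeasurable f) (hfi : Integrable fun x => gam H ε x * f x ^ 2) :
    MemLp (fun x => wt H ε x * f x) 2 := by
  refine (memLp_two_iff_integrable_sq ((continuous_wt hH ε).aestronglyMeasurable.mul hf)).2 ?_
  simpa only [Pi.mul_apply, mul_wt_sq hint] using hfi

lemma memLp_wt_mul_of_bounded (hH : Continuous H) (hint : GibbsIntegrable H ε) {f : ℝ → ℝ} {M : ℝ}
    (hf : AEStronglyMeasurable f) (hfM : ∀ x, |f x| ≤ M) :
    MemLp (fun x => wt H ε x * f x) 2 := by
  refine memLp_wt_mul hH hint hf (((integrable_gam hint).const_mul (M ^ 2)).mono'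
    ((continuous_gam hH ε).aestronglyMeasurable.mul (hf.pow 2)) (ae_of_all _ fun x => ?_))
  have hγ := (gam_pos hint x).le
  rw [Real.norm_of_nonneg (by positivity), mul_comm]
  exact mul_le_mul_of_nonneg_right (sq_le_sq' (abs_le.1 (hfM x)).1 (abs_le.1 (hfM x)).2) hγ

end GibbsWeight

section Flux

lemma HasWeakDerivOn.mul_contDiff {f g η : ℝ → ℝ} (h : HasWeakDerivOn f g univ)
    (hη : ContDiff ℝ ∞ η) :
    HasWeakDerivOn (fun x => f x * η x) (fun x => g x * η x + f x * deriv η x) univ := by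
  obtain ⟨hf, hg, hfg⟩ := hasWeakDerivOn_univ.1 h
  have hη' : Continuous (deriv η) := hη.continuous_deriv (by simp)
  have hloc : ∀ {F a : ℝ → ℝ}, LocallyIntegrable F → Continuous a →
      LocallyIntegrable fun x => F x * a x := fun hF ha => by
    rw [← locallyIntegrableOn_univ] at hF ⊢
    exact hF.mul_continuousOn ha.continuousOn isOpen_univ.isLocallyClosed
  refine hasWeakDerivOn_univ.2
    ⟨hloc hf hη.continuous, (hloc hg hη.continuous).add (hloc hf hη'), fun ψ hψ hψs => ?_⟩
  have hψ' : Continuous (deriv ψ) := hψ.continuous_deriv (by simp)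
  have h_deriv : deriv (fun x => η x * ψ x) = fun x => deriv η x * ψ x + η x * deriv ψ x :=
    funext fun x => deriv_fun_mul (hη.differentiable (by simp) x) (hψ.differentiable (by simp) x)
  have h_test := hfg _ (hη.mul hψ) hψs.mul_left
  have hi₁ := integrable_mul_of_hasCompactSupport hf (hη'.mul hψ.continuous) hψs.mul_left
  have hi₂ := integrable_mul_of_hasCompactSupport hf (hη.continuous.mul hψ') hψs.deriv.mul_left
  have hi₃ := integrable_mul_of_hasCompactSupport hg (hη.continuous.mul hψ.continuous) hψs.mul_left
  simp only [Pi.mul_apply] at hi₁ hi₂ hi₃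
  rw [h_deriv] at h_test
  simp only [mul_add] at h_test
  rw [integral_add hi₁ hi₂] at h_test
  simp only [add_mul, mul_assoc]
  rw [integral_add hi₃ hi₁]
  linarith

variable {H : ℝ → ℝ} {ε : ℝ} {ρ r : ℝ → ℝ → ℝ} {t : ℝ}

lemma hasWeakDerivOn_div_gam (hH : ContDiff ℝ ∞ H) (hint : GibbsIntegrable H ε)
    (hr : HasWeakDerivOn (ρ t) (r t) univ) :
    HasWeakDerivOn (fun x => ρ t x / gam H ε x) (fun x => flux H ε ρ r t x / gam H ε x) univ := by
  have hγ := fun x => (gam_pos hint x).ne'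
  have hγ_deriv : ∀ x, HasDerivAt (gam H ε) (gam H ε x * (-deriv H x / ε ^ 2)) x := fun x =>
    ((((hH.differentiable (by simp) x).hasDerivAt.neg.div_const (ε ^ 2)).exp).const_mul
      (partitionFn H ε)⁻¹).congr_deriv (mul_assoc _ _ _).symm
  have h_inv_deriv : deriv (fun x => (gam H ε x)⁻¹) =
      fun x => (ε ^ 2)⁻¹ * deriv H x * (gam H ε x)⁻¹ := by
    ext x
    rw [((hγ_deriv x).fun_inv (hγ x)).deriv]
    have hγx := hγ x
    field_simp
  have h_mul := hr.mul_contDiff (η := fun x => (gam H ε x)⁻¹) ((contDiff_gam hH ε).inv hγ)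
  have h_flux : (fun x => flux H ε ρ r t x / gam H ε x) = fun x =>
      r t x * (gam H ε x)⁻¹ + ρ t x * ((ε ^ 2)⁻¹ * deriv H x * (gam H ε x)⁻¹) := by
    ext x
    rw [flux]
    ring
  rw [h_flux]
  simpa only [h_inv_deriv, div_eq_mul_inv] using h_mul

end Flux

section State

/-- The state `ρ(t) / √γ_ε` of a solution in `L²`, frozen for negative times. -/
def state (H : ℝ → ℝ) (ε : ℝ) (ρ : ℝ → ℝ → ℝ) (t : ℝ) : L2Line :=
  toL2 volume fun x => ρ (max t 0) x / wt H ε x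

/-- The time-integrated flux `∫_0^t (∂_x ρ + ε⁻² ρ H') / √γ_ε` of a solution in `L²`. -/
def fluxState (H : ℝ → ℝ) (ε : ℝ) (ρ r : ℝ → ℝ → ℝ) (t : ℝ) : L2Line :=
  toL2 volume fun x => (∫ s in Ioo 0 t, flux H ε ρ r s x) / wt H ε x

lemma inner_intervalIntegral {X : Type*} [NormedAddCommGroup X] [InnerProductSpace ℝ X]
    [CompleteSpace X] {u : ℝ → X} (hu : Continuous u) (a : X) (s t : ℝ) :
    ⟪∫ r in s..t, u r, a⟫ = ∫ r in s..t, ⟪u r, a⟫ := by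
  have h_comm := (innerSL ℝ a).intervalIntegral_comp_comm (hu.intervalIntegrable (μ := volume) s t)
  simp only [innerSL_apply_apply] at h_comm
  rw [real_inner_comm, ← h_comm]
  simp only [real_inner_comm]

variable {H : ℝ → ℝ} {ε : ℝ}

lemma MemL2Strip.memLp (hH : Continuous H) (hint : GibbsIntegrable H ε) {T : ℝ} {f : ℝ → ℝ → ℝ}
    (h : MemL2Strip H ε T f) :
    MemLp (fun p : ℝ × ℝ => f p.1 p.2 / wt H ε p.2) 2 (stripMeasure T) := by
  have hm : AEMeasurable (fun p : ℝ × ℝ => wt H ε p.2) (stripMeasure T) :=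
    ((continuous_wt hH ε).comp continuous_snd).aemeasurable
  refine (memLp_two_iff_integrable_sq (h.1.aemeasurable.div hm).aestronglyMeasurable).2 ?_
  simpa only [Pi.div_apply, Function.uncurry, div_wt_sq hint] using h.2

lemma memL2Strip_zero (H : ℝ → ℝ) (ε : ℝ) (f : ℝ → ℝ → ℝ) : MemL2Strip H ε 0 f := by
  simp only [MemL2Strip, stripMeasure, Ioo_self, Measure.restrict_empty, Measure.zero_prod]
  exact ⟨aestronglyMeasurable_zero_measure _, integrable_zero_measure⟩

lemma MemL2Strip.memLp_integral_time (hH : Continuous H) (hint : GibbsIntegrable H ε) {T : ℝ}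
    {f : ℝ → ℝ → ℝ} (h : MemL2Strip H ε T f) :
    MemLp (fun x => (∫ s in Ioo 0 T, f s x) / wt H ε x) 2 := by
  simpa only [integral_div] using memLp_integral_fst (h.memLp hH hint)

lemma MemL2Strip.integral_integral_time_mul (hH : Continuous H) (hint : GibbsIntegrable H ε)
    {T : ℝ} {f : ℝ → ℝ → ℝ} (h : MemL2Strip H ε T f) {q : ℝ → ℝ} (hq : MemLp q 2) :
    ∫ x, (∫ s in Ioo 0 T, f s x) / wt H ε x * q x =
      ∫ p, f p.1 p.2 / wt H ε p.2 * q p.2 ∂(stripMeasure T) := by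
  simpa only [integral_div, stripMeasure] using integral_integral_fst_mul (h.memLp hH hint) hq

end State

namespace IsSolution

variable {H : ℝ → ℝ} {ε : ℝ} {ρ0 : ℝ → ℝ} {ρ : ℝ → ℝ → ℝ}

lemma memLp (h : IsSolution H ε ρ0 ρ) (hH : Continuous H) (hint : GibbsIntegrable H ε) {t : ℝ}
    (ht : 0 ≤ t) : MemLp (fun x => ρ t x / wt H ε x) 2 :=
  memLp_div_wt hH hint (h.meas_slice t ht) (h.sq_integrable t ht)

lemma coeFn_state (h : IsSolution H ε ρ0 ρ) (hH : Continuous H) (hint : GibbsIntegrable H ε)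
    {t : ℝ} (ht : 0 ≤ t) : state H ε ρ t =ᵐ[volume] fun x => ρ t x / wt H ε x := by
  rw [state, max_eq_left ht]
  exact coeFn_toL2 (h.memLp hH hint ht)

lemma inner_state (h : IsSolution H ε ρ0 ρ) (hH : Continuous H) (hint : GibbsIntegrable H ε)
    {t : ℝ} (ht : 0 ≤ t) {b : ℝ → ℝ} (hb : MemLp (fun x => wt H ε x * b x) 2) :
    ⟪state H ε ρ t, toL2 volume fun x => wt H ε x * b x⟫ = ∫ x, ρ t x * b x := by
  rw [inner_eq_integral (h.coeFn_state hH hint ht) (coeFn_toL2 hb)]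
  simp only [div_mul_mul_cancel_weight (wt_ne_zero hint)]

lemma norm_state_sq (h : IsSolution H ε ρ0 ρ) (hH : Continuous H) (hint : GibbsIntegrable H ε)
    {t : ℝ} (ht : 0 ≤ t) : ‖state H ε ρ t‖ ^ 2 = ∫ x, ρ t x ^ 2 / gam H ε x := by
  rw [state, max_eq_left ht, norm_toL2_sq (h.memLp hH hint ht)]
  simp only [div_wt_sq hint]

lemma state_sub (h : IsSolution H ε ρ0 ρ) (hH : Continuous H) (hint : GibbsIntegrable H ε)
    {s t : ℝ} (hs : 0 ≤ s) (ht : 0 ≤ t) :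
    state H ε ρ t - state H ε ρ s = toL2 volume fun x => (ρ t x - ρ s x) / wt H ε x := by
  simp only [state, max_eq_left hs, max_eq_left ht, sub_div]
  exact toL2_sub (h.memLp hH hint ht) (h.memLp hH hint hs)

lemma memLp_sub (h : IsSolution H ε ρ0 ρ) (hH : Continuous H) (hint : GibbsIntegrable H ε)
    {s t : ℝ} (hs : 0 ≤ s) (ht : 0 ≤ t) : MemLp (fun x => (ρ t x - ρ s x) / wt H ε x) 2 := by
  simpa only [sub_div, Pi.sub_def] using (h.memLp hH hint ht).sub (h.memLp hH hint hs)

lemma norm_state_sub_sq (h : IsSolution H ε ρ0 ρ) (hH : Continuous H) (hint : GibbsIntegrable H ε)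
    {s t : ℝ} (hs : 0 ≤ s) (ht : 0 ≤ t) :
    ‖state H ε ρ t - state H ε ρ s‖ ^ 2 = ∫ x, (ρ t x - ρ s x) ^ 2 / gam H ε x := by
  rw [h.state_sub hH hint hs ht, norm_toL2_sq (h.memLp_sub hH hint hs ht)]
  simp only [div_wt_sq hint]

lemma continuous_state (h : IsSolution H ε ρ0 ρ) (hH : Continuous H) (hint : GibbsIntegrable H ε) :
    Continuous (state H ε ρ) := by
  have h_on : ContinuousOn (state H ε ρ) (Ici 0) := fun s hs => by
    have h_sq : Tendsto (fun t => ‖state H ε ρ t - state H ε ρ s‖ ^ 2) (𝓝[Ici 0] s) (𝓝 0) := by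
      refine (h.continuous s hs).congr' ?_
      filter_upwards [self_mem_nhdsWithin] with t ht
      exact (h.norm_state_sub_sq hH hint hs ht).symm
    have h_norm := h_sq.sqrt
    simp only [Real.sqrt_sq (norm_nonneg _), Real.sqrt_zero] at h_norm
    exact tendsto_iff_norm_sub_tendsto_zero.2 h_norm
  refine (h_on.comp_continuous (f := fun t : ℝ => max t 0) (by fun_prop)
    fun t => le_max_right t 0).congr fun t => ?_
  simp only [Function.comp_apply, state, max_assoc, max_self]

variable {r : ℝ → ℝ → ℝ}

lemma mem_derivGraph_fluxState (h : IsSolution H ε ρ0 ρ) (hH : ContDiff ℝ ∞ H)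
    (hint : GibbsIntegrable H ε)
    (hr : ∀ᵐ t ∂(volume.restrict (Ioi (0 : ℝ))), HasWeakDerivOn (ρ t) (r t) univ) {t : ℝ}
    (ht : 0 ≤ t) (hflux : MemL2Strip H ε t (flux H ε ρ r)) :
    (∫ s in (0 : ℝ)..t, state H ε ρ s, fluxState H ε ρ r t) ∈ derivGraph (wt H ε) := by
  have hHc := hH.continuous
  have hw := continuous_wt hHc ε
  have hw0 := wt_ne_zero hint
  refine mem_derivGraph_of_forall_inner hw hw0 fun ψ hψ hψs => ?_
  have hψ_mem := memLp_div_of_hasCompactSupport hw hw0 hψ.continuous hψs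
  have hψ'_mem := memLp_div_of_hasCompactSupport hw hw0 (hψ.continuous_deriv (by simp)) hψs.deriv
  have hF : Integrable (fun p : ℝ × ℝ => flux H ε ρ r p.1 p.2 / wt H ε p.2 * (ψ p.2 / wt H ε p.2))
      (stripMeasure t) := (hflux.memLp hHc hint).integrable_mul (hψ_mem.comp_snd _)
  have h_slice : ∀ᵐ s ∂(volume.restrict (Ioo 0 t)),
      ⟪state H ε ρ s, toL2 volume fun x => deriv ψ x / wt H ε x⟫ =
        -∫ x, flux H ε ρ r s x / wt H ε x * (ψ x / wt H ε x) := by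
    filter_upwards [ae_restrict_of_ae_restrict_of_subset Ioo_subset_Ioi_self hr,
      ae_restrict_mem measurableSet_Ioo] with s hrs hs
    rw [inner_eq_integral (h.coeFn_state hHc hint hs.1.le) (coeFn_toL2 hψ'_mem)]
    simp only [div_wt_mul_div_wt hint]
    exact (hasWeakDerivOn_univ.1 (hasWeakDerivOn_div_gam hH hint hrs)).2.2 ψ hψ hψs
  rw [inner_intervalIntegral (h.continuous_state hHc hint), intervalIntegral.integral_of_le ht,
    integral_Ioc_eq_integral_Ioo, fluxState,
    inner_toL2 (hflux.memLp_integral_time hHc hint) hψ_mem,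
    hflux.integral_integral_time_mul hHc hint hψ_mem, integral_congr_ae h_slice, integral_neg]
  exact congrArg _ (integral_prod _ hF).symm

lemma hasWeakDerivOn_integral_flux (h : IsSolution H ε ρ0 ρ) (hH : Continuous H)
    (hint : GibbsIntegrable H ε) {t : ℝ} (ht : 0 ≤ t) (hflux : MemL2Strip H ε t (flux H ε ρ r))
    (h_weak : ∀ ψ : ℝ → ℝ, ContDiff ℝ ∞ ψ → HasCompactSupport ψ →
      tau ε * ((∫ x, ρ t x * ψ x) - (∫ x, ρ0 x * ψ x)) =
        -∫ p, flux H ε ρ r p.1 p.2 * deriv ψ p.2 ∂(stripMeasure t)) :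
    HasWeakDerivOn (fun x => ∫ s in Ioo 0 t, flux H ε ρ r s x)
      (fun x => tau ε * (ρ t x - ρ 0 x)) univ := by
  have hw := continuous_wt hH ε
  have hw0 := wt_ne_zero hint
  have hρ : ∀ s, 0 ≤ s → LocallyIntegrable (ρ s) := fun s hs =>
    locallyIntegrable_of_memLp_div hw hw0 (h.memLp hH hint hs)
  refine hasWeakDerivOn_univ.2 ⟨locallyIntegrable_of_memLp_div hw hw0
    (hflux.memLp_integral_time hH hint), ((hρ t ht).sub (hρ 0 le_rfl)).smul (tau ε),
    fun ψ hψ hψs => ?_⟩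
  have hψ' : Continuous (deriv ψ) := hψ.continuous_deriv (by simp)
  have hψ'_mem : MemLp (fun x => wt H ε x * deriv ψ x) 2 :=
    (hw.mul hψ').memLp_of_hasCompactSupport hψs.deriv.mul_left
  have h_flux := hflux.integral_integral_time_mul hH hint hψ'_mem
  simp only [div_mul_mul_cancel_weight hw0] at h_flux
  have h_init : ∫ x, ρ0 x * ψ x = ∫ x, ρ 0 x * ψ x := by
    refine integral_congr_ae ?_
    filter_upwards [h.initial] with x hx
    rw [hx]
  have hi : ∀ s, 0 ≤ s → Integrable fun x => ρ s x * ψ x := fun s hs =>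
    integrable_mul_of_hasCompactSupport (hρ s hs) hψ.continuous hψs
  rw [h_flux, eq_neg_iff_add_eq_zero, add_comm, ← eq_neg_iff_add_eq_zero, ← h_weak ψ hψ hψs, h_init,
    ← integral_sub (hi t ht) (hi 0 le_rfl), ← integral_const_mul]
  simp only [sub_mul, mul_assoc]

lemma exists_isFormFlow (h : IsSolution H ε ρ0 ρ) (hH : ContDiff ℝ ∞ H)
    (hint : GibbsIntegrable H ε) :
    ∃ Q : ℝ → L2Line, Q 0 = 0 ∧ IsFormFlow (derivGraph (wt H ε)) (tau ε) (state H ε ρ 0)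
      (fun t => ∫ s in (0 : ℝ)..t, state H ε ρ s) (state H ε ρ) Q := by
  obtain ⟨r, hr, hflux, h_weak⟩ := h.weak_form
  have hHc := hH.continuous
  have h_cont := h.continuous_state hHc hint
  have hflux : ∀ t, 0 ≤ t → MemL2Strip H ε t (flux H ε ρ r) := fun t ht => by
    rcases ht.eq_or_lt with rfl | ht
    · exact memL2Strip_zero H ε _
    · exact hflux t ht
  refine ⟨fluxState H ε ρ r, ?_, fun t => ?_, h_cont,
    fun t ht => h.mem_derivGraph_fluxState hH hint hr ht (hflux t ht), fun t ht p hp => ?_⟩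
  · rw [← norm_eq_zero, ← sq_eq_zero_iff, fluxState,
      norm_toL2_sq ((hflux 0 le_rfl).memLp_integral_time hHc hint)]
    simp
  · exact intervalIntegral.integral_hasDerivAt_right (h_cont.intervalIntegrable _ _)
      (h_cont.stronglyMeasurableAtFilter _ _) h_cont.continuousAt
  · have h_mem := h.memLp_sub hHc hint le_rfl ht
    have h_parts := inner_eq_neg_inner_of_hasWeakDerivOn (wt_ne_zero hint)
      (h.hasWeakDerivOn_integral_flux hHc hint ht (hflux t ht)
        fun ψ hψ hψs => h_weak ψ hψ hψs t ht) ((hflux t ht).memLp_integral_time hHc hint)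
      (by simpa only [mul_div_assoc] using h_mem.const_mul (tau ε)) hp
    simp only [mul_div_assoc] at h_parts
    rwa [toL2_const_mul _ h_mem, ← h.state_sub hHc hint le_rfl ht, real_inner_smul_left] at h_parts

lemma norm_state_zero_sq_le (h : IsSolution H ε ρ0 ρ) (hH : Continuous H) (hε : 0 < ε)
    (hint : GibbsIntegrable H ε) {C c : ℝ} (hwp : WellPrepared H ε C c ρ0) :
    ‖state H ε ρ 0‖ ^ 2 ≤ C := by
  obtain ⟨-, -, -, d, -, -, -, hC⟩ := hwp
  have hd : 0 ≤ ∫ x, gam H ε x * d x ^ 2 / tau ε := integral_nonneg fun x =>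
    div_nonneg (mul_nonneg (gam_pos hint x).le (sq_nonneg _)) (tau_pos hε).le
  rw [h.norm_state_sq hH hint le_rfl]
  refine le_trans (integral_congr_ae ?_).le ((le_add_of_nonneg_right hd).trans hC)
  filter_upwards [h.initial] with x hx
  have hγ := (gam_pos hint x).ne'
  rw [hx]
  field_simp

lemma exists_initial_deriv (h : IsSolution H ε ρ0 ρ) (hH : Continuous H) (hε : 0 < ε)
    (hint : GibbsIntegrable H ε) {C c : ℝ} (hwp : WellPrepared H ε C c ρ0) :
    ∃ b, (state H ε ρ 0, b) ∈ derivGraph (wt H ε) ∧ ‖b‖ ^ 2 ≤ C * tau ε := by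
  obtain ⟨-, -, -, d, hd, -, hdi, hC⟩ := hwp
  have hτ := tau_pos hε
  obtain ⟨F, hF, hFe⟩ := hd.exists_isPrimitive
  have hb : MemLp (fun x => wt H ε x * d x) 2 := by
    refine memLp_wt_mul hH hint (hasWeakDerivOn_univ.1 hd).2.1.aestronglyMeasurable
      ((hdi.mul_const (tau ε)).congr (ae_of_all _ fun x => div_mul_cancel₀ _ hτ.ne'))
  refine ⟨toL2 volume fun x => wt H ε x * d x, ⟨F, d, hF, ?_, coeFn_toL2 hb⟩, ?_⟩
  · filter_upwards [h.coeFn_state hH hint le_rfl, hFe, h.initial] with x hx hFx h0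
    rw [hx, h0, ← hFx, ← wt_sq hint]
    have hw := wt_ne_zero hint x
    field_simp
  · have hρ0 : 0 ≤ ∫ x, gam H ε x * (ρ0 x / gam H ε x) ^ 2 := integral_nonneg fun x =>
      mul_nonneg (gam_pos hint x).le (sq_nonneg _)
    rw [norm_toL2_sq hb, ← div_le_iff₀ hτ, ← integral_div]
    simp only [mul_wt_sq hint]
    exact (le_add_of_nonneg_left hρ0).trans hC

end IsSolution

section TestFunctions

/-- The indicator function of the region `[-1, 1]` between the wells. -/
def barrier : ℝ → ℝ := (Icc (-1) 1).indicator 1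

/-- The sign function truncated to `[-2, 2]`. It tells the two wells apart and vanishes where `γ_ε`
carries no mass in the limit. -/
def wellSign : ℝ → ℝ := (Icc (-2) 2).indicator Real.sign

/-- The mass `∫_0^2 γ_ε` of one well. -/
def wellMass (H : ℝ → ℝ) (ε : ℝ) : ℝ := ∫ y in (0 : ℝ)..2, gam H ε y

/-- The derivative of `committor`. -/
def committorDeriv (H : ℝ → ℝ) (ε x : ℝ) : ℝ := conductance H ε * (barrier x / gam H ε x)

/-- The committor function: odd, equal to `±1` beyond the wells, and harmonic in between, where
its flux `γ_ε ∂_x` is the constant `conductance H ε`. -/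
def committor (H : ℝ → ℝ) (ε x : ℝ) : ℝ := ∫ y in (0 : ℝ)..x, committorDeriv H ε y

/-- The derivative of `plateau`. -/
def plateauDeriv (H : ℝ → ℝ) (ε x : ℝ) : ℝ := -(wellMass H ε)⁻¹ * (gam H ε x * wellSign x)

/-- The plateau function: even, supported in `[-2, 2]` and close to `barrier`, with slope
proportional to `∓γ_ε`. It replaces `barrier`, which has no derivative to test with. -/
def plateau (H : ℝ → ℝ) (ε x : ℝ) : ℝ := 1 + ∫ y in (0 : ℝ)..x, plateauDeriv H ε y

lemma measurable_barrier : Measurable barrier := measurable_one.indicator measurableSet_Icc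

lemma barrier_nonneg (x : ℝ) : 0 ≤ barrier x := indicator_nonneg (fun _ _ => zero_le_one) x

lemma barrier_of_le_one {x : ℝ} (h0 : 0 ≤ x) (h1 : x ≤ 1) : barrier x = 1 :=
  indicator_of_mem (mem_Icc.2 ⟨by linarith, h1⟩) _

lemma barrier_of_one_lt {x : ℝ} (h1 : 1 < x) : barrier x = 0 :=
  indicator_of_notMem (fun h => h.2.not_gt h1) _

lemma barrier_neg (x : ℝ) : barrier (-x) = barrier x := by
  simp only [barrier, indicator, Set.neg_mem_Icc_iff, neg_neg, Pi.one_apply]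

lemma measurable_wellSign : Measurable wellSign :=
  (Measurable.ite measurableSet_Iio measurable_const
    (Measurable.ite measurableSet_Ioi measurable_const measurable_const)).indicator
    measurableSet_Icc

lemma abs_wellSign_le (x : ℝ) : |wellSign x| ≤ 1 := by
  rw [wellSign, indicator]
  split_ifs
  · rcases Real.sign_apply_eq x with h | h | h <;> simp [h]
  · simp

lemma wellSign_neg (x : ℝ) : wellSign (-x) = -wellSign x := by
  simp only [wellSign, indicator, Set.neg_mem_Icc_iff, neg_neg, Real.sign_neg]
  split_ifs <;> simp

lemma wellSign_of_pos {x : ℝ} (h0 : 0 < x) (h2 : x ≤ 2) : wellSign x = 1 := by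
  rw [wellSign, indicator_of_mem (mem_Icc.2 ⟨by linarith, h2⟩), Real.sign_of_pos h0]

lemma wellSign_of_two_lt {x : ℝ} (h2 : 2 < x) : wellSign x = 0 :=
  indicator_of_notMem (fun h => h.2.not_gt h2) _

lemma wellSign_zero : wellSign 0 = 0 := by
  simp only [wellSign, indicator, Real.sign_zero, ite_self]

lemma integral_zero_neg_of_even {f : ℝ → ℝ} (hf : ∀ x, f (-x) = f x) (x : ℝ) :
    ∫ y in (0 : ℝ)..-x, f y = -∫ y in (0 : ℝ)..x, f y := by
  have h_comp := intervalIntegral.integral_comp_neg (a := 0) (b := x) f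
  simp only [hf, neg_zero] at h_comp
  rw [h_comp, intervalIntegral.integral_symm]

lemma integral_zero_neg_of_odd {f : ℝ → ℝ} (hf : ∀ x, f (-x) = -f x) (x : ℝ) :
    ∫ y in (0 : ℝ)..-x, f y = ∫ y in (0 : ℝ)..x, f y := by
  have h_comp := intervalIntegral.integral_comp_neg (a := 0) (b := x) f
  simp only [hf, neg_zero, intervalIntegral.integral_neg] at h_comp
  rw [intervalIntegral.integral_symm, ← h_comp, neg_neg]

variable {H : ℝ → ℝ} {ε : ℝ}

lemma continuous_inv_gam (hH : Continuous H) (hint : GibbsIntegrable H ε) :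
    Continuous fun x => (gam H ε x)⁻¹ :=
  (continuous_gam hH ε).inv₀ fun x => (gam_pos hint x).ne'

lemma integral_inv_gam_pos (hH : Continuous H) (hint : GibbsIntegrable H ε) :
    0 < ∫ x in (-1 : ℝ)..1, (gam H ε x)⁻¹ :=
  intervalIntegral.intervalIntegral_pos_of_pos
    ((continuous_inv_gam hH hint).intervalIntegrable _ _)
    (fun x => inv_pos.2 (gam_pos hint x)) (by norm_num)

lemma conductance_pos (hH : Continuous H) (hint : GibbsIntegrable H ε) : 0 < conductance H ε :=
  div_pos two_pos (integral_inv_gam_pos hH hint)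

lemma wellMass_pos (hH : Continuous H) (hint : GibbsIntegrable H ε) : 0 < wellMass H ε :=
  intervalIntegral.intervalIntegral_pos_of_pos ((continuous_gam hH ε).intervalIntegrable _ _)
    (gam_pos hint) two_pos

lemma integral_zero_one_conductance_div_gam (hH : Continuous H) (hH_even : ∀ x, H (-x) = H x)
    (hint : GibbsIntegrable H ε) :
    ∫ y in (0 : ℝ)..1, conductance H ε / gam H ε y = 1 := by
  have hi := (continuous_inv_gam hH hint).intervalIntegrable (μ := volume)
  have h_add := intervalIntegral.integral_add_adjacent_intervals (hi (-1) 0) (hi 0 1)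
  have h_symm := integral_zero_neg_of_even (f := fun x => (gam H ε x)⁻¹)
    (fun x => by rw [gam_neg hH_even]) 1
  rw [intervalIntegral.integral_symm, neg_inj] at h_symm
  have h_pos := integral_inv_gam_pos hH hint
  rw [h_symm, ← two_mul] at h_add
  simp only [div_eq_mul_inv, intervalIntegral.integral_const_mul]
  rw [conductance, div_mul_eq_mul_div, h_add, div_self h_pos.ne']

lemma isPrimitive_committor (hH : Continuous H) (hint : GibbsIntegrable H ε) :
    IsPrimitive (committor H ε) (committorDeriv H ε) := by
  have h_eq : committorDeriv H ε = (Icc (-1) 1).indicator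
      fun x => conductance H ε * (gam H ε x)⁻¹ := by
    ext x
    simp only [committorDeriv, barrier, indicator, Pi.one_apply]
    split_ifs <;> simp
  have h_loc : LocallyIntegrable (committorDeriv H ε) := by
    rw [h_eq]
    exact ((integrable_indicator_iff measurableSet_Icc).2
      (continuous_const.mul (continuous_inv_gam hH hint)).integrableOn_Icc).locallyIntegrable
  have h_prim := IsPrimitive.const_add_integral h_loc 0
  simp only [zero_add] at h_prim
  exact h_prim

lemma committor_zero : committor H ε 0 = 0 := intervalIntegral.integral_same

lemma committor_neg (hH_even : ∀ x, H (-x) = H x) (x : ℝ) :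
    committor H ε (-x) = -committor H ε x :=
  integral_zero_neg_of_even (fun y => by
    simp only [committorDeriv, barrier_neg, gam_neg hH_even]) x

lemma committorDeriv_nonneg (hH : Continuous H) (hint : GibbsIntegrable H ε) (x : ℝ) :
    0 ≤ committorDeriv H ε x :=
  mul_nonneg (conductance_pos hH hint).le (div_nonneg (barrier_nonneg x) (gam_pos hint x).le)

lemma one_sub_committor (hH : Continuous H) (hH_even : ∀ x, H (-x) = H x)
    (hint : GibbsIntegrable H ε) {x : ℝ} (h0 : 0 ≤ x) (h1 : x ≤ 1) :
    1 - committor H ε x = ∫ y in x..1, conductance H ε / gam H ε y := by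
  have hi : ∀ a b, IntervalIntegrable (fun y => conductance H ε / gam H ε y) volume a b := by
    simp only [div_eq_mul_inv]
    exact (continuous_const.mul (continuous_inv_gam hH hint)).intervalIntegrable
  have h_committor : committor H ε x = ∫ y in (0 : ℝ)..x, conductance H ε / gam H ε y := by
    refine intervalIntegral.integral_congr fun y hy => ?_
    rw [uIcc_of_le h0] at hy
    simp only [committorDeriv, barrier_of_le_one hy.1 (hy.2.trans h1), mul_one_div]
  rw [h_committor, ← intervalIntegral.integral_interval_sub_left (hi 0 1) (hi 0 x),
    integral_zero_one_conductance_div_gam hH hH_even hint]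

lemma committor_of_one_le (hH : Continuous H) (hH_even : ∀ x, H (-x) = H x)
    (hint : GibbsIntegrable H ε) {x : ℝ} (h1 : 1 ≤ x) : committor H ε x = 1 := by
  have h_one := one_sub_committor hH hH_even hint zero_le_one le_rfl
  rw [intervalIntegral.integral_same] at h_one
  have h_sub := (isPrimitive_committor hH hint).integral_eq_sub 1 x
  have h_zero : ∫ y in (1 : ℝ)..x, committorDeriv H ε y = 0 := by
    rw [intervalIntegral.integral_of_le h1]
    refine setIntegral_eq_zero_of_forall_eq_zero fun y hy => ?_
    rw [committorDeriv, barrier_of_one_lt hy.1, zero_div, mul_zero]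
  linarith

lemma committor_mem_Icc (hH : Continuous H) (hH_even : ∀ x, H (-x) = H x)
    (hint : GibbsIntegrable H ε) {x : ℝ} (h0 : 0 ≤ x) : committor H ε x ∈ Icc (0 : ℝ) 1 := by
  rcases le_total 1 x with h1 | h1
  · simp [committor_of_one_le hH hH_even hint h1]
  refine ⟨intervalIntegral.integral_nonneg h0 fun y _ => committorDeriv_nonneg hH hint y, ?_⟩
  rw [← sub_nonneg, one_sub_committor hH hH_even hint h0 h1]
  exact intervalIntegral.integral_nonneg h1 fun y _ =>
    div_nonneg (conductance_pos hH hint).le (gam_pos hint y).le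

lemma abs_committor_le (hH : Continuous H) (hH_even : ∀ x, H (-x) = H x)
    (hint : GibbsIntegrable H ε) (x : ℝ) : |committor H ε x| ≤ 1 := by
  wlog h0 : 0 ≤ x generalizing x
  · rw [← neg_neg x, committor_neg hH_even, abs_neg]
    exact this _ (by linarith)
  have h_mem := committor_mem_Icc hH hH_even hint h0
  rw [abs_of_nonneg h_mem.1]
  exact h_mem.2

lemma IsDoubleWell.gam_mul_one_sub_committor_le (hH : IsDoubleWell H)
    (hint : GibbsIntegrable H ε) {x : ℝ} (h0 : 0 ≤ x) (h1 : x ≤ 1) :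
    gam H ε x * (1 - committor H ε x) ≤ conductance H ε := by
  have hκ := conductance_pos hH.continuous hint
  have hi : Continuous fun y => gam H ε x * (conductance H ε / gam H ε y) := by
    simp only [div_eq_mul_inv]
    exact continuous_const.mul (continuous_const.mul (continuous_inv_gam hH.continuous hint))
  rw [one_sub_committor hH.continuous hH.even hint h0 h1, ← intervalIntegral.integral_const_mul]
  calc ∫ y in x..1, gam H ε x * (conductance H ε / gam H ε y)
      ≤ ∫ _ in x..1, conductance H ε := by
        refine intervalIntegral.integral_mono_on h1 (hi.intervalIntegrable _ _)
          intervalIntegrable_const fun y hy => ?_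
        have h_mono := hH.gam_monotoneOn ε ⟨h0, h1⟩ ⟨h0.trans hy.1, hy.2⟩ hy.1
        rw [← mul_div_assoc, div_le_iff₀ (gam_pos hint y), mul_comm]
        exact mul_le_mul_of_nonneg_left h_mono hκ.le
    _ = (1 - x) * conductance H ε := by rw [intervalIntegral.integral_const, smul_eq_mul]
    _ ≤ conductance H ε := mul_le_of_le_one_left hκ.le (by linarith)

lemma IsDoubleWell.gam_mul_committor_sub_wellSign_sq_le (hH : IsDoubleWell H)
    (hint : GibbsIntegrable H ε) (x : ℝ) :
    gam H ε x * (committor H ε x - wellSign x) ^ 2 ≤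
      conductance H ε * barrier x + {x | 2 ≤ |x|}.indicator 1 x * gam H ε x := by
  wlog h0 : 0 ≤ x generalizing x
  · have h_neg := this (-x) (by linarith)
    rw [gam_neg hH.even, committor_neg hH.even, wellSign_neg, barrier_neg, neg_sub_neg,
      ← neg_sub, neg_sq] at h_neg
    simpa only [indicator, mem_ofPred_eq, abs_neg, Pi.one_apply] using h_neg
  have hγ := gam_pos hint x
  have h_committor_one := @committor_of_one_le _ _ hH.continuous hH.even hint x
  have h_barrier : 0 ≤ conductance H ε * barrier x :=
    mul_nonneg (conductance_pos hH.continuous hint).le (barrier_nonneg x)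
  have h_tail : 0 ≤ {x : ℝ | 2 ≤ |x|}.indicator 1 x * gam H ε x :=
    mul_nonneg (indicator_nonneg (fun _ _ => zero_le_one) _) hγ.le
  rcases h0.eq_or_lt with rfl | h_pos
  · rw [committor_zero, wellSign_zero, sub_zero, zero_pow two_ne_zero, mul_zero]
    exact add_nonneg h_barrier h_tail
  rcases lt_or_ge 2 x with h2 | h2
  · have h_mem : x ∈ {x : ℝ | 2 ≤ |x|} := h2.le.trans (le_abs_self x)
    rw [h_committor_one (by linarith), wellSign_of_two_lt h2, indicator_of_mem h_mem,
      Pi.one_apply]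
    linarith
  rw [wellSign_of_pos h_pos h2]
  rcases le_total 1 x with h1 | h1
  · rw [h_committor_one h1, sub_self, zero_pow two_ne_zero, mul_zero]
    exact add_nonneg h_barrier h_tail
  rw [barrier_of_le_one h0 h1, mul_one]
  have h_mem := committor_mem_Icc hH.continuous hH.even hint h0
  have h_sq : (committor H ε x - 1) ^ 2 ≤ 1 - committor H ε x := by nlinarith [h_mem.1, h_mem.2]
  linarith [mul_le_mul_of_nonneg_left h_sq hγ.le, hH.gam_mul_one_sub_committor_le hint h0 h1]

lemma isPrimitive_plateau (hint : GibbsIntegrable H ε) :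
    IsPrimitive (plateau H ε) (plateauDeriv H ε) := by
  refine IsPrimitive.const_add_integral (Integrable.locallyIntegrable ?_) 1
  refine ((integrable_gam hint).mul_bdd (c := 1) measurable_wellSign.aestronglyMeasurable
    (ae_of_all _ fun x => ?_)).const_mul _
  exact abs_wellSign_le x

lemma plateau_neg (hH_even : ∀ x, H (-x) = H x) (x : ℝ) :
    plateau H ε (-x) = plateau H ε x := by
  rw [plateau, integral_zero_neg_of_odd fun y => by
    simp only [plateauDeriv, gam_neg hH_even, wellSign_neg, mul_neg], plateau]

lemma plateau_of_le_two {x : ℝ} (h0 : 0 ≤ x) (h2 : x ≤ 2) :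
    plateau H ε x = 1 - (wellMass H ε)⁻¹ * ∫ y in (0 : ℝ)..x, gam H ε y := by
  rw [plateau, sub_eq_add_neg, ← neg_mul, ← intervalIntegral.integral_const_mul,
    intervalIntegral.integral_of_le h0, intervalIntegral.integral_of_le h0]
  congr 1
  refine setIntegral_congr_fun measurableSet_Ioc fun y hy => ?_
  simp only [plateauDeriv, wellSign_of_pos hy.1 (hy.2.trans h2), mul_one]

lemma plateau_eq_integral (hH : Continuous H) (hint : GibbsIntegrable H ε) {x : ℝ} (h0 : 0 ≤ x)
    (h2 : x ≤ 2) : plateau H ε x = (wellMass H ε)⁻¹ * ∫ y in x..2, gam H ε y := by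
  have hi := (continuous_gam hH ε).intervalIntegrable (μ := volume)
  rw [plateau_of_le_two h0 h2, ← intervalIntegral.integral_interval_sub_left (hi 0 2) (hi 0 x),
    ← wellMass, mul_sub, inv_mul_cancel₀ (wellMass_pos hH hint).ne']

lemma plateau_of_two_le (hH : Continuous H) (hint : GibbsIntegrable H ε) {x : ℝ} (h2 : 2 ≤ x) :
    plateau H ε x = 0 := by
  have h_two := plateau_eq_integral hH hint zero_le_two le_rfl
  rw [intervalIntegral.integral_same, mul_zero] at h_two
  have h_sub := (isPrimitive_plateau hint).integral_eq_sub 2 x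
  have h_zero : ∫ y in (2 : ℝ)..x, plateauDeriv H ε y = 0 := by
    rw [intervalIntegral.integral_of_le h2]
    refine setIntegral_eq_zero_of_forall_eq_zero fun y hy => ?_
    rw [plateauDeriv, wellSign_of_two_lt hy.1, mul_zero, mul_zero]
  linarith

lemma IsDoubleWell.integral_zero_gam_le (hH : IsDoubleWell H) (hint : GibbsIntegrable H ε) {x : ℝ}
    (h0 : 0 ≤ x) (h1 : x ≤ 1) : ∫ y in (0 : ℝ)..x, gam H ε y ≤ gam H ε x := by
  calc ∫ y in (0 : ℝ)..x, gam H ε y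
      ≤ ∫ _ in (0 : ℝ)..x, gam H ε x :=
        intervalIntegral.integral_mono_on h0
          ((continuous_gam hH.continuous ε).intervalIntegrable _ _) intervalIntegrable_const
          fun y hy => hH.gam_monotoneOn ε ⟨hy.1, hy.2.trans h1⟩ ⟨h0, h1⟩ hy.2
    _ = x * gam H ε x := by rw [intervalIntegral.integral_const, smul_eq_mul, sub_zero]
    _ ≤ gam H ε x := mul_le_of_le_one_left (gam_pos hint x).le h1

lemma IsDoubleWell.integral_two_gam_le (hH : IsDoubleWell H) (hint : GibbsIntegrable H ε) {x : ℝ}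
    (h1 : 1 ≤ x) (h2 : x ≤ 2) : ∫ y in x..2, gam H ε y ≤ gam H ε x := by
  calc ∫ y in x..2, gam H ε y
      ≤ ∫ _ in x..2, gam H ε x :=
        intervalIntegral.integral_mono_on h2
          ((continuous_gam hH.continuous ε).intervalIntegrable _ _) intervalIntegrable_const
          fun y hy => hH.gam_antitoneOn ε h1 (h1.trans hy.1) hy.1
    _ = (2 - x) * gam H ε x := by rw [intervalIntegral.integral_const, smul_eq_mul]
    _ ≤ gam H ε x := mul_le_of_le_one_left (gam_pos hint x).le (by linarith)

lemma IsDoubleWell.abs_barrier_sub_plateau_le (hH : IsDoubleWell H) (hint : GibbsIntegrable H ε)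
    (x : ℝ) : |barrier x - plateau H ε x| ≤ (wellMass H ε)⁻¹ * gam H ε x := by
  wlog h0 : 0 ≤ x generalizing x
  · have h_neg := this (-x) (by linarith)
    rwa [gam_neg hH.even, plateau_neg hH.even, barrier_neg] at h_neg
  have hN := inv_pos.2 (wellMass_pos hH.continuous hint)
  have hγ := fun x => (gam_pos hint x).le
  rcases le_or_gt x 1 with h1 | h1
  · rw [barrier_of_le_one h0 h1, plateau_of_le_two h0 (by linarith), sub_sub_cancel, abs_of_nonneg
      (mul_nonneg hN.le (intervalIntegral.integral_nonneg h0 fun y _ => hγ y))]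
    exact mul_le_mul_of_nonneg_left (hH.integral_zero_gam_le hint h0 h1) hN.le
  rw [barrier_of_one_lt h1, zero_sub, abs_neg]
  rcases le_or_gt x 2 with h2 | h2
  · rw [plateau_eq_integral hH.continuous hint h0 h2, abs_of_nonneg
      (mul_nonneg hN.le (intervalIntegral.integral_nonneg h2 fun y _ => hγ y))]
    exact mul_le_mul_of_nonneg_left (hH.integral_two_gam_le hint h1.le h2) hN.le
  · rw [plateau_of_two_le hH.continuous hint h2.le, abs_zero]
    exact mul_nonneg hN.le (hγ x)

end TestFunctions

section TestFunctionsL2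

variable {H : ℝ → ℝ} {ε : ℝ}

lemma memLp_wt_mul_wellSign (hH : Continuous H) (hint : GibbsIntegrable H ε) :
    MemLp (fun x => wt H ε x * wellSign x) 2 :=
  memLp_wt_mul_of_bounded hH hint measurable_wellSign.aestronglyMeasurable abs_wellSign_le

lemma memLp_wt_mul_committor (hH : Continuous H) (hH_even : ∀ x, H (-x) = H x)
    (hint : GibbsIntegrable H ε) : MemLp (fun x => wt H ε x * committor H ε x) 2 :=
  memLp_wt_mul_of_bounded hH hint (isPrimitive_committor hH hint).continuous.aestronglyMeasurable
    (abs_committor_le hH hH_even hint)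

lemma memLp_barrier_div_wt (hH : Continuous H) (hint : GibbsIntegrable H ε) :
    MemLp (fun x => barrier x / wt H ε x) 2 := by
  have h_cont : Continuous fun x => (wt H ε x)⁻¹ :=
    (continuous_wt hH ε).inv₀ (wt_ne_zero hint)
  have h_eq : (fun x => barrier x / wt H ε x) =
      (Icc (-1) 1).indicator fun x => (wt H ε x)⁻¹ := by
    ext x
    simp only [barrier, indicator, Pi.one_apply]
    split_ifs <;> simp
  rw [h_eq, memLp_indicator_iff_restrict measurableSet_Icc,
    memLp_two_iff_integrable_sq h_cont.aestronglyMeasurable]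
  exact (h_cont.pow 2).integrableOn_Icc

lemma IsDoubleWell.sq_barrier_sub_plateau_div_gam_le (hH : IsDoubleWell H)
    (hint : GibbsIntegrable H ε) (x : ℝ) :
    (barrier x - plateau H ε x) ^ 2 / gam H ε x ≤ (wellMass H ε)⁻¹ ^ 2 * gam H ε x := by
  have h_sq := pow_le_pow_left₀ (abs_nonneg _) (hH.abs_barrier_sub_plateau_le hint x) 2
  rw [sq_abs, mul_pow, sq (gam H ε x), ← mul_assoc] at h_sq
  exact (div_le_iff₀ (gam_pos hint x)).2 h_sq

lemma IsDoubleWell.memLp_barrier_sub_plateau_div_wt (hH : IsDoubleWell H)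
    (hint : GibbsIntegrable H ε) :
    MemLp (fun x => (barrier x - plateau H ε x) / wt H ε x) 2 := by
  have h_meas := measurable_barrier.sub (isPrimitive_plateau hint).continuous.measurable
  refine memLp_div_wt hH.continuous hint h_meas.aestronglyMeasurable
    (((integrable_gam hint).const_mul ((wellMass H ε)⁻¹ ^ 2)).mono'
      ((h_meas.pow_const 2).div (continuous_gam hH.continuous ε).measurable).aestronglyMeasurable
      (ae_of_all _ fun x => ?_))
  rw [Real.norm_of_nonneg (div_nonneg (sq_nonneg _) (gam_pos hint x).le)]
  exact hH.sq_barrier_sub_plateau_div_gam_le hint x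

lemma IsDoubleWell.memLp_plateau_div_wt (hH : IsDoubleWell H) (hint : GibbsIntegrable H ε) :
    MemLp (fun x => plateau H ε x / wt H ε x) 2 := by
  have h_sub := (memLp_barrier_div_wt hH.continuous hint).sub
    (hH.memLp_barrier_sub_plateau_div_wt hint)
  simpa only [Pi.sub_def, ← sub_div, sub_sub_cancel] using h_sub

lemma IsDoubleWell.norm_toL2_barrier_sub_plateau_le (hH : IsDoubleWell H)
    (hint : GibbsIntegrable H ε) :
    ‖(toL2 volume fun x => barrier x / wt H ε x) - toL2 volume fun x => plateau H ε x / wt H ε x‖ ≤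
      (wellMass H ε)⁻¹ := by
  rw [toL2_sub (memLp_barrier_div_wt hH.continuous hint) (hH.memLp_plateau_div_wt hint)]
  simp only [← sub_div]
  refine le_of_sq_le_sq ?_ (inv_pos.2 (wellMass_pos hH.continuous hint)).le
  rw [norm_toL2_sq (hH.memLp_barrier_sub_plateau_div_wt hint)]
  simp only [div_wt_sq hint]
  calc ∫ x, (barrier x - plateau H ε x) ^ 2 / gam H ε x
      ≤ ∫ x, (wellMass H ε)⁻¹ ^ 2 * gam H ε x :=
        integral_mono_of_nonneg
          (ae_of_all _ fun x => div_nonneg (sq_nonneg _) (gam_pos hint x).le)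
          ((integrable_gam hint).const_mul _)
          (ae_of_all _ (hH.sq_barrier_sub_plateau_div_gam_le hint))
    _ = (wellMass H ε)⁻¹ ^ 2 := by rw [integral_const_mul, integral_gam hint, mul_one]

lemma wt_mul_committorDeriv (hint : GibbsIntegrable H ε) (x : ℝ) :
    wt H ε x * committorDeriv H ε x = conductance H ε * (barrier x / wt H ε x) := by
  have hw := wt_ne_zero hint x
  rw [committorDeriv, ← wt_sq hint]
  field_simp

lemma plateauDeriv_div_wt (hint : GibbsIntegrable H ε) (x : ℝ) :
    plateauDeriv H ε x / wt H ε x = -(wellMass H ε)⁻¹ * (wt H ε x * wellSign x) := by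
  have hw := wt_ne_zero hint x
  rw [plateauDeriv, ← wt_sq hint]
  field_simp

end TestFunctionsL2

namespace IsSolution

variable {H : ℝ → ℝ} {ε C c : ℝ} {ρ0 : ℝ → ℝ} {ρ : ℝ → ℝ → ℝ}

lemma norm_state_le (h : IsSolution H ε ρ0 ρ) (hH : ContDiff ℝ ∞ H) (hε : 0 < ε)
    (hint : GibbsIntegrable H ε) (hwp : WellPrepared H ε C c ρ0) {t : ℝ} (ht : 0 ≤ t) :
    ‖state H ε ρ t‖ ≤ Real.sqrt C := by
  obtain ⟨Q, -, hF⟩ := h.exists_isFormFlow hH hint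
  exact (hF.norm_deriv_le (tau_pos hε) ht).trans
    (Real.le_sqrt_of_sq_le (h.norm_state_zero_sq_le hH.continuous hε hint hwp))

lemma integrable_mul (h : IsSolution H ε ρ0 ρ) (hH : Continuous H) (hint : GibbsIntegrable H ε)
    {t : ℝ} (ht : 0 ≤ t) {g : ℝ → ℝ} (hg : MemLp (fun x => wt H ε x * g x) 2) :
    Integrable fun x => ρ t x * g x := by
  have h_mul := (h.memLp hH hint ht).integrable_mul hg
  simpa only [Pi.mul_def, div_mul_mul_cancel_weight (wt_ne_zero hint)] using h_mul

lemma integrable (h : IsSolution H ε ρ0 ρ) (hH : Continuous H) (hint : GibbsIntegrable H ε)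
    {t : ℝ} (ht : 0 ≤ t) : Integrable (ρ t) := by
  have h_mul := h.integrable_mul hH hint ht (g := fun _ => 1)
    (memLp_wt_mul_of_bounded hH hint (M := 1) aestronglyMeasurable_const (by simp))
  simpa only [mul_one] using h_mul

lemma abs_integral_mul_le (h : IsSolution H ε ρ0 ρ) (hH : ContDiff ℝ ∞ H) (hε : 0 < ε)
    (hint : GibbsIntegrable H ε) (hwp : WellPrepared H ε C c ρ0) {t : ℝ} (ht : 0 ≤ t) {g : ℝ → ℝ}
    (hg : MemLp (fun x => wt H ε x * g x) 2) :
    |∫ x, ρ t x * g x| ≤ Real.sqrt C * Real.sqrt (∫ x, gam H ε x * g x ^ 2) := by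
  rw [← h.inner_state hH.continuous hint ht hg]
  have h_norm : ‖toL2 volume fun x => wt H ε x * g x‖ ≤ Real.sqrt (∫ x, gam H ε x * g x ^ 2) := by
    refine Real.le_sqrt_of_sq_le (le_of_eq ?_)
    simp only [norm_toL2_sq hg, mul_wt_sq hint]
  exact (abs_real_inner_le_norm _ _).trans (mul_le_mul (h.norm_state_le hH hε hint hwp ht) h_norm
    (norm_nonneg _) (Real.sqrt_nonneg _))

lemma integral_eq_initial (h : IsSolution H ε ρ0 ρ) (hH : ContDiff ℝ ∞ H) (hε : 0 < ε)
    (hint : GibbsIntegrable H ε) {t : ℝ} (ht : 0 ≤ t) : ∫ x, ρ t x = ∫ x, ρ0 x := by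
  obtain ⟨Q, -, hF⟩ := h.exists_isFormFlow hH hint
  have hP : IsPrimitive (fun _ => (1 : ℝ)) (fun _ => 0) := ⟨locallyIntegrable_zero, by simp⟩
  have h_one : MemLp (fun x => wt H ε x * (1 : ℝ)) 2 :=
    memLp_wt_mul_of_bounded hH.continuous hint (M := 1) aestronglyMeasurable_const (by simp)
  have h_zero : MemLp (fun x => wt H ε x * (0 : ℝ)) 2 := by
    simp only [mul_zero]
    exact MemLp.zero
  have h_toL2 : (toL2 volume fun x => wt H ε x * (0 : ℝ)) = 0 := by
    simpa only [zero_mul, zero_smul, mul_zero] using toL2_const_mul 0 h_one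
  have h_test := hF.weak t ht _ (hP.mem_derivGraph h_one h_zero)
  rw [h_toL2, inner_zero_right, neg_zero, inner_sub_left, h.inner_state hH.continuous hint ht h_one,
    h.inner_state hH.continuous hint le_rfl h_one] at h_test
  simp only [mul_one] at h_test
  rw [← integral_congr_ae h.initial]
  exact sub_eq_zero.1 ((mul_eq_zero.1 h_test).resolve_left (tau_pos hε).ne')

lemma tau_mul_integral_committor_sub (h : IsSolution H ε ρ0 ρ) (hH : Continuous H)
    (hH_even : ∀ x, H (-x) = H x) (hint : GibbsIntegrable H ε) {V Q : ℝ → L2Line}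
    (hF : IsFormFlow (derivGraph (wt H ε)) (tau ε) (state H ε ρ 0) V (state H ε ρ) Q)
    {t : ℝ} (ht : 0 ≤ t) :
    tau ε * ((∫ x, ρ t x * committor H ε x) - ∫ x, ρ 0 x * committor H ε x) =
      -(conductance H ε * ⟪Q t, toL2 volume fun x => barrier x / wt H ε x⟫) := by
  have h_mem := memLp_wt_mul_committor hH hH_even hint
  have h_barrier := memLp_barrier_div_wt hH hint
  have h_deriv : MemLp (fun x => wt H ε x * committorDeriv H ε x) 2 := by
    simpa only [wt_mul_committorDeriv hint] using h_barrier.const_mul (conductance H ε)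
  have h_test := hF.weak t ht _ ((isPrimitive_committor hH hint).mem_derivGraph h_mem h_deriv)
  simp only [wt_mul_committorDeriv hint, toL2_const_mul _ h_barrier, inner_smul_right,
    inner_sub_left, h.inner_state hH hint ht h_mem, h.inner_state hH hint le_rfl h_mem] at h_test
  exact h_test

lemma integral_wellSign_eq_inner_plateau (h : IsSolution H ε ρ0 ρ) (hH : IsDoubleWell H)
    (hint : GibbsIntegrable H ε) {V' Q : ℝ → L2Line}
    (hF : IsFormFlow (derivGraph (wt H ε)) (tau ε) (state H ε ρ 0)
      (fun t => ∫ s in (0 : ℝ)..t, state H ε ρ s) V' Q) {t : ℝ} (ht : 0 ≤ t) :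
    (wellMass H ε)⁻¹ * ∫ s in (0 : ℝ)..t, ∫ x, ρ s x * wellSign x =
      ⟪Q t, toL2 volume fun x => plateau H ε x / wt H ε x⟫ := by
  have h_sign := memLp_wt_mul_wellSign hH.continuous hint
  have h_deriv : MemLp (fun x => plateauDeriv H ε x / wt H ε x) 2 := by
    simpa only [plateauDeriv_div_wt hint] using h_sign.const_mul (-(wellMass H ε)⁻¹)
  have h_parts := inner_eq_neg_inner_of_hasWeakDerivOn (wt_ne_zero hint)
    ((isPrimitive_plateau hint).hasWeakDerivOn univ) (hH.memLp_plateau_div_wt hint) h_deriv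
    (hF.mem_graph t ht)
  have h_inner : ∫ s in (0 : ℝ)..t, ⟪state H ε ρ s, toL2 volume fun x => wt H ε x * wellSign x⟫ =
      ∫ s in (0 : ℝ)..t, ∫ x, ρ s x * wellSign x := by
    refine intervalIntegral.integral_congr fun s hs => ?_
    rw [uIcc_of_le ht] at hs
    exact h.inner_state hH.continuous hint hs.1 h_sign
  simp only [plateauDeriv_div_wt hint, toL2_const_mul _ h_sign] at h_parts
  rw [real_inner_smul_left, real_inner_comm,
    inner_intervalIntegral (h.continuous_state hH.continuous hint), h_inner,
    neg_mul, neg_inj] at h_parts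
  rw [h_parts, real_inner_comm]

lemma abs_committor_balance_le (h : IsSolution H ε ρ0 ρ) (hH : IsDoubleWell H) (hε : 0 < ε)
    (hint : GibbsIntegrable H ε) (hwp : WellPrepared H ε C c ρ0) {t : ℝ} (ht : 0 ≤ t) :
    |(∫ x, ρ t x * committor H ε x) - (∫ x, ρ 0 x * committor H ε x) +
      conductance H ε / tau ε * (wellMass H ε)⁻¹ * ∫ s in (0 : ℝ)..t, ∫ x, ρ s x * wellSign x| ≤
      conductance H ε / tau ε * (t * Real.sqrt (C * tau ε) * (wellMass H ε)⁻¹) := by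
  obtain ⟨Q, hQ0, hF⟩ := h.exists_isFormFlow hH.smooth hint
  obtain ⟨b, hb, hbC⟩ := h.exists_initial_deriv hH.continuous hε hint hwp
  have hτ := tau_pos hε
  have h_flux : ‖Q t‖ ≤ t * Real.sqrt (C * tau ε) :=
    (hF.norm_le_mul hτ.le hQ0 hb ht).trans
      (mul_le_mul_of_nonneg_left (Real.le_sqrt_of_sq_le hbC) ht)
  have h_committor := h.tau_mul_integral_committor_sub hH.continuous hH.even hint hF ht
  have h_plateau := h.integral_wellSign_eq_inner_plateau hH hint hF ht
  have h_balance : (∫ x, ρ t x * committor H ε x) - (∫ x, ρ 0 x * committor H ε x) +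
      conductance H ε / tau ε * (wellMass H ε)⁻¹ * ∫ s in (0 : ℝ)..t, ∫ x, ρ s x * wellSign x =
      -(conductance H ε / tau ε) * ⟪Q t, (toL2 volume fun x => barrier x / wt H ε x) -
        toL2 volume fun x => plateau H ε x / wt H ε x⟫ := by
    rw [mul_assoc, h_plateau, inner_sub_right]
    field_simp
    linear_combination h_committor
  have hκτ := div_pos (conductance_pos hH.continuous hint) hτ
  rw [h_balance, abs_mul, abs_neg, abs_of_pos hκτ]
  refine mul_le_mul_of_nonneg_left ((abs_real_inner_le_norm _ _).trans ?_) hκτ.le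
  exact mul_le_mul h_flux (hH.norm_toL2_barrier_sub_plateau_le hint) (norm_nonneg _)
    ((norm_nonneg _).trans h_flux)

end IsSolution

section CommittorSign

variable {H : ℝ → ℝ} {ε C c : ℝ} {ρ0 : ℝ → ℝ} {ρ : ℝ → ℝ → ℝ}

lemma integral_barrier : ∫ x, barrier x = 2 := by
  simp only [barrier, Pi.one_def, integral_indicator measurableSet_Icc, integral_const,
    MeasurableSet.univ, measureReal_restrict_apply, univ_inter, Real.volume_real_Icc]
  norm_num

lemma IsDoubleWell.integral_gam_mul_committor_sub_wellSign_sq_le (hH : IsDoubleWell H)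
    (hint : GibbsIntegrable H ε) :
    ∫ x, gam H ε x * (committor H ε x - wellSign x) ^ 2 ≤
      2 * conductance H ε + ∫ x, {x | 2 ≤ |x|}.indicator 1 x * gam H ε x := by
  have h_barrier : Integrable fun x => conductance H ε * barrier x :=
    ((integrable_indicator_iff measurableSet_Icc).2 (by simp [Pi.one_def])).const_mul _
  have h_tail : Integrable fun x => {x : ℝ | 2 ≤ |x|}.indicator 1 x * gam H ε x :=
    (integrable_gam hint).bdd_mul (c := 1)
      (measurable_one.indicator
        (measurableSet_le measurable_const measurable_id.abs)).aestronglyMeasurable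
      (ae_of_all _ fun x => (norm_indicator_le_norm_self _ _).trans (by simp))
  calc ∫ x, gam H ε x * (committor H ε x - wellSign x) ^ 2
      ≤ ∫ x, (conductance H ε * barrier x + {x | 2 ≤ |x|}.indicator 1 x * gam H ε x) :=
        integral_mono_of_nonneg
          (ae_of_all _ fun x => mul_nonneg (gam_pos hint x).le (sq_nonneg _))
          (h_barrier.add h_tail)
          (ae_of_all _ fun x => hH.gam_mul_committor_sub_wellSign_sq_le hint x)
    _ = 2 * conductance H ε + ∫ x, {x | 2 ≤ |x|}.indicator 1 x * gam H ε x := by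
        rw [integral_add h_barrier h_tail, integral_const_mul, integral_barrier, mul_comm]

lemma IsSolution.abs_integral_committor_sub_le (h : IsSolution H ε ρ0 ρ) (hH : IsDoubleWell H)
    (hε : 0 < ε) (hint : GibbsIntegrable H ε) (hwp : WellPrepared H ε C c ρ0) {t : ℝ}
    (ht : 0 ≤ t) :
    |(∫ x, ρ t x * committor H ε x) - ∫ x, ρ t x * wellSign x| ≤ Real.sqrt C *
      Real.sqrt (2 * conductance H ε + ∫ x, {x | 2 ≤ |x|}.indicator 1 x * gam H ε x) := by
  have h_sign := memLp_wt_mul_wellSign hH.continuous hint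
  have h_committor := memLp_wt_mul_committor hH.continuous hH.even hint
  have h_diff : MemLp (fun x => wt H ε x * (committor H ε x - wellSign x)) 2 := by
    simpa only [mul_sub, Pi.sub_def] using h_committor.sub h_sign
  have h_bound := h.abs_integral_mul_le hH.smooth hε hint hwp ht h_diff
  simp only [mul_sub] at h_bound
  rw [integral_sub (h.integrable_mul hH.continuous hint ht h_committor)
    (h.integrable_mul hH.continuous hint ht h_sign)] at h_bound
  exact h_bound.trans (mul_le_mul_of_nonneg_left
    (Real.sqrt_le_sqrt (hH.integral_gam_mul_committor_sub_wellSign_sq_le hint))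
    (Real.sqrt_nonneg C))

end CommittorSign

section Stability

variable {D : ℝ → ℝ} {K k η d₀ T : ℝ}

lemma hasDerivAt_integral_sub_exp (hk : k ≠ 0) (hD : Continuous D) (t : ℝ) :
    HasDerivAt (fun t => (∫ s in (0 : ℝ)..t, D s) - d₀ / k * (1 - Real.exp (-k * t)))
      (D t - d₀ * Real.exp (-k * t)) t := by
  have h_exp : HasDerivAt (fun t => d₀ / k * (1 - Real.exp (-k * t)))
      (d₀ / k * -(Real.exp (-k * t) * (-k * 1))) t :=
    ((((hasDerivAt_id t).const_mul (-k)).exp).const_sub 1).const_mul _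
  refine ((hD.integral_hasStrictDerivAt 0 t).hasDerivAt.sub h_exp).congr_deriv ?_
  field_simp

lemma abs_sub_exp_le_mul_abs_integral_sub (hk : 0 < k)
    (hD1 : ∀ t ∈ Icc 0 T, |D t| ≤ 1) {t : ℝ} (ht : t ∈ Icc 0 T)
    (h : |D t - D 0 + K * ∫ s in (0 : ℝ)..t, D s| ≤ η) :
    |D t - d₀ * Real.exp (-k * t)| ≤
      k * |(∫ s in (0 : ℝ)..t, D s) - d₀ / k * (1 - Real.exp (-k * t))| +
        (η + |D 0 - d₀| + |K - k| * T) := by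
  set I := ∫ s in (0 : ℝ)..t, D s
  set E := I - d₀ / k * (1 - Real.exp (-k * t)) with hE
  have hI : |I| ≤ T := by
    have h_norm := intervalIntegral.norm_integral_le_of_norm_le_const (a := 0) (b := t) (C := 1)
      (f := D) fun s hs => by
        rw [uIoc_of_le ht.1] at hs
        exact hD1 s ⟨hs.1.le, hs.2.trans ht.2⟩
    rw [sub_zero, one_mul, abs_of_nonneg ht.1] at h_norm
    exact h_norm.trans ht.2
  have h_split : D t - d₀ * Real.exp (-k * t) =
      (D t - D 0 + K * I) + (D 0 - d₀) - (K - k) * I - k * E := by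
    rw [hE]
    field_simp
    ring
  have hKI : |(K - k) * I| ≤ |K - k| * T := by
    rw [abs_mul]
    exact mul_le_mul_of_nonneg_left hI (abs_nonneg _)
  have hkE : |k * E| = k * |E| := by rw [abs_mul, abs_of_pos hk]
  calc |D t - d₀ * Real.exp (-k * t)|
      ≤ |D t - D 0 + K * I| + |D 0 - d₀| + |(K - k) * I| + |k * E| := by
        rw [h_split]
        exact (abs_sub _ _).trans (add_le_add_left ((abs_sub _ _).trans
          (add_le_add_left (abs_add_le _ _) _)) _)
    _ ≤ k * |E| + (η + |D 0 - d₀| + |K - k| * T) := by linarith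

lemma abs_sub_exp_le_of_integral (hk : 0 < k) (hD : Continuous D)
    (hD1 : ∀ t ∈ Icc 0 T, |D t| ≤ 1)
    (h : ∀ t ∈ Icc 0 T, |D t - D 0 + K * ∫ s in (0 : ℝ)..t, D s| ≤ η) {t : ℝ}
    (ht : t ∈ Icc 0 T) :
    |D t - d₀ * Real.exp (-k * t)| ≤ (η + |D 0 - d₀| + |K - k| * T) * Real.exp (k * t) := by
  set ν := η + |D 0 - d₀| + |K - k| * T
  set E : ℝ → ℝ := fun t => (∫ s in (0 : ℝ)..t, D s) - d₀ / k * (1 - Real.exp (-k * t)) with hE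
  have hE_deriv : ∀ t, HasDerivAt E (D t - d₀ * Real.exp (-k * t)) t :=
    hasDerivAt_integral_sub_exp hk.ne' hD
  have h_bound : ∀ t ∈ Icc 0 T, |D t - d₀ * Real.exp (-k * t)| ≤ k * |E t| + ν := fun t ht =>
    abs_sub_exp_le_mul_abs_integral_sub hk hD1 ht (h t ht)
  have h_gronwall := norm_le_gronwallBound_of_norm_deriv_right_le (f := E)
    (f' := fun t => D t - d₀ * Real.exp (-k * t)) (δ := 0) (K := k) (ε := ν) (a := 0) (b := T)
    (fun t _ => (hE_deriv t).continuousAt.continuousWithinAt)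
    (fun t _ => (hE_deriv t).hasDerivWithinAt) (by simp [hE])
    (fun t ht => h_bound t ⟨ht.1, ht.2.le⟩) t ht
  simp only [gronwallBound_of_K_ne_0 hk.ne', zero_mul, zero_add, sub_zero,
    Real.norm_eq_abs] at h_gronwall
  have hkE : k * |E t| ≤ ν * (Real.exp (k * t) - 1) := by
    calc k * |E t| ≤ k * (ν / k * (Real.exp (k * t) - 1)) :=
          mul_le_mul_of_nonneg_left h_gronwall hk.le
      _ = ν * (Real.exp (k * t) - 1) := by field_simp
  linarith [h_bound t ht]

end Stability

section WellLimits

lemma continuousAt_wellSign_one : ContinuousAt wellSign 1 := by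
  have h_one : wellSign =ᶠ[𝓝 1] fun _ => 1 := by
    filter_upwards [Ioo_mem_nhds (zero_lt_one' ℝ) one_lt_two] with x hx
    exact wellSign_of_pos hx.1 hx.2.le
  exact continuousAt_const.congr h_one.symm

lemma continuousAt_wellSign_neg_one : ContinuousAt wellSign (-1) := by
  have h_odd : wellSign = fun x => -wellSign (-x) := by
    ext x
    rw [wellSign_neg, neg_neg]
  rw [h_odd]
  exact (ContinuousAt.comp (by rw [neg_neg]; exact continuousAt_wellSign_one) continuousAt_neg).neg

lemma wellSign_one : wellSign 1 = 1 := wellSign_of_pos one_pos one_le_two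

lemma wellSign_neg_one : wellSign (-1) = -1 := by rw [wellSign_neg, wellSign_one]

variable {H : ℝ → ℝ} {ε₁ : ℝ}

lemma IsDoubleWell.tendsto_integral_indicator_mul_gam (hH : IsDoubleWell H) (hε₁ : 0 < ε₁)
    (hint : GibbsIntegrable H ε₁) {s : Set ℝ} (hs : MeasurableSet s) (h_right : 1 ∉ frontier s)
    (h_left : -1 ∉ frontier s) :
    Tendsto (fun ε => ∫ x, s.indicator 1 x * gam H ε x) (𝓝[>] 0)
      (𝓝 ((s.indicator 1 1 + s.indicator 1 (-1)) / 2)) :=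
  hH.tendsto_integral_mul_gam hε₁ hint (M := 1) (measurable_one.indicator hs)
    (fun x => by by_cases hx : x ∈ s <;> simp [hx])
    (continuousOn_const.continuousAt_indicator h_right)
    (continuousOn_const.continuousAt_indicator h_left)

lemma IsDoubleWell.tendsto_wellMass (hH : IsDoubleWell H) (hε₁ : 0 < ε₁)
    (hint : GibbsIntegrable H ε₁) : Tendsto (wellMass H) (𝓝[>] 0) (𝓝 (1 / 2)) := by
  have h_lim := hH.tendsto_integral_indicator_mul_gam hε₁ hint (measurableSet_Ioc (a := 0) (b := 2))
    (by rw [frontier_Ioc two_pos]; norm_num) (by rw [frontier_Ioc two_pos]; norm_num)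
  have h_value : ((Ioc (0 : ℝ) 2).indicator 1 1 + (Ioc (0 : ℝ) 2).indicator 1 (-1)) / 2 =
      (1 / 2 : ℝ) := by
    norm_num [indicator]
  rw [h_value] at h_lim
  refine h_lim.congr fun ε => ?_
  rw [wellMass, intervalIntegral.integral_of_le zero_le_two,
    ← integral_indicator measurableSet_Ioc]
  refine integral_congr_ae (ae_of_all _ fun x => ?_)
  by_cases hx : x ∈ Ioc (0 : ℝ) 2
  · simp only [indicator_of_mem hx, Pi.one_apply, one_mul]
  · simp only [indicator_of_notMem hx, zero_mul]

lemma IsDoubleWell.tendsto_outer_mass (hH : IsDoubleWell H) (hε₁ : 0 < ε₁)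
    (hint : GibbsIntegrable H ε₁) :
    Tendsto (fun ε => ∫ x, {x | 2 ≤ |x|}.indicator 1 x * gam H ε x) (𝓝[>] 0) (𝓝 0) := by
  have h_frontier : ∀ y : ℝ, |y| = 1 → y ∉ frontier {x : ℝ | 2 ≤ |x|} := fun y hy h => by
    have h_eq : 2 = |y| := frontier_le_subset_eq continuous_const continuous_abs h
    norm_num [hy] at h_eq
  have h_lim := hH.tendsto_integral_indicator_mul_gam hε₁ hint
    (measurableSet_le measurable_const measurable_id.abs) (h_frontier 1 (by norm_num))
    (h_frontier (-1) (by norm_num))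
  simpa [indicator] using h_lim

lemma IsDoubleWell.tendsto_conductance (hH : IsDoubleWell H) (hε₁ : 0 < ε₁)
    (hint : GibbsIntegrable H ε₁) : Tendsto (conductance H) (𝓝[>] 0) (𝓝 0) := by
  have h_lim := (hH.tendsto_conductance_div_tau hε₁ hint).mul tendsto_tau
  rw [mul_zero] at h_lim
  refine h_lim.congr' ?_
  filter_upwards [self_mem_nhdsWithin] with ε hε
  exact div_mul_cancel₀ _ (tau_pos hε).ne'

lemma IsDoubleWell.tendsto_exchange_rate (hH : IsDoubleWell H) (hε₁ : 0 < ε₁)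
    (hint : GibbsIntegrable H ε₁) :
    Tendsto (fun ε => conductance H ε / tau ε * (wellMass H ε)⁻¹) (𝓝[>] 0) (𝓝 (rate H)) := by
  have h_lim := (hH.tendsto_conductance_div_tau hε₁ hint).mul
    ((hH.tendsto_wellMass hε₁ hint).inv₀ (by norm_num))
  rwa [one_div, inv_inv, div_mul_cancel₀ _ two_ne_zero] at h_lim

lemma IsDoubleWell.tendsto_balance_error (hH : IsDoubleWell H) (hε₁ : 0 < ε₁)
    (hint : GibbsIntegrable H ε₁) (C t : ℝ) :
    Tendsto (fun ε => conductance H ε / tau ε * (t * Real.sqrt (C * tau ε) * (wellMass H ε)⁻¹))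
      (𝓝[>] 0) (𝓝 0) := by
  simpa using (hH.tendsto_conductance_div_tau hε₁ hint).mul
    (((tendsto_tau.const_mul C).sqrt.const_mul t).mul
      ((hH.tendsto_wellMass hε₁ hint).inv₀ (by norm_num)))

lemma IsDoubleWell.tendsto_committor_error (hH : IsDoubleWell H) (hε₁ : 0 < ε₁)
    (hint : GibbsIntegrable H ε₁) (C : ℝ) :
    Tendsto (fun ε => Real.sqrt C * Real.sqrt (2 * conductance H ε +
      ∫ x, {x | 2 ≤ |x|}.indicator 1 x * gam H ε x)) (𝓝[>] 0) (𝓝 0) := by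
  simpa using (((hH.tendsto_conductance hε₁ hint).const_mul 2).add
    (hH.tendsto_outer_mass hε₁ hint)).sqrt.const_mul (Real.sqrt C)

end WellLimits

section MassDifference

variable {H : ℝ → ℝ} {ε C c : ℝ} {ρ0 : ℝ → ℝ} {ρ : ℝ → ℝ → ℝ}

lemma IsSolution.abs_integral_wellSign_le (h : IsSolution H ε ρ0 ρ) (hH : Continuous H)
    (hint : GibbsIntegrable H ε) {t : ℝ} (ht : 0 ≤ t) :
    |∫ x, ρ t x * wellSign x| ≤ ∫ x, ρ t x := by
  rw [← Real.norm_eq_abs]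
  refine norm_integral_le_of_norm_le (h.integrable hH hint ht) (ae_of_all _ fun x => ?_)
  rw [norm_mul, Real.norm_of_nonneg (h.nonneg t ht x)]
  exact mul_le_of_le_one_right (h.nonneg t ht x) (abs_wellSign_le x)

lemma IsSolution.integral_mul_const_add (h : IsSolution H ε ρ0 ρ) (hH : Continuous H)
    (hint : GibbsIntegrable H ε) {t : ℝ} (ht : 0 ≤ t) {g : ℝ → ℝ}
    (hg : MemLp (fun x => wt H ε x * g x) 2) (a b : ℝ) :
    ∫ x, ρ t x * (a + b * g x) = a * (∫ x, ρ t x) + b * ∫ x, ρ t x * g x := by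
  rw [← integral_const_mul, ← integral_const_mul,
    ← integral_add ((h.integrable hH hint ht).const_mul a)
      ((h.integrable_mul hH hint ht hg).const_mul b)]
  congr 1
  ext x
  ring

lemma IsSolution.abs_wellSign_balance_le (h : IsSolution H ε ρ0 ρ) (hH : IsDoubleWell H)
    (hε : 0 < ε) (hint : GibbsIntegrable H ε) (hwp : WellPrepared H ε C c ρ0) {t : ℝ}
    (ht : 0 ≤ t) :
    |(∫ x, ρ t x * wellSign x) - (∫ x, ρ 0 x * wellSign x) +
      conductance H ε / tau ε * (wellMass H ε)⁻¹ * ∫ s in (0 : ℝ)..t, ∫ x, ρ s x * wellSign x| ≤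
      conductance H ε / tau ε * (t * Real.sqrt (C * tau ε) * (wellMass H ε)⁻¹) +
        2 * (Real.sqrt C * Real.sqrt (2 * conductance H ε +
          ∫ x, {x | 2 ≤ |x|}.indicator 1 x * gam H ε x)) := by
  have h_balance := h.abs_committor_balance_le hH hε hint hwp ht
  have h_final := h.abs_integral_committor_sub_le hH hε hint hwp ht
  have h_initial := h.abs_integral_committor_sub_le hH hε hint hwp le_rfl
  rw [abs_le] at h_balance h_final h_initial ⊢
  constructor <;> linarith

lemma IsSolution.abs_integral_wellSign_sub_exp_le (h : IsSolution H ε ρ0 ρ) (hH : IsDoubleWell H)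
    (hε : 0 < ε) (hint : GibbsIntegrable H ε) (hwp : WellPrepared H ε C c ρ0) {k d₀ t : ℝ}
    (hk : 0 < k) (ht : 0 ≤ t) :
    |(∫ x, ρ t x * wellSign x) - d₀ * Real.exp (-k * t)| ≤
      (conductance H ε / tau ε * (t * Real.sqrt (C * tau ε) * (wellMass H ε)⁻¹) +
        2 * (Real.sqrt C * Real.sqrt (2 * conductance H ε +
          ∫ x, {x | 2 ≤ |x|}.indicator 1 x * gam H ε x)) +
        |(∫ x, ρ 0 x * wellSign x) - d₀| +
        |conductance H ε / tau ε * (wellMass H ε)⁻¹ - k| * t) * Real.exp (k * t) := by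
  have h_sign := memLp_wt_mul_wellSign hH.continuous hint
  set D : ℝ → ℝ := fun s => ⟪state H ε ρ s, toL2 volume fun x => wt H ε x * wellSign x⟫
  have hD_cont : Continuous D := by
    have h_cont := h.continuous_state hH.continuous hint
    fun_prop
  have hD_eq : ∀ s, 0 ≤ s → D s = ∫ x, ρ s x * wellSign x := fun s hs =>
    h.inner_state hH.continuous hint hs h_sign
  have hD_le : ∀ s ∈ Icc 0 t, |D s| ≤ 1 := fun s hs => by
    rw [hD_eq s hs.1, ← hwp.2.1, ← h.integral_eq_initial hH.smooth hε hint hs.1]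
    exact h.abs_integral_wellSign_le hH.continuous hint hs.1
  rw [← hD_eq t ht, ← hD_eq 0 le_rfl]
  refine abs_sub_exp_le_of_integral hk hD_cont hD_le (fun s hs => ?_) (right_mem_Icc.2 ht)
  have hD_integral : ∫ r in (0 : ℝ)..s, D r = ∫ r in (0 : ℝ)..s, ∫ x, ρ r x * wellSign x := by
    refine intervalIntegral.integral_congr fun r hr => ?_
    rw [uIcc_of_le hs.1] at hr
    exact hD_eq r hr.1
  rw [hD_integral, hD_eq s hs.1, hD_eq 0 le_rfl]
  refine (h.abs_wellSign_balance_le hH hε hint hwp hs.1).trans ?_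
  have hκτ := (div_pos (conductance_pos hH.continuous hint) (tau_pos hε)).le
  have hm := (inv_pos.2 (wellMass_pos hH.continuous hint)).le
  have hst := hs.2
  gcongr

lemma WellPrepared.mul_integral_mul_gam_le (hwp : WellPrepared H ε C c ρ0) (hc : 0 ≤ c)
    (hint : GibbsIntegrable H ε) {g : ℝ → ℝ} (hg : ∀ x, 0 ≤ g x)
    (hgi : Integrable fun x => ρ0 x * g x) :
    c * ∫ x, g x * gam H ε x ≤ ∫ x, ρ0 x * g x := by
  rw [← integral_const_mul]
  refine integral_mono_of_nonneg
    (ae_of_all _ fun x => mul_nonneg hc (mul_nonneg (hg x) (gam_pos hint x).le)) hgi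
    (ae_of_all _ fun x => ?_)
  have h_lower := (le_div_iff₀ (gam_pos hint x)).1 (hwp.2.2.1 x)
  linarith [mul_le_mul_of_nonneg_right h_lower (hg x)]

end MassDifference

/-- A family, indexed by `ε ∈ (0, ε₀)`, of solutions whose well-prepared initial data converge
weakly-* to `μ0` as `ε → 0`. -/
structure IsFamily (H : ℝ → ℝ) (ε₀ C c : ℝ) (ρ0 : ℝ → ℝ → ℝ) (ρ : ℝ → ℝ → ℝ → ℝ)
    (μ0 : Measure ℝ) : Prop where
  doubleWell : IsDoubleWell H
  pos : 0 < ε₀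
  gibbsIntegrable : ∀ ε ∈ Ioo 0 ε₀, GibbsIntegrable H ε
  isSolution : ∀ ε ∈ Ioo 0 ε₀, IsSolution H ε (ρ0 ε) (ρ ε)
  const_pos : 0 < c
  wellPrepared : ∀ ε ∈ Ioo 0 ε₀, WellPrepared H ε C c (ρ0 ε)
  tendsto_initial : ∀ ψ : ℝ →ᵇ ℝ,
    Tendsto (fun ε => ∫ x, ρ0 ε x * ψ x) (𝓝[>] 0) (𝓝 (∫ x, ψ x ∂μ0))

/-- The solution of the limit equation `u̇ = -k (u - 1)` that starts at `2 μ0 ((0, ∞))`. -/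
def limitCurve (k : ℝ) (μ0 : Measure ℝ) (t : ℝ) : ℝ :=
  1 + (2 * μ0.real (Ioi 0) - 1) * Real.exp (-k * t)

namespace IsFamily

variable {H : ℝ → ℝ} {ε₀ C c : ℝ} {ρ0 : ℝ → ℝ → ℝ} {ρ : ℝ → ℝ → ℝ → ℝ} {μ0 : Measure ℝ}

lemma eventually_mem (F : IsFamily H ε₀ C c ρ0 ρ μ0) : ∀ᶠ ε in 𝓝[>] (0 : ℝ), ε ∈ Ioo 0 ε₀ :=
  Ioo_mem_nhdsGT F.pos

lemma exists_gibbsIntegrable (F : IsFamily H ε₀ C c ρ0 ρ μ0) : ∃ ε > 0, GibbsIntegrable H ε :=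
  ⟨ε₀ / 2, half_pos F.pos, F.gibbsIntegrable _ ⟨half_pos F.pos, half_lt_self F.pos⟩⟩

lemma integral_eq_one (F : IsFamily H ε₀ C c ρ0 ρ μ0) {ε : ℝ} (hε : ε ∈ Ioo 0 ε₀) {t : ℝ}
    (ht : 0 ≤ t) : ∫ x, ρ ε t x = 1 :=
  ((F.isSolution ε hε).integral_eq_initial F.doubleWell.smooth hε.1 (F.gibbsIntegrable ε hε)
    ht).trans (F.wellPrepared ε hε).2.1

lemma integral_initial (F : IsFamily H ε₀ C c ρ0 ρ μ0) {ε : ℝ} (hε : ε ∈ Ioo 0 ε₀) (g : ℝ → ℝ) :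
    ∫ x, ρ ε 0 x * g x = ∫ x, ρ0 ε x * g x :=
  integral_congr_ae ((F.isSolution ε hε).initial.mul .rfl)

lemma integrable_mul_of_bounded (F : IsFamily H ε₀ C c ρ0 ρ μ0) {ε : ℝ} (hε : ε ∈ Ioo 0 ε₀)
    {t : ℝ} (ht : 0 ≤ t) {g : ℝ → ℝ} {M : ℝ} (hg : Measurable g) (hgM : ∀ x, |g x| ≤ M) :
    Integrable fun x => ρ ε t x * g x :=
  (F.isSolution ε hε).integrable_mul F.doubleWell.continuous (F.gibbsIntegrable ε hε) ht
    (memLp_wt_mul_of_bounded F.doubleWell.continuous (F.gibbsIntegrable ε hε)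
      hg.aestronglyMeasurable hgM)

lemma tendsto_concentration_bound (F : IsFamily H ε₀ C c ρ0 ρ μ0) {g : ℝ → ℝ} {M : ℝ}
    (hg : Measurable g) (hgM : ∀ x, |g x| ≤ M) (hgc : ContinuousAt g 1)
    (hgc' : ContinuousAt g (-1)) (h_right : g 1 = 0) (h_left : g (-1) = 0) :
    Tendsto (fun ε => Real.sqrt C * Real.sqrt (∫ x, gam H ε x * g x ^ 2)) (𝓝[>] 0) (𝓝 0) := by
  obtain ⟨ε₁, hε₁, hint⟩ := F.exists_gibbsIntegrable
  have h_sq := F.doubleWell.tendsto_integral_mul_gam hε₁ hint (g := fun x => g x ^ 2)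
    (M := M ^ 2) (hg.pow_const 2)
    (fun x => by rw [abs_pow]; exact pow_le_pow_left₀ (abs_nonneg _) (hgM x) 2)
    (hgc.pow 2) (hgc'.pow 2)
  have h_lim := h_sq.sqrt.const_mul (Real.sqrt C)
  simp only [h_right, h_left, mul_comm (_ ^ 2)] at h_lim
  simpa using h_lim

lemma tendsto_integral_mul_of_eq_zero (F : IsFamily H ε₀ C c ρ0 ρ μ0) {t : ℝ} (ht : 0 ≤ t)
    {g : ℝ → ℝ} {M : ℝ} (hg : Measurable g) (hgM : ∀ x, |g x| ≤ M) (hgc : ContinuousAt g 1)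
    (hgc' : ContinuousAt g (-1)) (h_right : g 1 = 0) (h_left : g (-1) = 0) :
    Tendsto (fun ε => ∫ x, ρ ε t x * g x) (𝓝[>] 0) (𝓝 0) := by
  refine squeeze_zero_norm' ?_ (F.tendsto_concentration_bound hg hgM hgc hgc' h_right h_left)
  filter_upwards [F.eventually_mem] with ε hε
  exact (F.isSolution ε hε).abs_integral_mul_le F.doubleWell.smooth hε.1 (F.gibbsIntegrable ε hε)
    (F.wellPrepared ε hε) ht (memLp_wt_mul_of_bounded F.doubleWell.continuous
      (F.gibbsIntegrable ε hε) hg.aestronglyMeasurable hgM)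

lemma ae_abs_eq_one [IsFiniteMeasure μ0] (F : IsFamily H ε₀ C c ρ0 ρ μ0) :
    ∀ᵐ x ∂μ0, |x| = 1 := by
  set ψ : ℝ →ᵇ ℝ := BoundedContinuousFunction.ofNormedAddCommGroup
    (fun x : ℝ => min 1 |(|x| - 1)|) (by fun_prop) 1 (fun x => by
      rw [Real.norm_of_nonneg (by positivity)]; exact min_le_left _ _)
  have hψ : ∀ x, ψ x = min 1 |(|x| - 1)| := fun x => rfl
  have h_zero := F.tendsto_integral_mul_of_eq_zero le_rfl (g := ψ) (M := ‖ψ‖)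
    ψ.continuous.measurable (fun x => ψ.norm_coe_le_norm x) ψ.continuous.continuousAt
    ψ.continuous.continuousAt (by simp [hψ]) (by simp [hψ])
  have h_integral : ∫ x, ψ x ∂μ0 = 0 := by
    refine tendsto_nhds_unique ((F.tendsto_initial ψ).congr' ?_) h_zero
    filter_upwards [F.eventually_mem] with ε hε using (F.integral_initial hε _).symm
  rw [integral_eq_zero_iff_of_nonneg (fun x => by rw [hψ, Pi.zero_apply]; positivity)
    (ψ.integrable μ0)] at h_integral
  filter_upwards [h_integral] with x hx
  rw [hψ, Pi.zero_apply] at hx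
  rcases min_choice 1 |(|x| - 1)| with h_min | h_min
  · exact absurd (h_min.symm.trans hx) one_ne_zero
  · rw [h_min, abs_eq_zero] at hx
    exact sub_eq_zero.1 hx

lemma integral_eq_of_forall_abs_eq_one [IsProbabilityMeasure μ0] (F : IsFamily H ε₀ C c ρ0 ρ μ0)
    {g : ℝ → ℝ} (h_right : g 1 = 1) (h_left : g (-1) = -1) :
    ∫ x, g x ∂μ0 = 2 * μ0.real (Ioi 0) - 1 := by
  have h_ae : g =ᵐ[μ0] fun x => 2 * (Ioi (0 : ℝ)).indicator 1 x - 1 := by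
    filter_upwards [F.ae_abs_eq_one] with x hx
    rcases eq_or_eq_neg_of_abs_eq hx with rfl | rfl
    · norm_num [h_right, indicator]
    · norm_num [h_left, indicator]
  have h_ind : Integrable ((Ioi (0 : ℝ)).indicator (1 : ℝ → ℝ)) μ0 :=
    (integrable_const 1).indicator measurableSet_Ioi
  rw [integral_congr_ae h_ae, integral_sub (h_ind.const_mul 2) (integrable_const 1),
    integral_const_mul, integral_indicator_one measurableSet_Ioi]
  simp

lemma tendsto_initial_wellSign [IsProbabilityMeasure μ0] (F : IsFamily H ε₀ C c ρ0 ρ μ0) :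
    Tendsto (fun ε => ∫ x, ρ ε 0 x * wellSign x) (𝓝[>] 0) (𝓝 (2 * μ0.real (Ioi 0) - 1)) := by
  set ψ : ℝ →ᵇ ℝ := BoundedContinuousFunction.ofNormedAddCommGroup
    (fun x : ℝ => max (-1) (min 1 x)) (by fun_prop) 1 (fun x => by
      rw [Real.norm_eq_abs, abs_le]
      exact ⟨le_max_left _ _, max_le (by norm_num) (min_le_left _ _)⟩)
  have hψ : ∀ x, ψ x = max (-1) (min 1 x) := fun x => rfl
  have hψ_right : ψ 1 = 1 := by rw [hψ]; norm_num
  have hψ_left : ψ (-1) = -1 := by rw [hψ]; norm_num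
  have hψ_le : ∀ x, |ψ x| ≤ ‖ψ‖ := fun x => ψ.norm_coe_le_norm x
  have h_diff := F.tendsto_integral_mul_of_eq_zero le_rfl (g := fun x => wellSign x - ψ x)
    (M := 1 + ‖ψ‖) (measurable_wellSign.sub ψ.continuous.measurable)
    (fun x => (abs_sub _ _).trans (add_le_add (abs_wellSign_le x) (hψ_le x)))
    (continuousAt_wellSign_one.sub ψ.continuous.continuousAt)
    (continuousAt_wellSign_neg_one.sub ψ.continuous.continuousAt)
    (by rw [hψ_right, wellSign_one, sub_self]) (by rw [hψ_left, wellSign_neg_one, sub_self])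
  have h_sum := h_diff.add (F.tendsto_initial ψ)
  rw [zero_add, F.integral_eq_of_forall_abs_eq_one hψ_right hψ_left] at h_sum
  refine h_sum.congr' ?_
  filter_upwards [F.eventually_mem] with ε hε
  simp only [← F.integral_initial hε, mul_sub]
  rw [integral_sub (F.integrable_mul_of_bounded hε le_rfl measurable_wellSign abs_wellSign_le)
    (F.integrable_mul_of_bounded hε le_rfl ψ.continuous.measurable hψ_le), sub_add_cancel]

lemma tendsto_wellSign [IsProbabilityMeasure μ0] (F : IsFamily H ε₀ C c ρ0 ρ μ0) {t : ℝ}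
    (ht : 0 ≤ t) :
    Tendsto (fun ε => ∫ x, ρ ε t x * wellSign x) (𝓝[>] 0) (𝓝 (limitCurve (rate H) μ0 t - 1)) := by
  have hH := F.doubleWell
  obtain ⟨ε₁, hε₁, hint⟩ := F.exists_gibbsIntegrable
  have h_lim := (((hH.tendsto_balance_error hε₁ hint C t).add
    ((hH.tendsto_committor_error hε₁ hint C).const_mul 2)).add
    (F.tendsto_initial_wellSign.sub_const (2 * μ0.real (Ioi 0) - 1)).abs).add
    (((hH.tendsto_exchange_rate hε₁ hint).sub_const (rate H)).abs.mul_const t)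
    |>.mul_const (Real.exp (rate H * t))
  simp only [sub_self, abs_zero, mul_zero, add_zero, zero_mul] at h_lim
  rw [tendsto_iff_norm_sub_tendsto_zero, limitCurve, add_sub_cancel_left]
  refine squeeze_zero' (Eventually.of_forall fun _ => norm_nonneg _) ?_ h_lim
  filter_upwards [F.eventually_mem] with ε hε
  exact (F.isSolution ε hε).abs_integral_wellSign_sub_exp_le hH hε.1 (F.gibbsIntegrable ε hε)
    (F.wellPrepared ε hε) hH.rate_pos ht

lemma tendsto_integral_mul [IsProbabilityMeasure μ0] (F : IsFamily H ε₀ C c ρ0 ρ μ0) {t : ℝ}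
    (ht : 0 ≤ t) {g : ℝ → ℝ} {M : ℝ} (hg : Measurable g) (hgM : ∀ x, |g x| ≤ M)
    (hgc : ContinuousAt g 1) (hgc' : ContinuousAt g (-1)) :
    Tendsto (fun ε => ∫ x, ρ ε t x * g x) (𝓝[>] 0)
      (𝓝 ((1 / 2) * (limitCurve (rate H) μ0 t * g 1 +
        (2 - limitCurve (rate H) μ0 t) * g (-1)))) := by
  set a := (g 1 + g (-1)) / 2 with ha
  set b := (g 1 - g (-1)) / 2 with hb
  have h_affine : ∀ x, |a + b * wellSign x| ≤ |a| + |b| := fun x => by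
    refine (abs_add_le _ _).trans (add_le_add_right ?_ _)
    rw [abs_mul]
    exact mul_le_of_le_one_right (abs_nonneg _) (abs_wellSign_le x)
  have h_meas : Measurable fun x => a + b * wellSign x :=
    measurable_const.add (measurable_wellSign.const_mul b)
  have h_diff := F.tendsto_integral_mul_of_eq_zero ht (g := fun x => g x - (a + b * wellSign x))
    (M := M + (|a| + |b|)) (hg.sub h_meas)
    (fun x => (abs_sub _ _).trans (add_le_add (hgM x) (h_affine x)))
    (hgc.sub (continuousAt_const.add (continuousAt_const.mul continuousAt_wellSign_one)))
    (hgc'.sub (continuousAt_const.add (continuousAt_const.mul continuousAt_wellSign_neg_one)))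
    (by rw [wellSign_one, ha, hb]; ring) (by rw [wellSign_neg_one, ha, hb]; ring)
  convert (h_diff.add (((F.tendsto_wellSign ht).const_mul b).const_add a)).congr' ?_ using 2
  · rw [ha, hb]
    ring
  filter_upwards [F.eventually_mem] with ε hε
  simp only [mul_sub]
  rw [integral_sub (F.integrable_mul_of_bounded hε ht hg hgM)
      (F.integrable_mul_of_bounded hε ht h_meas h_affine),
    (F.isSolution ε hε).integral_mul_const_add F.doubleWell.continuous (F.gibbsIntegrable ε hε) ht
      (memLp_wt_mul_wellSign F.doubleWell.continuous (F.gibbsIntegrable ε hε)),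
    F.integral_eq_one hε ht]
  ring

lemma le_one_add_mul_initial [IsProbabilityMeasure μ0] (F : IsFamily H ε₀ C c ρ0 ρ μ0) {s : ℝ}
    (hs : |s| ≤ 1) : c ≤ 1 + s * (2 * μ0.real (Ioi 0) - 1) := by
  have hH := F.doubleWell
  obtain ⟨ε₁, hε₁, hint₁⟩ := F.exists_gibbsIntegrable
  have h_abs : ∀ x, |s * wellSign x| ≤ 1 := fun x => by
    rw [abs_mul]
    exact mul_le_one₀ hs (abs_nonneg _) (abs_wellSign_le x)
  have h_nonneg : ∀ x, 0 ≤ 1 + s * wellSign x := fun x => by linarith [(abs_le.1 (h_abs x)).1]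
  have h_le : ∀ x, |1 + s * wellSign x| ≤ 2 := fun x => by
    rw [abs_of_nonneg (h_nonneg x)]
    linarith [(abs_le.1 (h_abs x)).2]
  have h_meas : Measurable fun x => 1 + s * wellSign x :=
    measurable_const.add (measurable_wellSign.const_mul s)
  have h_gam := (hH.tendsto_integral_mul_gam hε₁ hint₁ h_meas h_le
    (continuousAt_const.add (continuousAt_const.mul continuousAt_wellSign_one))
    (continuousAt_const.add (continuousAt_const.mul continuousAt_wellSign_neg_one))).const_mul c
  rw [wellSign_one, wellSign_neg_one] at h_gam
  suffices h_compare : c * ((1 + s * 1 + (1 + s * -1)) / 2) ≤ 1 + s * (2 * μ0.real (Ioi 0) - 1) by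
    linarith
  refine le_of_tendsto_of_tendsto h_gam ((F.tendsto_initial_wellSign.const_mul s).const_add 1) ?_
  filter_upwards [F.eventually_mem] with ε hε
  have hint := F.gibbsIntegrable ε hε
  have h_mass := (F.isSolution ε hε).integral_mul_const_add hH.continuous hint le_rfl
    (memLp_wt_mul_wellSign hH.continuous hint) 1 s
  rw [F.integral_eq_one hε le_rfl, mul_one] at h_mass
  rw [← h_mass, F.integral_initial hε]
  refine (F.wellPrepared ε hε).mul_integral_mul_gam_le F.const_pos.le hint h_nonneg ?_
  exact (F.integrable_mul_of_bounded hε le_rfl h_meas h_le).congr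
    ((F.isSolution ε hε).initial.mul .rfl)

lemma mass_bounds [IsProbabilityMeasure μ0] (F : IsFamily H ε₀ C c ρ0 ρ μ0) :
    c ≤ 2 * μ0.real (Ioi 0) ∧ 2 * μ0.real (Ioi 0) ≤ 2 - c := by
  have h_right := F.le_one_add_mul_initial (s := 1) (by simp)
  have h_left := F.le_one_add_mul_initial (s := -1) (by simp)
  constructor <;> linarith

end IsFamily

section TimeTest

variable {T : ℝ} {ψ ψ' : ℝ × ℝ → ℝ}

/-- A bounded test function `ψ` on the strip with time derivative `ψ'`, vanishing near the times
`0` and `T`. No regularity in space is required, so that indicator functions of the wells are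
admissible. -/
structure IsTimeTest (T : ℝ) (ψ ψ' : ℝ × ℝ → ℝ) : Prop where
  measurable : Measurable ψ
  hasDerivAt : ∀ t x, HasDerivAt (fun s => ψ (s, x)) (ψ' (t, x)) t
  bounded : ∃ M, ∀ p, |ψ p| ≤ M
  bounded_deriv : ∃ M, ∀ p, |ψ' p| ≤ M
  support : ∃ δ > 0, ∀ t x, t ∉ Icc δ (T - δ) → ψ (t, x) = 0

lemma exists_subset_Icc_of_isCompact {K : Set ℝ} (hK : IsCompact K) (hKT : K ⊆ Ioo 0 T) :
    ∃ δ > 0, K ⊆ Icc δ (T - δ) := by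
  obtain ⟨δ, hδ, h⟩ := hK.exists_cthickening_subset_open isOpen_Ioo hKT
  refine ⟨δ, hδ, fun t ht => ?_⟩
  have h_mem : ∀ s, |s - t| ≤ δ → s ∈ Ioo 0 T := fun s hs =>
    h (Metric.mem_cthickening_of_dist_le s t δ K ht (by rwa [Real.dist_eq]))
  have h_left := (h_mem (t - δ) (by simp [abs_of_pos hδ])).1
  have h_right := (h_mem (t + δ) (by simp [abs_of_pos hδ])).2
  constructor <;> linarith

lemma IsTimeTest.of_contDiff (hψ : ContDiff ℝ ∞ ψ) (hs : HasCompactSupport ψ)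
    (hT : tsupport ψ ⊆ Ioo 0 T ×ˢ univ) :
    IsTimeTest T ψ fun p => deriv (fun t => ψ (t, p.2)) p.1 := by
  have hd : ∀ t x, HasDerivAt (fun s => ψ (s, x)) (fderiv ℝ ψ (t, x) (1, 0)) t := fun t x =>
    (hψ.differentiable (by simp) (t, x)).hasFDerivAt.comp_hasDerivAt t
      ((hasDerivAt_id t).prodMk (hasDerivAt_const t x))
  have hc : Continuous fun p => fderiv ℝ ψ p (1, 0) :=
    (hψ.continuous_fderiv (by simp)).clm_apply continuous_const
  obtain ⟨δ, hδ, h⟩ := exists_subset_Icc_of_isCompact (T := T) (hs.image continuous_fst)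
    (by rintro _ ⟨p, hp, rfl⟩; exact (hT hp).1)
  obtain ⟨M, hM⟩ := hc.bounded_above_of_compact_support (hs.fderiv_apply ℝ (1, 0))
  refine ⟨hψ.continuous.measurable, fun t x => (hd t x).differentiableAt.hasDerivAt,
    hψ.continuous.bounded_above_of_compact_support hs, ⟨M, fun p => ?_⟩, δ, hδ, fun t x ht => ?_⟩
  · rw [(hd p.1 p.2).deriv]
    exact hM p
  · by_contra h_ne
    exact ht (h ⟨(t, x), subset_tsupport _ h_ne, rfl⟩)

lemma IsTimeTest.mul {a : ℝ → ℝ} (ha : ContDiff ℝ ∞ a) (hs : HasCompactSupport a)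
    (hT : tsupport a ⊆ Ioo 0 T) {g : ℝ → ℝ} {M : ℝ} (hg : Measurable g) (hgM : ∀ x, |g x| ≤ M) :
    IsTimeTest T (fun p => a p.1 * g p.2) fun p => deriv a p.1 * g p.2 := by
  obtain ⟨δ, hδ, h⟩ := exists_subset_Icc_of_isCompact hs hT
  have h_bdd : ∀ b : ℝ → ℝ, Continuous b → HasCompactSupport b →
      ∃ M, ∀ p : ℝ × ℝ, |b p.1 * g p.2| ≤ M := fun b hb hbs => by
    obtain ⟨B, hB⟩ := hb.bounded_above_of_compact_support hbs
    refine ⟨B * M, fun p => ?_⟩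
    rw [abs_mul]
    exact mul_le_mul (hB _) (hgM _) (abs_nonneg _) ((norm_nonneg _).trans (hB 0))
  refine ⟨(ha.continuous.measurable.comp measurable_fst).mul (hg.comp measurable_snd),
    fun t x => ((ha.differentiable (by simp) t).hasDerivAt).mul_const (g x),
    h_bdd a ha.continuous hs, h_bdd _ (ha.continuous_deriv (by simp)) hs.deriv, δ, hδ,
    fun t x ht => ?_⟩
  rw [image_eq_zero_of_notMem_tsupport fun hta => ht (h hta), zero_mul]

lemma IsTimeTest.measurable_shift (hψ : IsTimeTest T ψ ψ') (r : ℝ) :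
    Measurable fun p : ℝ × ℝ => ψ (p.1 - r, p.2) :=
  hψ.measurable.comp ((measurable_fst.sub_const r).prodMk measurable_snd)

lemma IsTimeTest.abs_quotient_le (hψ : IsTimeTest T ψ ψ') {M r : ℝ} (hM : ∀ p, |ψ' p| ≤ M)
    (hr : 0 < r) (p : ℝ × ℝ) : |r⁻¹ * (ψ (p.1 - r, p.2) - ψ p)| ≤ M := by
  have h_lip := convex_univ.norm_image_sub_le_of_norm_hasDerivWithin_le
    (fun t _ => (hψ.hasDerivAt t p.2).hasDerivWithinAt) (fun t _ => hM (t, p.2))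
    (mem_univ p.1) (mem_univ (p.1 - r))
  rw [sub_sub_cancel_left, norm_neg, Real.norm_of_nonneg hr.le] at h_lip
  rw [abs_mul, abs_inv, abs_of_pos hr, inv_mul_le_iff₀ hr, mul_comm]
  exact h_lip

lemma IsTimeTest.tendsto_quotient (hψ : IsTimeTest T ψ ψ') (p : ℝ × ℝ) :
    Tendsto (fun r => r⁻¹ * (ψ (p.1 - r, p.2) - ψ p)) (𝓝[>] 0) (𝓝 (-ψ' p)) := by
  have h_reverse : HasDerivAt (fun r => ψ (p.1 - r, p.2)) (-ψ' p) 0 := by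
    have h_at : HasDerivAt (fun s => ψ (s, p.2)) (ψ' p) (p.1 - 0) := by
      rw [sub_zero]
      exact hψ.hasDerivAt p.1 p.2
    exact (h_at.scomp 0 ((hasDerivAt_id (0 : ℝ)).const_sub p.1)).congr_deriv (by simp)
  simpa using h_reverse.tendsto_slope_zero_right

lemma IsTimeTest.tendsto_integral_quotient (hψ : IsTimeTest T ψ ψ') {μ : Measure (ℝ × ℝ)}
    {f : ℝ × ℝ → ℝ} (hf : Integrable f μ) :
    Tendsto (fun r => ∫ p, f p * (r⁻¹ * (ψ (p.1 - r, p.2) - ψ p)) ∂μ) (𝓝[>] 0)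
      (𝓝 (-∫ p, f p * ψ' p ∂μ)) := by
  obtain ⟨M, hM⟩ := hψ.bounded_deriv
  rw [← integral_neg]
  simp only [← mul_neg]
  refine tendsto_integral_filter_of_dominated_convergence (fun p => ‖f p‖ * M)
    (Eventually.of_forall fun r => hf.aestronglyMeasurable.mul
      (((hψ.measurable_shift r).sub hψ.measurable).const_mul _).aestronglyMeasurable) ?_
    (hf.norm.mul_const M) (ae_of_all _ fun p => (hψ.tendsto_quotient p).const_mul _)
  filter_upwards [self_mem_nhdsWithin] with r hr
  refine ae_of_all _ fun p => ?_
  rw [norm_mul]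
  exact mul_le_mul_of_nonneg_left (hψ.abs_quotient_le hM hr p) (norm_nonneg _)

end TimeTest

section WeightedStrip

lemma stripMeasure_eq_restrict (T : ℝ) :
    stripMeasure T = (volume : Measure (ℝ × ℝ)).restrict (Ioo 0 T ×ˢ univ) := by
  rw [stripMeasure, Measure.volume_eq_prod, ← Measure.prod_restrict, Measure.restrict_univ]

lemma integral_shift_mul {T r δ : ℝ} (hr : 0 ≤ r) (hrδ : r < δ) (f : ℝ → ℝ → ℝ) {ψ : ℝ × ℝ → ℝ}
    (hψ : ∀ t x, t ∉ Icc δ (T - δ) → ψ (t, x) = 0) :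
    ∫ p, f (p.1 + r) p.2 * ψ p ∂(stripMeasure T) =
      ∫ p, f p.1 p.2 * ψ (p.1 - r, p.2) ∂(stripMeasure T) := by
  have h_zero : ∀ s ∈ Ico 0 δ, ∀ p : ℝ × ℝ, p ∉ Ioo 0 T ×ˢ univ → ψ (p.1 - s, p.2) = 0 := by
    refine fun s hs p hp => hψ _ _ fun h_mem => hp ⟨⟨?_, ?_⟩, mem_univ _⟩ <;>
      linarith [h_mem.1, h_mem.2, hs.1, hs.2]
  rw [stripMeasure_eq_restrict, setIntegral_eq_integral_of_forall_compl_eq_zero,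
    setIntegral_eq_integral_of_forall_compl_eq_zero,
    ← integral_add_right_eq_self (fun p : ℝ × ℝ => f p.1 p.2 * ψ (p.1 - r, p.2)) (r, 0)]
  · simp
  · exact fun p hp => mul_eq_zero_of_right _ (h_zero r ⟨hr, hrδ⟩ p hp)
  · exact fun p hp => mul_eq_zero_of_right _
      (by simpa using h_zero 0 ⟨le_rfl, hr.trans_lt hrδ⟩ p hp)

variable {H : ℝ → ℝ} {ε : ℝ}

lemma memLp_wt_mul_strip (hH : Continuous H) (hint : GibbsIntegrable H ε) {T M : ℝ}
    {ψ : ℝ × ℝ → ℝ} (hψ : Measurable ψ) (hM : ∀ p, |ψ p| ≤ M) :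
    MemLp (fun p : ℝ × ℝ => wt H ε p.2 * ψ p) 2 (stripMeasure T) := by
  have h_const : MemLp (fun p : ℝ × ℝ => wt H ε p.2 * M) 2 (stripMeasure T) :=
    (memLp_wt_mul_of_bounded hH hint (f := fun _ => M) (M := |M|) aestronglyMeasurable_const
      (fun _ => le_rfl)).comp_snd _
  refine h_const.mono (((continuous_wt hH ε).measurable.comp measurable_snd).mul
    hψ).aestronglyMeasurable (ae_of_all _ fun p => ?_)
  rw [norm_mul, norm_mul]
  exact mul_le_mul_of_nonneg_left ((hM p).trans (le_abs_self M)) (norm_nonneg _)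

lemma memLp_strip_of_ae_eq {T : ℝ} {f : ℝ × ℝ → ℝ} {F : ℝ → L2Line}
    (hf : AEStronglyMeasurable f (stripMeasure T)) (hF : Continuous F)
    (h : ∀ t ∈ Ioo 0 T, F t =ᵐ[volume] fun x => f (t, x)) :
    MemLp f 2 (stripMeasure T) ∧
      ∫ p, f p ^ 2 ∂(stripMeasure T) = ∫ t in Ioo 0 T, ‖F t‖ ^ 2 := by
  have h_slice : ∀ t ∈ Ioo 0 T, MemLp (fun x => f (t, x)) 2 := fun t ht =>
    (memLp_congr_ae (h t ht)).1 (Lp.memLp (F t))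
  have h_norm : ∀ t ∈ Ioo 0 T, ∫ x, f (t, x) ^ 2 = ‖F t‖ ^ 2 := fun t ht => by
    rw [← real_inner_self_eq_norm_sq, inner_eq_integral (h t ht) (h t ht)]
    simp only [sq]
  have h_sq : Integrable (fun p => f p ^ 2) (stripMeasure T) := by
    refine (integrable_prod_iff (hf.pow 2)).2 ⟨?_, ?_⟩
    · filter_upwards [ae_restrict_mem measurableSet_Ioo] with t ht
      exact (h_slice t ht).integrable_sq
    · refine IntegrableOn.congr_fun (f := fun t => ‖F t‖ ^ 2)
        ((hF.norm.pow 2).integrableOn_Icc.mono_set Ioo_subset_Icc_self) (fun t ht => ?_)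
        measurableSet_Ioo
      simp only [← h_norm t ht, Pi.pow_apply, norm_pow, Real.norm_eq_abs, sq_abs]
  refine ⟨(memLp_two_iff_integrable_sq hf).2 h_sq, ?_⟩
  rw [stripMeasure, integral_prod _ h_sq]
  exact setIntegral_congr_fun measurableSet_Ioo h_norm

lemma exists_weak_limit_memLp {α : Type*} [MeasurableSpace α] {μ : Measure α} {f : ℕ → α → ℝ}
    {C : ℝ} (hf : ∀ n, MemLp (f n) 2 μ) (hC : ∀ n, ∫ x, f n x ^ 2 ∂μ ≤ C) :
    ∃ y, MemLp y 2 μ ∧ ∫ x, y x ^ 2 ∂μ ≤ C ∧ ∀ g, MemLp g 2 μ → ∀ l,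
      Tendsto (fun n => ∫ x, f n x * g x ∂μ) atTop (𝓝 l) → ∫ x, y x * g x ∂μ = l := by
  obtain ⟨y, hy, hy_lim⟩ := exists_weak_limit (x := fun n => toL2 μ (f n)) (R := Real.sqrt C)
    fun n => Real.le_sqrt_of_sq_le ((norm_toL2_sq (hf n)).trans_le (hC n))
  refine ⟨y, Lp.memLp y, ?_, fun g hg l hl => ?_⟩
  · have hC0 : 0 ≤ C := (integral_nonneg fun x => sq_nonneg (f 0 x)).trans (hC 0)
    calc ∫ x, y x ^ 2 ∂μ = ‖y‖ ^ 2 := by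
          rw [← real_inner_self_eq_norm_sq, inner_eq_integral (ae_eq_refl _) (ae_eq_refl _)]
          simp only [sq]
      _ ≤ Real.sqrt C ^ 2 := pow_le_pow_left₀ (norm_nonneg _) hy 2
      _ = C := Real.sq_sqrt hC0
  · rw [← inner_eq_integral (ae_eq_refl y) (coeFn_toL2 hg)]
    refine hy_lim _ _ (hl.congr fun n => ?_)
    rw [inner_toL2 (hf n) hg]

end WeightedStrip

/-- `w` is the weak time derivative of `ρ` on the strip, with `∫∫ w² / γ_ε ≤ C`. -/
structure IsTimeDeriv (H : ℝ → ℝ) (ε C T : ℝ) (ρ w : ℝ → ℝ → ℝ) : Prop where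
  memL2Strip : MemL2Strip H ε T w
  integral_sq_le : ∫ p, (w p.1 p.2 / wt H ε p.2) ^ 2 ∂(stripMeasure T) ≤ C
  weak : ∀ ψ ψ', IsTimeTest T ψ ψ' → ∫ p, w p.1 p.2 * ψ p ∂(stripMeasure T) =
    -∫ p, ρ p.1 p.2 * ψ' p ∂(stripMeasure T)

lemma IsTimeDeriv.hasWeakTimeDeriv {H : ℝ → ℝ} {ε C T : ℝ} {ρ w : ℝ → ℝ → ℝ}
    (hw : IsTimeDeriv H ε C T ρ w) : HasWeakTimeDeriv T ρ w := fun ψ hψ hψs hψT => by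
  rw [hw.weak ψ _ (IsTimeTest.of_contDiff hψ hψs hψT), neg_neg]

/-- The difference quotient in time, with step `r`, of `ρ / √γ_ε`. -/
def timeQuotient (H : ℝ → ℝ) (ε : ℝ) (ρ : ℝ → ℝ → ℝ) (r : ℝ) (p : ℝ × ℝ) : ℝ :=
  r⁻¹ * ((ρ (p.1 + r) p.2 - ρ p.1 p.2) / wt H ε p.2)

namespace IsSolution

variable {H : ℝ → ℝ} {ε C c : ℝ} {ρ0 : ℝ → ℝ} {ρ : ℝ → ℝ → ℝ}

lemma aestronglyMeasurable_shift (h : IsSolution H ε ρ0 ρ) {r : ℝ} (hr : 0 ≤ r) (T : ℝ) :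
    AEStronglyMeasurable (fun p : ℝ × ℝ => ρ (p.1 + r) p.2) (stripMeasure T) := by
  have h_shift : Measure.QuasiMeasurePreserving (fun t : ℝ => t + r) (volume.restrict (Ioo 0 T))
      (volume.restrict (Ioi 0)) := by
    refine ((measurePreserving_add_right volume r).restrict_preimage
      measurableSet_Ioi).quasiMeasurePreserving.mono_left ?_
    refine Measure.absolutelyContinuous_of_le (Measure.restrict_mono_set _ fun t ht => ?_)
    exact add_pos_of_pos_of_nonneg ht.1 hr
  exact h.meas.comp_quasiMeasurePreserving (QuasiMeasurePreserving.prodMap h_shift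
    (Measure.QuasiMeasurePreserving.id (volume : Measure ℝ)))

lemma memLp_shift (h : IsSolution H ε ρ0 ρ) (hH : Continuous H) (hint : GibbsIntegrable H ε)
    {r : ℝ} (hr : 0 ≤ r) (T : ℝ) :
    MemLp (fun p : ℝ × ℝ => ρ (p.1 + r) p.2 / wt H ε p.2) 2 (stripMeasure T) :=
  (memLp_strip_of_ae_eq (F := fun t => state H ε ρ (t + r))
    ((h.aestronglyMeasurable_shift hr T).aemeasurable.div
      ((continuous_wt hH ε).measurable.comp measurable_snd).aemeasurable).aestronglyMeasurable
    ((h.continuous_state hH hint).comp (by fun_prop))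
    fun _ ht => h.coeFn_state hH hint (add_nonneg ht.1.le hr)).1

lemma memLp_strip (h : IsSolution H ε ρ0 ρ) (hH : Continuous H) (hint : GibbsIntegrable H ε)
    (T : ℝ) : MemLp (fun p : ℝ × ℝ => ρ p.1 p.2 / wt H ε p.2) 2 (stripMeasure T) := by
  simpa only [add_zero] using h.memLp_shift hH hint le_rfl T

lemma integrable_strip_mul (h : IsSolution H ε ρ0 ρ) (hH : Continuous H)
    (hint : GibbsIntegrable H ε) {T M : ℝ} {ψ : ℝ × ℝ → ℝ} (hψ : Measurable ψ)
    (hM : ∀ p, |ψ p| ≤ M) :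
    Integrable (fun p : ℝ × ℝ => ρ p.1 p.2 * ψ p) (stripMeasure T) := by
  refine ((h.memLp_strip hH hint T).integrable_mul
    (memLp_wt_mul_strip hH hint hψ hM)).congr (ae_of_all _ fun p => ?_)
  exact div_mul_mul_cancel_weight (wt_ne_zero hint) _ _ _

lemma memLp_increment (h : IsSolution H ε ρ0 ρ) (hH : Continuous H) (hint : GibbsIntegrable H ε)
    {r : ℝ} (hr : 0 ≤ r) (T : ℝ) :
    MemLp (fun p : ℝ × ℝ => (ρ (p.1 + r) p.2 - ρ p.1 p.2) / wt H ε p.2) 2 (stripMeasure T) := by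
  simp only [sub_div]
  exact (h.memLp_shift hH hint hr T).sub (h.memLp_strip hH hint T)

lemma integral_sq_increment_le (h : IsSolution H ε ρ0 ρ) (hH : ContDiff ℝ ∞ H) (hε : 0 < ε)
    (hint : GibbsIntegrable H ε) (hwp : WellPrepared H ε C c ρ0) {r T : ℝ} (hr : 0 ≤ r)
    (hT : 0 ≤ T) :
    ∫ p, ((ρ (p.1 + r) p.2 - ρ p.1 p.2) / wt H ε p.2) ^ 2 ∂(stripMeasure T) ≤ r ^ 2 * C := by
  have hHc := hH.continuous
  have hc := h.continuous_state hHc hint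
  obtain ⟨Q, hQ, hF⟩ := h.exists_isFormFlow hH hint
  obtain ⟨b, hb, hbC⟩ := h.exists_initial_deriv hHc hε hint hwp
  have hτ := tau_pos hε
  have h_state : ∀ t ∈ Ioo 0 T, (state H ε ρ (t + r) - state H ε ρ t : L2Line) =ᵐ[volume]
      fun x => (ρ (t + r) x - ρ t x) / wt H ε x := fun t ht => by
    filter_upwards [h.coeFn_state hHc hint (add_nonneg ht.1.le hr),
      h.coeFn_state hHc hint ht.1.le, Lp.coeFn_sub (state H ε ρ (t + r)) (state H ε ρ t)]
      with x h_later h_now h_sub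
    rw [h_sub, Pi.sub_apply, h_later, h_now, sub_div]
  rw [(memLp_strip_of_ae_eq (h.memLp_increment hHc hint hr T).aestronglyMeasurable
    ((hc.comp (by fun_prop)).sub hc) h_state).2, ← integral_Ioc_eq_integral_Ioo,
    ← intervalIntegral.integral_of_le hT]
  calc ∫ t in (0 : ℝ)..T, ‖state H ε ρ (t + r) - state H ε ρ t‖ ^ 2
      ≤ r ^ 2 * ‖b‖ ^ 2 / (2 * tau ε) := hF.integral_norm_sq_increment_le hτ hQ hb hr hT
    _ ≤ r ^ 2 * (C * tau ε) / (2 * tau ε) := by gcongr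
    _ = r ^ 2 * C / 2 := by field_simp
    _ ≤ r ^ 2 * C := by
        have hC : 0 ≤ C := nonneg_of_mul_nonneg_left ((sq_nonneg _).trans hbC) hτ
        linarith [mul_nonneg (sq_nonneg r) hC]

lemma integral_sq_timeQuotient_le (h : IsSolution H ε ρ0 ρ) (hH : ContDiff ℝ ∞ H) (hε : 0 < ε)
    (hint : GibbsIntegrable H ε) (hwp : WellPrepared H ε C c ρ0) {r T : ℝ} (hr : 0 < r)
    (hT : 0 ≤ T) : ∫ p, timeQuotient H ε ρ r p ^ 2 ∂(stripMeasure T) ≤ C := by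
  simp only [timeQuotient, mul_pow]
  rw [integral_const_mul, inv_pow, inv_mul_le_iff₀ (pow_pos hr 2)]
  exact h.integral_sq_increment_le hH hε hint hwp hr.le hT

lemma integral_timeQuotient_mul (h : IsSolution H ε ρ0 ρ) (hH : Continuous H)
    (hint : GibbsIntegrable H ε) {T r δ : ℝ} {ψ ψ' : ℝ × ℝ → ℝ} (hψ : IsTimeTest T ψ ψ')
    (hδψ : ∀ t x, t ∉ Icc δ (T - δ) → ψ (t, x) = 0) (hr : 0 ≤ r) (hrδ : r < δ) :
    ∫ p, timeQuotient H ε ρ r p * (wt H ε p.2 * ψ p) ∂(stripMeasure T) =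
      ∫ p, ρ p.1 p.2 * (r⁻¹ * (ψ (p.1 - r, p.2) - ψ p)) ∂(stripMeasure T) := by
  obtain ⟨M, hM⟩ := hψ.bounded
  have h_now := h.integrable_strip_mul hH hint (T := T) hψ.measurable hM
  have h_back := h.integrable_strip_mul hH hint (T := T) (hψ.measurable_shift r) fun _ => hM _
  have h_later : Integrable (fun p : ℝ × ℝ => ρ (p.1 + r) p.2 * ψ p) (stripMeasure T) :=
    ((h.memLp_shift hH hint hr T).integrable_mul
      (memLp_wt_mul_strip hH hint hψ.measurable hM)).congr
      (ae_of_all _ fun p => div_mul_mul_cancel_weight (wt_ne_zero hint) _ _ _)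
  simp only [timeQuotient, mul_assoc, div_mul_mul_cancel_weight (wt_ne_zero hint), sub_mul,
    mul_left_comm _ r⁻¹, mul_sub (ρ _ _)]
  rw [integral_const_mul, integral_const_mul, integral_sub h_later h_now,
    integral_sub h_back h_now, integral_shift_mul hr hrδ ρ hδψ]

lemma exists_isTimeDeriv (h : IsSolution H ε ρ0 ρ) (hH : ContDiff ℝ ∞ H) (hε : 0 < ε)
    (hint : GibbsIntegrable H ε) (hwp : WellPrepared H ε C c ρ0) {T : ℝ} (hT : 0 ≤ T) :
    ∃ w : ℝ → ℝ → ℝ, IsTimeDeriv H ε C T ρ w := by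
  have hHc := hH.continuous
  set r : ℕ → ℝ := fun n => 1 / ((n : ℝ) + 1)
  have hr : ∀ n, 0 < r n := fun n => Nat.one_div_pos_of_nat
  have hr_lim : Tendsto r atTop (𝓝[>] 0) := tendsto_nhdsWithin_iff.2
    ⟨tendsto_one_div_add_atTop_nhds_zero_nat, Eventually.of_forall hr⟩
  obtain ⟨y, hy, hyC, hy_lim⟩ := exists_weak_limit_memLp
    (fun n => (h.memLp_increment hHc hint (hr n).le T).const_mul (r n)⁻¹)
    (fun n => h.integral_sq_timeQuotient_le hH hε hint hwp (hr n) hT)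
  have hy_div : ∀ p : ℝ × ℝ, y p * wt H ε p.2 / wt H ε p.2 = y p :=
    fun p => mul_div_cancel_right₀ _ (wt_ne_zero hint _)
  refine ⟨fun t x => y (t, x) * wt H ε x, ⟨hy.aestronglyMeasurable.mul
    ((continuous_wt hHc ε).comp continuous_snd).aestronglyMeasurable, ?_⟩, ?_, fun ψ ψ' hψ => ?_⟩
  · simpa only [← div_wt_sq hint, hy_div] using hy.integrable_sq
  · simpa only [hy_div] using hyC
  · obtain ⟨M, hM⟩ := hψ.bounded
    obtain ⟨δ, hδ, hδψ⟩ := hψ.support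
    have hρ : Integrable (fun p : ℝ × ℝ => ρ p.1 p.2) (stripMeasure T) := by
      simpa using h.integrable_strip_mul hHc hint (T := T) (ψ := fun _ => 1) (M := 1)
        measurable_const fun _ => abs_one.le
    simp only [mul_assoc]
    refine hy_lim _ (memLp_wt_mul_strip hHc hint hψ.measurable hM) _
      (((hψ.tendsto_integral_quotient hρ).comp hr_lim).congr' ?_)
    filter_upwards [hr_lim.eventually (Ioo_mem_nhdsGT hδ)] with n hn
    exact (h.integral_timeQuotient_mul hHc hint hψ hδψ hn.1.le hn.2).symm

end IsSolution

section Density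

variable {E : Type*} [NormedAddCommGroup E] [NormedSpace ℝ E] [FiniteDimensional ℝ E]
  [MeasurableSpace E] [BorelSpace E] {μ : Measure E} [IsLocallyFiniteMeasure μ] {Ω : Set E}

/-- The classes in `L²(Ω)` of the smooth functions with compact support in `Ω`. -/
def testSubmodule (μ : Measure E) (Ω : Set E) : Submodule ℝ (Lp ℝ 2 (μ.restrict Ω)) where
  carrier := {P | ∃ a : E → ℝ, ContDiff ℝ ∞ a ∧ HasCompactSupport a ∧ tsupport a ⊆ Ω ∧
    P =ᵐ[μ.restrict Ω] a}
  zero_mem' := ⟨0, contDiff_const, HasCompactSupport.zero, by simp [tsupport],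
    Lp.coeFn_zero ℝ 2 _⟩
  add_mem' := by
    rintro P Q ⟨a, ha, has, haΩ, hPa⟩ ⟨b, hb, hbs, hbΩ, hQb⟩
    exact ⟨a + b, ha.add hb, has.add hbs, (tsupport_add a b).trans (union_subset haΩ hbΩ),
      (Lp.coeFn_add P Q).trans (hPa.add hQb)⟩
  smul_mem' := by
    rintro r P ⟨a, ha, has, haΩ, hPa⟩
    refine ⟨fun x => r * a x, contDiff_const.mul ha, has.mul_left,
      tsupport_mul_subset_right.trans haΩ, ?_⟩
    filter_upwards [Lp.coeFn_smul r P, hPa] with x h_smul hPx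
    rw [h_smul, Pi.smul_apply, hPx, smul_eq_mul]

lemma topologicalClosure_testSubmodule (hΩ : IsOpen Ω) :
    (testSubmodule μ Ω).topologicalClosure = ⊤ := by
  rw [Submodule.topologicalClosure_eq_top_iff, eq_bot_iff]
  intro P hP
  rw [Submodule.mem_orthogonal] at hP
  have h_loc : LocallyIntegrableOn P Ω μ :=
    (locallyIntegrableOn_of_locallyIntegrable_restrict
      ((Lp.memLp P).locallyIntegrable one_le_two))
  have h_zero := hΩ.ae_eq_zero_of_integral_contDiff_smul_eq_zero h_loc fun a ha has haΩ => by
    have h_mem : MemLp a 2 (μ.restrict Ω) :=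
      (ha.continuous.memLp_of_hasCompactSupport has).restrict _
    have h_orth := hP (toL2 _ a) ⟨a, ha, has, haΩ, coeFn_toL2 h_mem⟩
    rw [inner_eq_integral (coeFn_toL2 h_mem) (ae_eq_refl _)] at h_orth
    refine (setIntegral_eq_integral_of_forall_compl_eq_zero fun x hx => ?_).symm.trans h_orth
    rw [image_eq_zero_of_notMem_tsupport fun h => hx (haΩ h), zero_smul]
  refine (Submodule.mem_bot ℝ).2 (Lp.ext ?_)
  filter_upwards [Lp.coeFn_zero ℝ 2 (μ.restrict Ω), (ae_restrict_iff' hΩ.measurableSet).2 h_zero]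
    with x hx hPx
  rw [hx, hPx, Pi.zero_apply]

lemma exists_contDiff_integral_sq_sub_lt (hΩ : IsOpen Ω) {f : E → ℝ}
    (hf : MemLp f 2 (μ.restrict Ω)) {δ : ℝ} (hδ : 0 < δ) :
    ∃ a : E → ℝ, ContDiff ℝ ∞ a ∧ HasCompactSupport a ∧ tsupport a ⊆ Ω ∧
      ∫ x in Ω, (f x - a x) ^ 2 ∂μ < δ ^ 2 := by
  have h_mem : toL2 (μ.restrict Ω) f ∈ closure (testSubmodule μ Ω : Set (Lp ℝ 2 (μ.restrict Ω))) :=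
    by rw [← Submodule.topologicalClosure_coe, topologicalClosure_testSubmodule hΩ]; trivial
  obtain ⟨P, ⟨a, ha, has, haΩ, hPa⟩, hP⟩ := Metric.mem_closure_iff.1 h_mem δ hδ
  have ham : MemLp a 2 (μ.restrict Ω) := (ha.continuous.memLp_of_hasCompactSupport has).restrict _
  refine ⟨a, ha, has, haΩ, ?_⟩
  rw [dist_eq_norm, Lp.ext (hPa.trans (coeFn_toL2 ham).symm), toL2_sub hf ham] at hP
  rw [← norm_toL2_sq (f := fun x => f x - a x) (hf.sub ham)]
  exact pow_lt_pow_left₀ hP (norm_nonneg _) two_ne_zero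

end Density

section LimitCurve

variable (k : ℝ) (μ0 : Measure ℝ)

lemma contDiff_limitCurve : ContDiff ℝ ∞ (limitCurve k μ0) := by
  unfold limitCurve
  fun_prop

lemma hasDerivAt_limitCurve (t : ℝ) :
    HasDerivAt (limitCurve k μ0) (-k * (limitCurve k μ0 t - 1)) t := by
  have h_exp := ((((hasDerivAt_id t).const_mul (-k)).exp).const_mul
    (2 * μ0.real (Ioi 0) - 1)).const_add 1
  refine h_exp.congr_deriv ?_
  simp only [limitCurve, id_eq, mul_one]
  ring

lemma continuous_limitCurve_velocity : Continuous fun t => -k * (limitCurve k μ0 t - 1) := by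
  have h_cont := (contDiff_limitCurve k μ0).continuous
  fun_prop

lemma memLp_Ioo_of_continuous {f : ℝ → ℝ} (hf : Continuous f) (a b : ℝ) :
    MemLp f 2 (volume.restrict (Ioo a b)) :=
  (memLp_two_iff_integrable_sq hf.aestronglyMeasurable).2
    ((hf.pow 2).integrableOn_Icc.mono_set Ioo_subset_Icc_self)

lemma hasWeakDerivOn_limitCurve (Ω : Set ℝ) :
    HasWeakDerivOn (limitCurve k μ0) (fun t => -k * (limitCurve k μ0 t - 1)) Ω := by
  rw [← deriv_eq (hasDerivAt_limitCurve k μ0)]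
  exact (IsPrimitive.of_contDiff ((contDiff_limitCurve k μ0).of_le (by simp))).hasWeakDerivOn Ω

end LimitCurve

section Slices

variable {T : ℝ} {ψ ψ' : ℝ × ℝ → ℝ}

lemma tendsto_integral_strip {ι : Type*} {l : Filter ι} [l.IsCountablyGenerated]
    {f : ι → ℝ × ℝ → ℝ} {L : ℝ → ℝ} {M : ℝ} (hf : ∀ᶠ i in l, Integrable (f i) (stripMeasure T))
    (hM : ∀ᶠ i in l, ∀ t ∈ Ioo 0 T, |∫ x, f i (t, x)| ≤ M)
    (hL : ∀ t ∈ Ioo 0 T, Tendsto (fun i => ∫ x, f i (t, x)) l (𝓝 (L t))) :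
    Tendsto (fun i => ∫ p, f i p ∂(stripMeasure T)) l (𝓝 (∫ t in Ioo 0 T, L t)) := by
  have h_slices : Tendsto (fun i => ∫ t in Ioo 0 T, ∫ x, f i (t, x)) l
      (𝓝 (∫ t in Ioo 0 T, L t)) := by
    refine tendsto_integral_filter_of_dominated_convergence (fun _ => M) ?_ ?_
      (integrable_const M) ?_
    · filter_upwards [hf] with i hi
      exact hi.integral_prod_left.aestronglyMeasurable
    · filter_upwards [hM] with i hi
      exact (ae_restrict_iff' measurableSet_Ioo).2 (ae_of_all _ hi)
    · exact (ae_restrict_iff' measurableSet_Ioo).2 (ae_of_all _ hL)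
  refine h_slices.congr' ?_
  filter_upwards [hf] with i hi
  rw [stripMeasure, integral_prod _ hi]

lemma abs_integral_mul_le_of_integral_eq_one {α : Type*} [MeasurableSpace α] {μ : Measure α}
    {κ g : α → ℝ} {M : ℝ} (hκ : ∀ x, 0 ≤ κ x) (hκ_one : ∫ x, κ x ∂μ = 1) (hg : ∀ x, |g x| ≤ M) :
    |∫ x, κ x * g x ∂μ| ≤ M := by
  have h_le : ∀ x, ‖κ x * g x‖ ≤ κ x * M := fun x => by
    rw [norm_mul, Real.norm_of_nonneg (hκ x)]
    exact mul_le_mul_of_nonneg_left (hg x) (hκ x)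
  have h_bound := norm_integral_le_of_norm_le
    ((integrable_of_integral_eq_one hκ_one).mul_const M) (ae_of_all μ h_le)
  rwa [integral_mul_const, hκ_one, one_mul] at h_bound

lemma IsTimeTest.add {φ φ' : ℝ × ℝ → ℝ} (hψ : IsTimeTest T ψ ψ') (hφ : IsTimeTest T φ φ') :
    IsTimeTest T (fun p => ψ p + φ p) fun p => ψ' p + φ' p := by
  obtain ⟨M, hM⟩ := hψ.bounded
  obtain ⟨N, hN⟩ := hφ.bounded
  obtain ⟨M', hM'⟩ := hψ.bounded_deriv
  obtain ⟨N', hN'⟩ := hφ.bounded_deriv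
  obtain ⟨δ, hδ, hδψ⟩ := hψ.support
  obtain ⟨η, hη, hηφ⟩ := hφ.support
  refine ⟨hψ.measurable.add hφ.measurable, fun t x => (hψ.hasDerivAt t x).add (hφ.hasDerivAt t x),
    ⟨M + N, fun p => (abs_add_le _ _).trans (add_le_add (hM p) (hN p))⟩,
    ⟨M' + N', fun p => (abs_add_le _ _).trans (add_le_add (hM' p) (hN' p))⟩,
    min δ η, lt_min hδ hη, fun t x ht => ?_⟩
  have h_sub : Icc δ (T - δ) ∪ Icc η (T - η) ⊆ Icc (min δ η) (T - min δ η) :=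
    union_subset (Icc_subset_Icc (min_le_left _ _) (sub_le_sub_left (min_le_left _ _) _))
      (Icc_subset_Icc (min_le_right _ _) (sub_le_sub_left (min_le_right _ _) _))
  rw [hδψ t x fun h => ht (h_sub (Or.inl h)), hηφ t x fun h => ht (h_sub (Or.inr h)), add_zero]

lemma IsTimeTest.integral_deriv_mul (hψ : IsTimeTest T ψ ψ') (hT : 0 ≤ T)
    (hψ' : Measurable ψ') {u u' : ℝ → ℝ} (hu : ∀ t, HasDerivAt u (u' t) t) (hu' : Continuous u')
    (x : ℝ) : ∫ t in Ioo 0 T, u' t * ψ (t, x) = -∫ t in Ioo 0 T, u t * ψ' (t, x) := by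
  obtain ⟨M, hM⟩ := hψ.bounded_deriv
  obtain ⟨δ, hδ, h_supp⟩ := hψ.support
  have h_int : IntervalIntegrable (fun t => ψ' (t, x)) volume 0 T := by
    rw [intervalIntegrable_iff]
    exact Measure.integrableOn_of_bounded (M := M) (by simp)
      (hψ'.comp measurable_prodMk_right).aestronglyMeasurable (ae_of_all _ fun t => hM (t, x))
  have h_parts := intervalIntegral.integral_mul_deriv_eq_deriv_mul (fun t _ => hu t)
    (fun t _ => hψ.hasDerivAt t x) (hu'.intervalIntegrable 0 T) h_int
  rw [h_supp 0 x fun h => hδ.not_ge h.1, h_supp T x fun h => by linarith [h.2],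
    intervalIntegral.integral_of_le hT, intervalIntegral.integral_of_le hT,
    integral_Ioc_eq_integral_Ioo, integral_Ioc_eq_integral_Ioo] at h_parts
  linarith

end Slices

/-- A bounded measurable function of `(t, x)` that is continuous in `x` at the two wells, so that
its integrals against the measures `γ_ε` and `ρ_ε(t, ·)`, which concentrate at the wells, converge
at each time `t`. -/
structure IsWellTest (ψ : ℝ × ℝ → ℝ) : Prop where
  measurable : Measurable ψ
  bounded : ∃ M, ∀ p, |ψ p| ≤ M
  continuousAt_one : ∀ t, ContinuousAt (fun x => ψ (t, x)) 1
  continuousAt_neg_one : ∀ t, ContinuousAt (fun x => ψ (t, x)) (-1)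

/-- The seminorm `(∫_0^T ½ (ψ(t, 1)² + ψ(t, -1)²) dt)^{1/2}`, the limit of the `γ_ε`-weighted
`L²` norms of `ψ` on the strip. -/
def wellSeminorm (T : ℝ) (ψ : ℝ × ℝ → ℝ) : ℝ :=
  Real.sqrt (∫ t in Ioo 0 T, (ψ (t, 1) ^ 2 + ψ (t, -1) ^ 2) / 2)

/-- The integral of `ψ` against the measure `½ (d δ₁ - d δ₋₁)` on `(0, T) × ℝ`. -/
def jumpPairing (T : ℝ) (d : ℝ → ℝ) (ψ : ℝ × ℝ → ℝ) : ℝ :=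
  ∫ t in Ioo 0 T, (1 / 2) * (d t * ψ (t, 1) - d t * ψ (t, -1))

lemma abs_indicator_one_le {α : Type*} (s : Set α) (x : α) :
    |s.indicator (1 : α → ℝ) x| ≤ 1 := by
  by_cases hx : x ∈ s <;> simp [hx]

namespace IsWellTest

variable {ψ φ : ℝ × ℝ → ℝ}

lemma of_boundedContinuous (Ψ : (ℝ × ℝ) →ᵇ ℝ) : IsWellTest Ψ where
  measurable := Ψ.continuous.measurable
  bounded := ⟨‖Ψ‖, Ψ.norm_coe_le_norm⟩
  continuousAt_one _ := (Ψ.continuous.comp (Continuous.prodMk_right _)).continuousAt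
  continuousAt_neg_one _ := (Ψ.continuous.comp (Continuous.prodMk_right _)).continuousAt

lemma mul_indicator {a : ℝ → ℝ} (ha : Continuous a) (has : HasCompactSupport a) {s : Set ℝ}
    (hs : MeasurableSet s) (h_right : 1 ∉ frontier s) (h_left : -1 ∉ frontier s) :
    IsWellTest fun p => a p.1 * s.indicator 1 p.2 where
  measurable := (ha.measurable.comp measurable_fst).mul
    ((measurable_one.indicator hs).comp measurable_snd)
  bounded := by
    obtain ⟨B, hB⟩ := ha.bounded_above_of_compact_support has
    refine ⟨B, fun p => ?_⟩
    rw [abs_mul]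
    exact (mul_le_of_le_one_right (abs_nonneg _) (abs_indicator_one_le s _)).trans (hB _)
  continuousAt_one _ :=
    continuousAt_const.mul (continuousOn_const.continuousAt_indicator h_right)
  continuousAt_neg_one _ :=
    continuousAt_const.mul (continuousOn_const.continuousAt_indicator h_left)

lemma add (hψ : IsWellTest ψ) (hφ : IsWellTest φ) : IsWellTest fun p => ψ p + φ p where
  measurable := hψ.measurable.add hφ.measurable
  bounded := by
    obtain ⟨M, hM⟩ := hψ.bounded
    obtain ⟨N, hN⟩ := hφ.bounded
    exact ⟨M + N, fun p => (abs_add_le _ _).trans (add_le_add (hM p) (hN p))⟩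
  continuousAt_one t := (hψ.continuousAt_one t).add (hφ.continuousAt_one t)
  continuousAt_neg_one t := (hψ.continuousAt_neg_one t).add (hφ.continuousAt_neg_one t)

lemma sub (hψ : IsWellTest ψ) (hφ : IsWellTest φ) : IsWellTest fun p => ψ p - φ p where
  measurable := hψ.measurable.sub hφ.measurable
  bounded := by
    obtain ⟨M, hM⟩ := hψ.bounded
    obtain ⟨N, hN⟩ := hφ.bounded
    exact ⟨M + N, fun p => (abs_sub _ _).trans (add_le_add (hM p) (hN p))⟩
  continuousAt_one t := (hψ.continuousAt_one t).sub (hφ.continuousAt_one t)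
  continuousAt_neg_one t := (hψ.continuousAt_neg_one t).sub (hφ.continuousAt_neg_one t)

lemma memLp_slice (hψ : IsWellTest ψ) (x T : ℝ) :
    MemLp (fun t => ψ (t, x)) 2 (volume.restrict (Ioo 0 T)) := by
  obtain ⟨M, hM⟩ := hψ.bounded
  exact MemLp.of_bound (hψ.measurable.comp measurable_prodMk_right).aestronglyMeasurable M
    (ae_of_all _ fun t => hM (t, x))

lemma integrable_mul_sub {d : ℝ → ℝ} {T : ℝ} (hd : MemLp d 2 (volume.restrict (Ioo 0 T)))
    (hψ : IsWellTest ψ) :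
    IntegrableOn (fun t => (1 / 2) * (d t * ψ (t, 1) - d t * ψ (t, -1))) (Ioo 0 T) :=
  ((hd.integrable_mul (hψ.memLp_slice 1 T)).sub
    (hd.integrable_mul (hψ.memLp_slice (-1) T))).const_mul _

lemma jumpPairing_sub {d : ℝ → ℝ} {T : ℝ} (hd : MemLp d 2 (volume.restrict (Ioo 0 T)))
    (hψ : IsWellTest ψ) (hφ : IsWellTest φ) :
    jumpPairing T d (fun p => ψ p - φ p) = jumpPairing T d ψ - jumpPairing T d φ := by
  rw [jumpPairing, jumpPairing, jumpPairing,
    ← integral_sub (hψ.integrable_mul_sub hd) (hφ.integrable_mul_sub hd)]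
  refine integral_congr_ae (ae_of_all _ fun t => ?_)
  ring

lemma abs_jumpPairing_le {d : ℝ → ℝ} {T : ℝ} (hd : MemLp d 2 (volume.restrict (Ioo 0 T)))
    (hψ : IsWellTest ψ) :
    |jumpPairing T d ψ| ≤ Real.sqrt (∫ t in Ioo 0 T, d t ^ 2) * wellSeminorm T ψ := by
  have h_right := hψ.memLp_slice 1 T
  have h_left := hψ.memLp_slice (-1) T
  have h_jump : MemLp (fun t => (1 / 2) * (ψ (t, 1) - ψ (t, -1))) 2 (volume.restrict (Ioo 0 T)) :=
    (h_right.sub h_left).const_mul _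
  have h_le : ∫ t in Ioo 0 T, ((1 / 2) * (ψ (t, 1) - ψ (t, -1))) ^ 2 ≤
      ∫ t in Ioo 0 T, (ψ (t, 1) ^ 2 + ψ (t, -1) ^ 2) / 2 :=
    integral_mono h_jump.integrable_sq
      ((h_right.integrable_sq.add h_left.integrable_sq).div_const 2) fun t => by
        nlinarith only [sq_nonneg (ψ (t, 1) + ψ (t, -1))]
  calc |jumpPairing T d ψ| = |∫ t in Ioo 0 T, d t * ((1 / 2) * (ψ (t, 1) - ψ (t, -1)))| := by
        simp only [jumpPairing, ← mul_sub, mul_left_comm]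
    _ ≤ Real.sqrt (∫ t in Ioo 0 T, d t ^ 2) *
        Real.sqrt (∫ t in Ioo 0 T, ((1 / 2) * (ψ (t, 1) - ψ (t, -1))) ^ 2) :=
      abs_integral_mul_le hd h_jump
    _ ≤ Real.sqrt (∫ t in Ioo 0 T, d t ^ 2) * wellSeminorm T ψ :=
      mul_le_mul_of_nonneg_left (Real.sqrt_le_sqrt h_le) (Real.sqrt_nonneg _)

lemma exists_wellSeminorm_sub_lt (hψ : IsWellTest ψ) {T δ : ℝ} (hδ : 0 < δ) :
    ∃ φ φ' : ℝ × ℝ → ℝ, IsTimeTest T φ φ' ∧ IsWellTest φ ∧ IsWellTest φ' ∧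
      wellSeminorm T (fun p => ψ p - φ p) < δ := by
  obtain ⟨a, ha, has, haT, ha_lt⟩ :=
    exists_contDiff_integral_sq_sub_lt isOpen_Ioo (hψ.memLp_slice 1 T) hδ
  obtain ⟨b, hb, hbs, hbT, hb_lt⟩ :=
    exists_contDiff_integral_sq_sub_lt isOpen_Ioo (hψ.memLp_slice (-1) T) hδ
  have h_Ioi : ∀ a' : ℝ → ℝ, Continuous a' → HasCompactSupport a' →
      IsWellTest fun p => a' p.1 * (Ioi (0 : ℝ)).indicator 1 p.2 := fun a' ha' has' =>
    mul_indicator ha' has' measurableSet_Ioi (by simp) (by simp)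
  have h_Iic : ∀ b' : ℝ → ℝ, Continuous b' → HasCompactSupport b' →
      IsWellTest fun p => b' p.1 * (Iic (0 : ℝ)).indicator 1 p.2 := fun b' hb' hbs' =>
    mul_indicator hb' hbs' measurableSet_Iic (by simp) (by simp)
  refine ⟨_, _,
    (IsTimeTest.mul ha has haT (measurable_one.indicator measurableSet_Ioi)
      (abs_indicator_one_le _)).add
      (IsTimeTest.mul hb hbs hbT (measurable_one.indicator measurableSet_Iic)
        (abs_indicator_one_le _)),
    (h_Ioi a ha.continuous has).add (h_Iic b hb.continuous hbs),
    (h_Ioi _ (ha.continuous_deriv (by simp)) has.deriv).add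
      (h_Iic _ (hb.continuous_deriv (by simp)) hbs.deriv), ?_⟩
  have h_one : (1 : ℝ) ∈ Ioi (0 : ℝ) ∧ (1 : ℝ) ∉ Iic (0 : ℝ) := by norm_num
  have h_neg_one : (-1 : ℝ) ∉ Ioi (0 : ℝ) ∧ (-1 : ℝ) ∈ Iic (0 : ℝ) := by norm_num
  simp only [wellSeminorm, indicator_of_mem h_one.1, indicator_of_notMem h_one.2,
    indicator_of_notMem h_neg_one.1, indicator_of_mem h_neg_one.2, Pi.one_apply, mul_one, mul_zero,
    add_zero, zero_add]
  rw [Real.sqrt_lt' hδ, integral_div, integral_add]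
  · linarith
  · exact ((hψ.memLp_slice 1 T).sub
      ((ha.continuous.memLp_of_hasCompactSupport has).restrict _)).integrable_sq
  · exact ((hψ.memLp_slice (-1) T).sub
      ((hb.continuous.memLp_of_hasCompactSupport hbs).restrict _)).integrable_sq

end IsWellTest

lemma IsTimeTest.jumpPairing_eq {T : ℝ} (hT : 0 ≤ T) {ψ ψ' : ℝ × ℝ → ℝ} (hψ : IsTimeTest T ψ ψ')
    (hψw : IsWellTest ψ) (hψw' : IsWellTest ψ') {u u' : ℝ → ℝ} (hu : ∀ t, HasDerivAt u (u' t) t)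
    (hu' : Continuous u') :
    jumpPairing T u' ψ =
      -∫ t in Ioo 0 T, (1 / 2) * (u t * ψ' (t, 1) + (2 - u t) * ψ' (t, -1)) := by
  have h_cont : Continuous u := continuous_iff_continuousAt.2 fun t => (hu t).continuousAt
  have h_int : ∀ {f : ℝ → ℝ} {φ : ℝ × ℝ → ℝ}, Continuous f → IsWellTest φ → ∀ x,
      IntegrableOn (fun t => f t * φ (t, x)) (Ioo 0 T) := fun hf hφ x =>
    (memLp_Ioo_of_continuous hf 0 T).integrable_mul (hφ.memLp_slice x T)
  have h_right := hψ.integral_deriv_mul hT hψw'.measurable hu hu' 1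
  have h_left := hψ.integral_deriv_mul hT hψw'.measurable (fun t => (hu t).const_sub 2)
    hu'.neg (-1)
  rw [jumpPairing, integral_const_mul, integral_const_mul,
    integral_sub (h_int hu' hψw 1) (h_int hu' hψw (-1)),
    integral_add (h_int h_cont hψw' 1)
      (h_int (f := fun t => 2 - u t) (continuous_const.sub h_cont) hψw' (-1))]
  simp only [neg_mul, integral_neg] at h_left
  linarith

namespace IsTimeDeriv

variable {H : ℝ → ℝ} {ε C T M : ℝ} {ρ w : ℝ → ℝ → ℝ} {ψ : ℝ × ℝ → ℝ}

lemma integrable_mul (hw : IsTimeDeriv H ε C T ρ w) (hH : Continuous H)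
    (hint : GibbsIntegrable H ε) (hψ : Measurable ψ) (hM : ∀ p, |ψ p| ≤ M) :
    Integrable (fun p => w p.1 p.2 * ψ p) (stripMeasure T) :=
  ((hw.memL2Strip.memLp hH hint).integrable_mul (memLp_wt_mul_strip hH hint hψ hM)).congr
    (ae_of_all _ fun _ => div_mul_mul_cancel_weight (wt_ne_zero hint) _ _ _)

lemma abs_integral_mul_le (hw : IsTimeDeriv H ε C T ρ w) (hH : Continuous H)
    (hint : GibbsIntegrable H ε) (hψ : Measurable ψ) (hM : ∀ p, |ψ p| ≤ M) :
    |∫ p, w p.1 p.2 * ψ p ∂(stripMeasure T)| ≤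
      Real.sqrt C * Real.sqrt (∫ p, gam H ε p.2 * ψ p ^ 2 ∂(stripMeasure T)) := by
  have h_cs := KramersLimit.abs_integral_mul_le (hw.memL2Strip.memLp hH hint)
    (memLp_wt_mul_strip hH hint hψ hM)
  simp only [div_mul_mul_cancel_weight (wt_ne_zero hint), mul_wt_sq hint] at h_cs
  exact h_cs.trans (mul_le_mul_of_nonneg_right (Real.sqrt_le_sqrt hw.integral_sq_le)
    (Real.sqrt_nonneg _))

lemma abs_integral_mul_sub_jumpPairing_le {φ : ℝ × ℝ → ℝ} {d : ℝ → ℝ}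
    (hw : IsTimeDeriv H ε C T ρ w) (hH : Continuous H) (hint : GibbsIntegrable H ε)
    (hd : MemLp d 2 (volume.restrict (Ioo 0 T))) (hψ : IsWellTest ψ) (hφ : IsWellTest φ) :
    |∫ p, w p.1 p.2 * ψ p ∂(stripMeasure T) - jumpPairing T d ψ| ≤
      Real.sqrt C * Real.sqrt (∫ p, gam H ε p.2 * (ψ p - φ p) ^ 2 ∂(stripMeasure T)) +
        |∫ p, w p.1 p.2 * φ p ∂(stripMeasure T) - jumpPairing T d φ| +
        Real.sqrt (∫ t in Ioo 0 T, d t ^ 2) * wellSeminorm T fun p => ψ p - φ p := by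
  obtain ⟨M, hM⟩ := hψ.bounded
  obtain ⟨N, hN⟩ := hφ.bounded
  obtain ⟨P, hP⟩ := (hψ.sub hφ).bounded
  have h_time := hw.abs_integral_mul_le hH hint (hψ.sub hφ).measurable hP
  have h_jump := (hψ.sub hφ).abs_jumpPairing_le hd
  rw [hψ.jumpPairing_sub hd hφ] at h_jump
  simp only [mul_sub] at h_time
  rw [integral_sub (hw.integrable_mul hH hint hψ.measurable hM)
    (hw.integrable_mul hH hint hφ.measurable hN)] at h_time
  refine le_trans ?_ (add_le_add (add_le_add h_time le_rfl) h_jump)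
  rw [abs_sub_comm (jumpPairing T d ψ)]
  refine le_trans (le_of_eq ?_) (abs_add_three _ _ _)
  ring_nf

end IsTimeDeriv

namespace IsFamily

variable {H : ℝ → ℝ} {ε₀ C c T : ℝ} {ρ0 : ℝ → ℝ → ℝ} {ρ w : ℝ → ℝ → ℝ → ℝ} {μ0 : Measure ℝ}
  {ψ ψ' : ℝ × ℝ → ℝ}

lemma tendsto_sqrt_integral_gam_mul_sq (F : IsFamily H ε₀ C c ρ0 ρ μ0) (hψ : IsWellTest ψ) :
    Tendsto (fun ε => Real.sqrt (∫ p, gam H ε p.2 * ψ p ^ 2 ∂(stripMeasure T))) (𝓝[>] 0)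
      (𝓝 (wellSeminorm T ψ)) := by
  obtain ⟨ε₁, hε₁, hint⟩ := F.exists_gibbsIntegrable
  obtain ⟨M, hM⟩ := hψ.bounded
  have h_sq : ∀ p, |ψ p ^ 2| ≤ M ^ 2 := fun p => by
    rw [abs_pow]
    exact pow_le_pow_left₀ (abs_nonneg _) (hM p) 2
  refine (tendsto_integral_strip (M := M ^ 2) ?_ ?_ fun t _ => ?_).sqrt
  · filter_upwards [F.eventually_mem] with ε hε
    have hint' := F.gibbsIntegrable ε hε
    simpa only [mul_wt_sq hint'] using
      (memLp_wt_mul_strip F.doubleWell.continuous hint' hψ.measurable hM).integrable_sq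
  · filter_upwards [F.eventually_mem] with ε hε t _
    have hint' := F.gibbsIntegrable ε hε
    exact abs_integral_mul_le_of_integral_eq_one (fun x => (gam_pos hint' x).le)
      (integral_gam hint') fun x => h_sq (t, x)
  · simp only [mul_comm (gam H _ _)]
    exact F.doubleWell.tendsto_integral_mul_gam hε₁ hint
      ((hψ.measurable.comp measurable_prodMk_left).pow_const 2) (fun x => h_sq (t, x))
      ((hψ.continuousAt_one t).pow 2) ((hψ.continuousAt_neg_one t).pow 2)

variable [IsProbabilityMeasure μ0]

lemma tendsto_integral_strip_mul (F : IsFamily H ε₀ C c ρ0 ρ μ0) (hψ : IsWellTest ψ) :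
    Tendsto (fun ε => ∫ p, ρ ε p.1 p.2 * ψ p ∂(stripMeasure T)) (𝓝[>] 0)
      (𝓝 (∫ t in Ioo 0 T, (1 / 2) * (limitCurve (rate H) μ0 t * ψ (t, 1) +
        (2 - limitCurve (rate H) μ0 t) * ψ (t, -1)))) := by
  obtain ⟨M, hM⟩ := hψ.bounded
  refine tendsto_integral_strip (M := M) ?_ ?_ fun t ht => ?_
  · filter_upwards [F.eventually_mem] with ε hε
    exact (F.isSolution ε hε).integrable_strip_mul F.doubleWell.continuous
      (F.gibbsIntegrable ε hε) hψ.measurable hM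
  · filter_upwards [F.eventually_mem] with ε hε t ht
    exact abs_integral_mul_le_of_integral_eq_one ((F.isSolution ε hε).nonneg t ht.1.le)
      (F.integral_eq_one hε ht.1.le) fun x => hM (t, x)
  · exact F.tendsto_integral_mul ht.1.le (hψ.measurable.comp measurable_prodMk_left)
      (fun x => hM (t, x)) (hψ.continuousAt_one t) (hψ.continuousAt_neg_one t)

lemma tendsto_time_deriv_of_isTimeTest (F : IsFamily H ε₀ C c ρ0 ρ μ0) (hT : 0 ≤ T)
    (hw : ∀ ε ∈ Ioo 0 ε₀, IsTimeDeriv H ε C T (ρ ε) (w ε)) (hψ : IsTimeTest T ψ ψ')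
    (hψw : IsWellTest ψ) (hψw' : IsWellTest ψ') :
    Tendsto (fun ε => ∫ p, w ε p.1 p.2 * ψ p ∂(stripMeasure T)) (𝓝[>] 0)
      (𝓝 (jumpPairing T (fun t => -rate H * (limitCurve (rate H) μ0 t - 1)) ψ)) := by
  rw [hψ.jumpPairing_eq hT hψw hψw' (hasDerivAt_limitCurve (rate H) μ0)
    (continuous_limitCurve_velocity (rate H) μ0)]
  refine (F.tendsto_integral_strip_mul hψw').neg.congr' ?_
  filter_upwards [F.eventually_mem] with ε hε using ((hw ε hε).weak ψ ψ' hψ).symm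

lemma tendsto_time_deriv (F : IsFamily H ε₀ C c ρ0 ρ μ0) (hT : 0 ≤ T)
    (hw : ∀ ε ∈ Ioo 0 ε₀, IsTimeDeriv H ε C T (ρ ε) (w ε)) (hψ : IsWellTest ψ) :
    Tendsto (fun ε => ∫ p, w ε p.1 p.2 * ψ p ∂(stripMeasure T)) (𝓝[>] 0)
      (𝓝 (jumpPairing T (fun t => -rate H * (limitCurve (rate H) μ0 t - 1)) ψ)) := by
  set d := fun t => -rate H * (limitCurve (rate H) μ0 t - 1)
  have hd : MemLp d 2 (volume.restrict (Ioo 0 T)) :=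
    memLp_Ioo_of_continuous (continuous_limitCurve_velocity _ _) 0 T
  set A := Real.sqrt C
  set B := Real.sqrt (∫ t in Ioo 0 T, d t ^ 2)
  have hAB : 0 < A + B + 1 := by positivity
  refine Metric.tendsto_nhds.2 fun κ hκ => ?_
  obtain ⟨φ, φ', hφ, hφw, hφw', h_close⟩ :=
    hψ.exists_wellSeminorm_sub_lt (T := T) (div_pos hκ hAB)
  set q := wellSeminorm T fun p => ψ p - φ p
  have h_small : A * q + B * q < κ := by
    have hq_nonneg : 0 ≤ q := Real.sqrt_nonneg _
    linarith [(lt_div_iff₀' hAB).1 h_close]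
  have h_error := (((F.tendsto_sqrt_integral_gam_mul_sq (T := T) (hψ.sub hφw)).const_mul A).add
    ((F.tendsto_time_deriv_of_isTimeTest hT hw hφ hφw hφw').sub_const
      (jumpPairing T d φ)).abs).add_const (B * q)
  rw [sub_self, abs_zero, add_zero] at h_error
  filter_upwards [h_error.eventually_lt_const h_small, F.eventually_mem] with ε h_lt hε
  exact ((hw ε hε).abs_integral_mul_sub_jumpPairing_le F.doubleWell.continuous
    (F.gibbsIntegrable ε hε) hd hψ hφw).trans_lt h_lt

end IsFamily

section Rayleigh

/-- The coefficient `A_k(u)` of the limit metric `g_u(v, w) = A_k(u) v w`. -/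
def metricDensity (k u : ℝ) : ℝ :=
  if u = 1 then 1 / k else Real.log (u / (2 - u)) / (2 * k * (u - 1))

variable {k u : ℝ}

lemma limitMetric_eq_metricDensity_mul (k u v w : ℝ) :
    limitMetric k u v w = metricDensity k u * (v * w) := by
  unfold limitMetric metricDensity
  split_ifs <;> ring

lemma measurable_metricDensity (k : ℝ) : Measurable (metricDensity k) := by
  unfold metricDensity
  exact Measurable.ite (measurableSet_singleton 1) measurable_const (by fun_prop)

lemma metricDensity_two_sub (k u : ℝ) : metricDensity k (2 - u) = metricDensity k u := by
  have h_one : 2 - u = 1 ↔ u = 1 := by constructor <;> intro h <;> linarith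
  simp only [metricDensity, h_one, sub_sub_cancel]
  rw [← inv_div u, Real.log_inv, show 2 * k * (2 - u - 1) = -(2 * k * (u - 1)) by ring,
    neg_div_neg_eq]

lemma metricDensity_nonneg (hk : 0 ≤ k) (hu : u ∈ Ioo (0 : ℝ) 2) : 0 ≤ metricDensity k u := by
  wlog h : 1 ≤ u generalizing u
  · rw [← metricDensity_two_sub]
    exact this ⟨by linarith [hu.2], by linarith [hu.1]⟩ (by linarith)
  rw [metricDensity]
  split_ifs
  · positivity
  · have h_log := Real.log_nonneg ((one_le_div (sub_pos.2 hu.2)).2 (by linarith : 2 - u ≤ u))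
    exact div_nonneg h_log (mul_nonneg (by positivity) (sub_nonneg.2 h))

lemma metricDensity_le {δ : ℝ} (hk : 0 < k) (hδ : 0 < δ) (hu : u ∈ Icc δ (2 - δ)) :
    metricDensity k u ≤ 1 / (k * δ) := by
  wlog h : 1 ≤ u generalizing u
  · rw [← metricDensity_two_sub]
    exact this ⟨by linarith [hu.2], by linarith [hu.1]⟩ (by linarith)
  have h_two : δ ≤ 2 - u := by linarith [hu.2]
  rw [metricDensity]
  split_ifs with h_one
  · exact one_div_le_one_div_of_le (by positivity) (mul_le_of_le_one_right hk.le (by linarith))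
  · have h_pos : 0 < u - 1 := sub_pos.2 (lt_of_le_of_ne h (Ne.symm h_one))
    have h_pos' : 0 < 2 - u := hδ.trans_le h_two
    rw [div_le_iff₀ (by positivity)]
    calc Real.log (u / (2 - u)) ≤ u / (2 - u) - 1 :=
          Real.log_le_sub_one_of_pos (div_pos (by linarith) h_pos')
      _ = 2 * (u - 1) / (2 - u) := by field_simp; ring
      _ ≤ 2 * (u - 1) / δ := by gcongr
      _ = 1 / (k * δ) * (2 * k * (u - 1)) := by field_simp

lemma deriv_limitEnergy (hk : k ≠ 0) (hu : u ∈ Ioo (0 : ℝ) 2) :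
    deriv limitEnergy u = metricDensity k u * (k * (u - 1)) := by
  have h0 : u ≠ 0 := hu.1.ne'
  have h2 : 2 - u ≠ 0 := (sub_pos.2 hu.2).ne'
  have h_deriv : HasDerivAt limitEnergy ((1 / 2) * ((1 * Real.log u + u * u⁻¹) +
      (-1 * Real.log (2 - u) + (2 - u) * (-1 / (2 - u))))) u := by
    have h_sub : HasDerivAt (fun x : ℝ => 2 - x) (-1) u := (hasDerivAt_id u).const_sub 2
    exact (((hasDerivAt_id u).mul (Real.hasDerivAt_log h0)).add
      (h_sub.mul (h_sub.log h2))).const_mul (1 / 2)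
  rw [h_deriv.deriv, metricDensity]
  split_ifs with h_one
  · subst h_one; norm_num
  · have := sub_ne_zero.2 h_one
    rw [Real.log_div h0 h2]
    field_simp
    ring

lemma rayleighDensity_eq (hk : k ≠ 0) (hu : u ∈ Ioo (0 : ℝ) 2) (v : ℝ) :
    rayleighDensity k u v = metricDensity k u * ((1 / 2) * v ^ 2 + k * (u - 1) * v) := by
  rw [rayleighDensity, limitMetric_eq_metricDensity_mul, deriv_limitEnergy hk hu]
  ring

lemma rayleighDensity_velocity_le (hk : 0 < k) (hu : u ∈ Ioo (0 : ℝ) 2) (v : ℝ) :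
    rayleighDensity k u (-k * (u - 1)) ≤ rayleighDensity k u v := by
  rw [rayleighDensity_eq hk.ne' hu, rayleighDensity_eq hk.ne' hu]
  refine mul_le_mul_of_nonneg_left ?_ (metricDensity_nonneg hk.le hu)
  linarith [sq_nonneg (v + k * (u - 1))]

lemma limitMetric_velocity_add_deriv_limitEnergy (hk : k ≠ 0) (hu : u ∈ Ioo (0 : ℝ) 2) (v : ℝ) :
    limitMetric k u (-k * (u - 1)) v + deriv limitEnergy u * v = 0 := by
  rw [limitMetric_eq_metricDensity_mul, deriv_limitEnergy hk hu]
  ring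

lemma abs_rayleighDensity_le {δ : ℝ} (hk : 0 < k) (hδ : 0 < δ) (hu : u ∈ Icc δ (2 - δ)) (v : ℝ) :
    |rayleighDensity k u v| ≤ 1 / (k * δ) * ((1 / 2) * v ^ 2 + k * |v|) := by
  have hu' : u ∈ Ioo (0 : ℝ) 2 := ⟨by linarith [hu.1], by linarith [hu.2]⟩
  have h_one : |u - 1| ≤ 1 := abs_le.2 ⟨by linarith [hu'.1], by linarith [hu'.2]⟩
  rw [rayleighDensity_eq hk.ne' hu', abs_mul, abs_of_nonneg (metricDensity_nonneg hk.le hu')]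
  refine mul_le_mul (metricDensity_le hk hδ hu) ?_ (abs_nonneg _) (by positivity)
  calc |(1 / 2) * v ^ 2 + k * (u - 1) * v| ≤ |(1 / 2) * v ^ 2| + |k * (u - 1) * v| :=
        abs_add_le _ _
    _ = (1 / 2) * v ^ 2 + k * |u - 1| * |v| := by
        rw [abs_of_nonneg (by positivity : 0 ≤ (1 / 2) * v ^ 2), abs_mul, abs_mul, abs_of_pos hk]
    _ ≤ (1 / 2) * v ^ 2 + k * 1 * |v| := by gcongr
    _ = (1 / 2) * v ^ 2 + k * |v| := by rw [mul_one]

variable {T δ : ℝ} {u d v : ℝ → ℝ}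

lemma integrableOn_rayleighDensity (hk : 0 < k) (hδ : 0 < δ)
    (hu : AEMeasurable u (volume.restrict (Ioo 0 T)))
    (hu_mem : ∀ t ∈ Icc 0 T, u t ∈ Icc δ (2 - δ)) (hv : MemLp v 2 (volume.restrict (Ioo 0 T))) :
    IntegrableOn (fun t => rayleighDensity k (u t) (v t)) (Ioo 0 T) := by
  have hv_meas := hv.aestronglyMeasurable.aemeasurable
  have h_meas : AEMeasurable (fun t => rayleighDensity k (u t) (v t))
      (volume.restrict (Ioo 0 T)) := by
    have h_energy := (measurable_deriv limitEnergy).comp_aemeasurable hu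
    have h_metric := (measurable_metricDensity k).comp_aemeasurable hu
    simp only [rayleighDensity, limitMetric_eq_metricDensity_mul]
    exact ((h_metric.mul (hv_meas.mul hv_meas)).const_mul _).add (h_energy.mul hv_meas)
  have h_dom : Integrable (fun t => 1 / (k * δ) * ((1 / 2) * v t ^ 2 + k * |v t|))
      (volume.restrict (Ioo 0 T)) :=
    ((hv.integrable_sq.const_mul _).add ((hv.integrable one_le_two).abs.const_mul k)).const_mul _
  refine h_dom.mono' h_meas.aestronglyMeasurable ?_
  filter_upwards [ae_restrict_mem measurableSet_Ioo] with t ht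
  exact abs_rayleighDensity_le hk hδ (hu_mem t (Ioo_subset_Icc_self ht)) (v t)

lemma isRayleighMinimizer_of_ae_eq (hk : 0 < k) (hδ : 0 < δ)
    (hu : AEMeasurable u (volume.restrict (Ioo 0 T)))
    (hu_mem : ∀ t ∈ Icc 0 T, u t ∈ Icc δ (2 - δ)) (hd : MemLp d 2 (volume.restrict (Ioo 0 T)))
    (hd_eq : ∀ᵐ t ∂(volume.restrict (Ioo 0 T)), d t = -k * (u t - 1)) :
    IsRayleighMinimizer k T u d := by
  refine ⟨hd, integrableOn_rayleighDensity hk hδ hu hu_mem hd, fun v hv =>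
    ⟨integrableOn_rayleighDensity hk hδ hu hu_mem hv, integral_mono_ae
      (integrableOn_rayleighDensity hk hδ hu hu_mem hd)
      (integrableOn_rayleighDensity hk hδ hu hu_mem hv) ?_⟩⟩
  filter_upwards [hd_eq, ae_restrict_mem measurableSet_Ioo] with t hdt ht
  obtain ⟨h_left, h_right⟩ := hu_mem t (Ioo_subset_Icc_self ht)
  rw [hdt]
  exact rayleighDensity_velocity_le hk ⟨by linarith, by linarith⟩ _

lemma isLimitGradientFlow_of_hasDerivWithinAt (hk : k ≠ 0)
    (hu_mem : ∀ t ∈ Icc 0 T, u t ∈ Ioo (0 : ℝ) 2)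
    (hu : ∀ t ∈ Icc 0 T, HasDerivWithinAt u (-k * (u t - 1)) (Icc 0 T) t) :
    IsLimitGradientFlow k T u := fun t ht =>
  ⟨hu_mem t ht, _, hu t ht, limitMetric_velocity_add_deriv_limitEnergy hk (hu_mem t ht)⟩

end Rayleigh

lemma limitCurve_zero (k : ℝ) (μ0 : Measure ℝ) : limitCurve k μ0 0 = 2 * μ0.real (Ioi 0) := by
  simp [limitCurve]

lemma hasDerivWithinAt_of_eqOn_limitCurve {k : ℝ} {μ0 : Measure ℝ} {s : Set ℝ} {u : ℝ → ℝ}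
    (hu : EqOn u (limitCurve k μ0) s) {t : ℝ} (ht : t ∈ s) :
    HasDerivWithinAt u (-k * (u t - 1)) s t := by
  rw [hu ht]
  exact (hasDerivAt_limitCurve k μ0 t).hasDerivWithinAt.congr hu (hu ht)

lemma ae_eq_velocity_of_eqOn_limitCurve {k : ℝ} {μ0 : Measure ℝ} {Ω : Set ℝ} {u du : ℝ → ℝ}
    (hΩ : IsOpen Ω) (hdu : HasWeakDerivOn u du Ω) (hu : EqOn u (limitCurve k μ0) Ω) :
    ∀ᵐ t ∂(volume.restrict Ω), du t = -k * (u t - 1) := by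
  have h_limit := (hasWeakDerivOn_limitCurve k μ0 Ω).congr hΩ.measurableSet hu.symm
  filter_upwards [hdu.ae_eq hΩ h_limit, ae_restrict_mem hΩ.measurableSet] with t hdt ht
  rw [hdt, hu ht]

namespace IsFamily

variable {H : ℝ → ℝ} {ε₀ C c : ℝ} {ρ0 : ℝ → ℝ → ℝ} {ρ : ℝ → ℝ → ℝ → ℝ} {μ0 : Measure ℝ}
  [IsProbabilityMeasure μ0] {T : ℝ} {e : ℕ → ℝ} {u du : ℝ → ℝ}

lemma tendsto_density (F : IsFamily H ε₀ C c ρ0 ρ μ0) (he : Tendsto e atTop (𝓝[>] 0)) {t : ℝ}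
    (ht : 0 ≤ t) (ψ : ℝ →ᵇ ℝ) :
    Tendsto (fun n => ∫ x, ρ (e n) t x * ψ x) atTop
      (𝓝 ((1 / 2) * (limitCurve (rate H) μ0 t * ψ 1 +
        (2 - limitCurve (rate H) μ0 t) * ψ (-1)))) :=
  (F.tendsto_integral_mul ht ψ.continuous.measurable ψ.norm_coe_le_norm
    ψ.continuous.continuousAt ψ.continuous.continuousAt).comp he

lemma isLimit_limitCurve (F : IsFamily H ε₀ C c ρ0 ρ μ0) (hT : 0 ≤ T)
    (he_mem : ∀ n, e n ∈ Ioo 0 ε₀) (he : Tendsto e atTop (𝓝[>] 0)) :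
    IsLimit H T ρ e (limitCurve (rate H) μ0)
      fun t => -rate H * (limitCurve (rate H) μ0 t - 1) where
  memLp := memLp_Ioo_of_continuous (contDiff_limitCurve _ _).continuous 0 T
  memLp_deriv := memLp_Ioo_of_continuous (continuous_limitCurve_velocity _ _) 0 T
  weak_deriv := hasWeakDerivOn_limitCurve _ _ _
  mass n _ ht := F.integral_eq_one (he_mem n) ht.1
  tendsto_density _ ht ψ := F.tendsto_density he ht.1 ψ
  tendsto_time_deriv := by
    choose! w hw using fun ε (hε : ε ∈ Ioo 0 ε₀) =>
      (F.isSolution ε hε).exists_isTimeDeriv F.doubleWell.smooth hε.1 (F.gibbsIntegrable ε hε)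
        (F.wellPrepared ε hε) hT
    exact ⟨fun n => w (e n), fun n =>
      ⟨(hw _ (he_mem n)).memL2Strip, (hw _ (he_mem n)).hasWeakTimeDeriv⟩,
      fun ψ => (F.tendsto_time_deriv hT hw (IsWellTest.of_boundedContinuous ψ)).comp he⟩

lemma eqOn_limitCurve (F : IsFamily H ε₀ C c ρ0 ρ μ0) (he : Tendsto e atTop (𝓝[>] 0))
    (hu : IsLimit H T ρ e u du) : EqOn u (limitCurve (rate H) μ0) (Icc 0 T) := fun t ht => by
  -- Any bounded continuous function separating the wells determines `u t`.
  let ψ : ℝ →ᵇ ℝ := .ofNormedAddCommGroup Real.sin Real.continuous_sin 1 Real.abs_sin_le_one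
  have h_eq := tendsto_nhds_unique (hu.tendsto_density t ht ψ) (F.tendsto_density he ht.1 ψ)
  have h_sin := Real.sin_pos_of_pos_of_le_one one_pos le_rfl
  simp only [ψ, BoundedContinuousFunction.coe_ofNormedAddCommGroup, Real.sin_neg] at h_eq
  exact mul_right_cancel₀ h_sin.ne' (by linarith)

lemma limitCurve_mem_Icc (F : IsFamily H ε₀ C c ρ0 ρ μ0) {t : ℝ} (ht : 0 ≤ t) :
    limitCurve (rate H) μ0 t ∈ Icc c (2 - c) := by
  obtain ⟨h_left, h_right⟩ := F.mass_bounds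
  have h_exp : Real.exp (-rate H * t) ≤ 1 := Real.exp_le_one_iff.2
    (by linarith [mul_nonneg F.doubleWell.rate_pos.le ht])
  have h_exp_pos := Real.exp_pos (-rate H * t)
  unfold limitCurve
  constructor <;> nlinarith

end IsFamily

end KramersLimit

end

theorem mainTheorem2 (H : ℝ → ℝ) (hH : KramersLimit.IsDoubleWell H)
    (ε₀ : ℝ) (hε₀ : 0 < ε₀)
    (hint : ∀ ε ∈ Ioo 0 ε₀, Integrable (fun x => Real.exp (-H x / ε ^ 2)))
    (ρ0 : ℝ → ℝ → ℝ) (ρ : ℝ → ℝ → ℝ → ℝ)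
    (hsol : ∀ ε ∈ Ioo 0 ε₀, KramersLimit.IsSolution H ε (ρ0 ε) (ρ ε))
    (C c : ℝ) (hc : 0 < c)
    (hwp : ∀ ε ∈ Ioo 0 ε₀, KramersLimit.WellPrepared H ε C c (ρ0 ε))
    (μ0 : Measure ℝ) [IsProbabilityMeasure μ0]
    (hinit : ∀ ψ : ℝ →ᵇ ℝ,
      Tendsto (fun ε => ∫ x, ρ0 ε x * ψ x) (𝓝[>] 0) (𝓝 (∫ x, ψ x ∂μ0)))
    (T : ℝ) (hT : 0 < T) :
    (∀ e : ℕ → ℝ, (∀ n, e n ∈ Ioo 0 ε₀) → Tendsto e atTop (𝓝 0) →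
      ∃ φ : ℕ → ℕ, StrictMono φ ∧ ∃ u du : ℝ → ℝ,
        KramersLimit.IsLimit H T ρ (e ∘ φ) u du) ∧
    (∀ e : ℕ → ℝ, (∀ n, e n ∈ Ioo 0 ε₀) → Tendsto e atTop (𝓝 0) →
      ∀ u du : ℝ → ℝ, KramersLimit.IsLimit H T ρ e u du →
        (∃ δ > 0, ∀ t ∈ Icc 0 T, δ ≤ u t ∧ u t ≤ 2 - δ) ∧
        KramersLimit.IsRayleighMinimizer (KramersLimit.rate H) T u du ∧
        KramersLimit.IsLimitGradientFlow (KramersLimit.rate H) T u ∧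
        (∀ᵐ t ∂(volume.restrict (Ioo 0 T)), du t = -KramersLimit.rate H * (u t - 1)) ∧
        (∀ t ∈ Icc 0 T,
          HasDerivWithinAt u (-KramersLimit.rate H * (u t - 1)) (Icc 0 T) t) ∧
        u 0 = 2 * μ0.real (Ioi 0)) := by
  have F : KramersLimit.IsFamily H ε₀ C c ρ0 ρ μ0 := ⟨hH, hε₀, hint, hsol, hc, hwp, hinit⟩
  have hk := hH.rate_pos
  have h_right : ∀ e : ℕ → ℝ, (∀ n, e n ∈ Ioo 0 ε₀) → Tendsto e atTop (𝓝 0) →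
      Tendsto e atTop (𝓝[>] 0) := fun e he_mem he =>
    tendsto_nhdsWithin_iff.2 ⟨he, .of_forall fun n => (he_mem n).1⟩
  refine ⟨fun e he_mem he => ⟨id, strictMono_id, _, _,
    F.isLimit_limitCurve hT.le he_mem (h_right e he_mem he)⟩, fun e he_mem he u du hu => ?_⟩
  have hu_eq : EqOn u (KramersLimit.limitCurve (KramersLimit.rate H) μ0) (Icc 0 T) :=
    F.eqOn_limitCurve (h_right e he_mem he) hu
  have hu_mem : ∀ t ∈ Icc 0 T, u t ∈ Icc c (2 - c) := fun t ht =>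
    hu_eq ht ▸ F.limitCurve_mem_Icc ht.1
  have hu_deriv := fun t => KramersLimit.hasDerivWithinAt_of_eqOn_limitCurve hu_eq (t := t)
  have hdu := KramersLimit.ae_eq_velocity_of_eqOn_limitCurve isOpen_Ioo hu.weak_deriv
    (hu_eq.mono Ioo_subset_Icc_self)
  refine ⟨⟨c, hc, hu_mem⟩, ?_, ?_, hdu, hu_deriv, ?_⟩
  · exact KramersLimit.isRayleighMinimizer_of_ae_eq hk hc hu.memLp.aestronglyMeasurable.aemeasurable
      hu_mem hu.memLp_deriv hdu
  · exact KramersLimit.isLimitGradientFlow_of_hasDerivWithinAt hk.ne'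
      (fun t ht => Icc_subset_Ioo hc (sub_lt_self 2 hc) (hu_mem t ht)) hu_deriv
  · rw [hu_eq (left_mem_Icc.2 hT.le), KramersLimit.limitCurve_zero]
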